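/- An existential first-order sentence over posets is a sentence $\varphi=\exists x_1\cdots\exists x_q\,\psi(x_1,\dots,x_q)$ where $\psi$ is built with $\wedge$ and $\vee$ from atoms $x_i=x_j$, $x_i\le x_j$ and negated atoms; $|\varphi|$ is its number of symbols. The width of a finite poset is the maximum cardinality of an antichain. **Theorem.** The problem of deciding, for a given existential first-order sentence $\varphi$ and a given finite poset $\mathcal P=(P,\le^P)$, whether $\mathcal P\models\varphi$, is fixed-parameter tractable with respect to $|\varphi|$ and the width of $\mathcal P$. Precisely, there are a single algorithm, a computable function $h:\mathbb N\times\mathbb N\to\mathbb N$ and a constant $C$ such that for every existential first-order sentence $\varphi$ and every finite poset $\mathcal P$ with $n$ elements and width $w$, the algorithm, given $\varphi$ and the $n\times n$ table of $\le^P$, decides correctly whether $\mathcal P\models\varphi$ in at most $h(|\varphi|,w)\cdot C\cdot\max(n,1)^2$ steps. Here an algorithm is a program of a random access machine with addition, truncated subtraction, halving and indirect addressing, under the uniform cost measure. -/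

import Mathlib

/-! ## Existential first-order sentences over the vocabulary `{≤}` -/

/-- Quantifier-free formulas in the variables `x_0, …, x_{q-1}`, with negations only in front of
atoms; the atoms are `x_i = x_j` and `x_i ≤ x_j`. -/
inductive QFFormula (q : ℕ) : Type
  | eq (i j : Fin q) : QFFormula q
  | le (i j : Fin q) : QFFormula q
  | ne (i j : Fin q) : QFFormula q
  | nle (i j : Fin q) : QFFormula q
  | and (ψ₁ ψ₂ : QFFormula q) : QFFormula q
  | or (ψ₁ ψ₂ : QFFormula q) : QFFormula q

namespace QFFormula

/-- Number of symbols of a quantifier-free formula. -/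
def size {q : ℕ} : QFFormula q → ℕ
  | eq _ _ => 3
  | le _ _ => 3
  | ne _ _ => 4
  | nle _ _ => 4
  | and ψ₁ ψ₂ => ψ₁.size + ψ₂.size + 1
  | or ψ₁ ψ₂ => ψ₁.size + ψ₂.size + 1

/-- Reverse Polish notation, as a list of numbers. -/
def encode {q : ℕ} : QFFormula q → List ℕ
  | eq i j => [0, (i : ℕ), (j : ℕ)]
  | le i j => [1, (i : ℕ), (j : ℕ)]
  | ne i j => [2, (i : ℕ), (j : ℕ)]
  | nle i j => [3, (i : ℕ), (j : ℕ)]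
  | and ψ₁ ψ₂ => ψ₁.encode ++ ψ₂.encode ++ [4]
  | or ψ₁ ψ₂ => ψ₁.encode ++ ψ₂.encode ++ [5]

/-- The formula as a first-order formula of Mathlib, in the language of orders. -/
def toFormula {q : ℕ} : QFFormula q → FirstOrder.Language.order.BoundedFormula Empty q
  | eq i j => FirstOrder.Language.Term.bdEqual
      (FirstOrder.Language.Term.var (Sum.inr i)) (FirstOrder.Language.Term.var (Sum.inr j))
  | le i j => FirstOrder.Language.Term.le
      (FirstOrder.Language.Term.var (Sum.inr i)) (FirstOrder.Language.Term.var (Sum.inr j))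
  | ne i j => (FirstOrder.Language.Term.bdEqual
      (FirstOrder.Language.Term.var (Sum.inr i)) (FirstOrder.Language.Term.var (Sum.inr j))).not
  | nle i j => (FirstOrder.Language.Term.le
      (FirstOrder.Language.Term.var (Sum.inr i)) (FirstOrder.Language.Term.var (Sum.inr j))).not
  | and ψ₁ ψ₂ => ψ₁.toFormula ⊓ ψ₂.toFormula
  | or ψ₁ ψ₂ => ψ₁.toFormula ⊔ ψ₂.toFormula

end QFFormula

/-- Existential first-order sentences `∃ x_0 … ∃ x_{q-1}. ψ` in prefix normal form. -/
structure ExSentence : Type where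
  /-- the number of quantifiers -/
  q : ℕ
  /-- the quantifier-free part -/
  body : QFFormula q

namespace ExSentence

/-- `|φ|`: the number of symbols of the sentence. -/
def size (φ : ExSentence) : ℕ := 2 * φ.q + φ.body.size

/-- The sentence as a first-order sentence of Mathlib, in the language of orders. -/
def toSentence (φ : ExSentence) : FirstOrder.Language.order.Sentence := φ.body.toFormula.exs

/-- `P ⊨ φ`, where the relation symbol is interpreted by the order of `P`. -/
def Models (P : Type*) [PartialOrder P] (φ : ExSentence) : Prop :=
  @FirstOrder.Language.Sentence.Realize FirstOrder.Language.order P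
    (FirstOrder.Language.orderStructure P) φ.toSentence

end ExSentence

/-! ## Width -/

/-- The width of a finite poset: the maximum cardinality of an antichain. -/
noncomputable def posetWidth (P : Type*) [PartialOrder P] : ℕ :=
  sSup {k : ℕ | ∃ A : Finset P, IsAntichain (· ≤ ·) (A : Set P) ∧ A.card = k}

/-! ## Random access machines with uniform cost -/

/-- Instructions of a random access machine. Registers and memory cells hold natural numbers;
the only arithmetic operations are addition, truncated subtraction and halving. -/
inductive RamInstr : Type
  /-- `R_d := c` -/
  | const (d c : ℕ) : RamInstr
  /-- `R_d := R_a` -/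
  | move (d a : ℕ) : RamInstr
  /-- `R_d := R_a + R_b` -/
  | add (d a b : ℕ) : RamInstr
  /-- `R_d := max (R_a - R_b) 0` -/
  | sub (d a b : ℕ) : RamInstr
  /-- `R_d := ⌊R_a / 2⌋` -/
  | half (d a : ℕ) : RamInstr
  /-- `R_d := M[R_a]` -/
  | load (d a : ℕ) : RamInstr
  /-- `M[R_a] := R_b` -/
  | store (a b : ℕ) : RamInstr
  /-- continue with instruction number `l` -/
  | jump (l : ℕ) : RamInstr
  /-- continue with instruction number `l` if `R_a = 0`, otherwise with the next instruction -/
  | jzero (a l : ℕ) : RamInstr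

/-- A program is a finite list of instructions, numbered from `0`. In particular it uses only
finitely many registers, whatever the input is. -/
abbrev RamProg : Type := List RamInstr

/-- A configuration: program counter, registers, memory. -/
structure RamConfig : Type where
  pc : ℕ
  reg : ℕ → ℕ
  mem : ℕ → ℕ

namespace RamInstr

/-- The effect of one instruction. -/
def exec (c : RamConfig) : RamInstr → RamConfig
  | const d k => ⟨c.pc + 1, Function.update c.reg d k, c.mem⟩
  | move d a => ⟨c.pc + 1, Function.update c.reg d (c.reg a), c.mem⟩
  | add d a b => ⟨c.pc + 1, Function.update c.reg d (c.reg a + c.reg b), c.mem⟩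
  | sub d a b => ⟨c.pc + 1, Function.update c.reg d (c.reg a - c.reg b), c.mem⟩
  | half d a => ⟨c.pc + 1, Function.update c.reg d (c.reg a / 2), c.mem⟩
  | load d a => ⟨c.pc + 1, Function.update c.reg d (c.mem (c.reg a)), c.mem⟩
  | store a b => ⟨c.pc + 1, c.reg, Function.update c.mem (c.reg a) (c.reg b)⟩
  | jump l => ⟨l, c.reg, c.mem⟩
  | jzero a l => ⟨if c.reg a = 0 then l else c.pc + 1, c.reg, c.mem⟩

end RamInstr

namespace RamProg

/-- The machine halts when the program counter points to no instruction. -/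
def Halted (p : RamProg) (c : RamConfig) : Prop := p.length ≤ c.pc

/-- One step of the machine; a halted machine does not move. -/
def step (p : RamProg) (c : RamConfig) : RamConfig :=
  match p[c.pc]? with
  | some i => i.exec c
  | none => c

/-- The initial configuration: the input is written in the memory cells `0, 1, 2, …`, everything
else is `0`. -/
def init (x : List ℕ) : RamConfig := ⟨0, fun _ => 0, fun a => x.getD a 0⟩

/-- On input `x` the program halts after at most `T` steps with the number `y` in register `0`. -/
def OutputsWithin (p : RamProg) (x : List ℕ) (y T : ℕ) : Prop :=
  ∃ t ≤ T, p.Halted (p.step^[t] (init x)) ∧ (p.step^[t] (init x)).reg 0 = y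

end RamProg

/-! ## Instances of the model checking problem -/

open Classical in
/-- The 0/1-matrix of the order of an `n`-element poset, row by row, where `e` lists the
elements. -/
noncomputable def orderTable {P : Type*} [PartialOrder P] {n : ℕ} (e : Fin n ≃ P) : List ℕ :=
  (List.finRange n).flatMap fun i => (List.finRange n).map fun j => if e i ≤ e j then 1 else 0

/-- The input for a sentence `φ` and a poset with `n` elements listed by `e`: the number `n`, the
number of quantifiers, the length of the code of the quantifier-free part, the order table, and
the code of the quantifier-free part. -/
noncomputable def encodeInstance (φ : ExSentence) {P : Type*} [PartialOrder P] {n : ℕ}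
    (e : Fin n ≃ P) : List ℕ :=
  n :: φ.q :: φ.body.encode.length :: (orderTable e ++ φ.body.encode)

/-! A poset of width `w` is covered by `k ≤ w` chains. Once such a cover is known, one guesses for
the `q` variables which inequalities `x_i ≤ x_j` hold and in which chain each `x_i` lies; there are
`2 ^ (q * q + q * k)` guesses. For one guess the search is greedy. Every variable gets a pointer,
initially at the bottom of its chain. Let `s` be a solution that lies on or above the pointers in
the guessed chains. If `x_a ≰ x_b` is demanded but `ptr a ≤ ptr b`, then `s a = ptr a` would give `s
a ≤ ptr b ≤ s b`; if `x_b ≤ x_a` is demanded but `ptr b ≰ ptr a`, then `s a = ptr a` would give `ptr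
b ≤ s b ≤ ptr a`. In both cases pointer `a` can advance without losing `s`. Heights grow with every
advance, so after at most `q * n` advances either all demands hold, and the pointers are a solution,
or a chain is exhausted, and the guess has none.

The chain cover comes from the same search with the demand that all pointers be incomparable, in the
manner of Dilworth's theorem by augmenting paths. Elements are inserted one by one, each first as a
chain of its own. If the search stops at an antichain, the number of chains is at most the width. If
it runs off the end of a chain, the recorded reasons for the advances form an augmenting path, and
exchanging edges along it merges two chains. An insertion costs `O(w ^ 3 * n)`, hence the quadratic
total. The width is never computed; it enters the analysis only.

The program is written in a structured language whose loops have iteration counts fixed on entry, so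
that effect and cost are total functions, and it is compiled to machine code with an exact step
count (`PStmt.compile_correct`). The mathematical weight is carried by `phase_spec` (the pointer
search, for an arbitrary invariant), `exchange_spec` and `insertElement_spec` (the cover),
`tryGuess_spec` and `exists_goodGuess` (the guesses). -/

set_option linter.constructorNameAsVariable false
set_option linter.unusedSimpArgs false

/-! ## A structured language with total semantics, and its compilation -/

/-- Program variables. -/
inductive Var : Type
  | res | n | q | len | k | m | v | i | j | idx | acc | t | found | fi | fj | fail | last
  | finish | cur | x | y | bits | guess | size | ok | pos | sp | tok | val | hi | qq
  deriving DecidableEq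

/-- Arrays. -/
inductive Arr : Type
  | inp | row | prv | nxt | wit | tim | head | ptr | con | stk | qrow
  deriving DecidableEq

namespace Var

/-- Numbering of the program variables. -/
def code : Var → ℕ
  | res => 0 | n => 1 | q => 2 | len => 3 | k => 4 | m => 5 | v => 6 | i => 7 | j => 8
  | idx => 9 | acc => 10 | t => 11 | found => 12 | fi => 13 | fj => 14 | fail => 15
  | last => 16 | finish => 17 | cur => 18 | x => 19 | y => 20 | bits => 21 | guess => 22
  | size => 23 | ok => 24 | pos => 25 | sp => 26 | tok => 27 | val => 28 | hi => 29 | qq => 30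

theorem code_injective : Function.Injective code := by
  intro a b h
  cases a <;> cases b <;> first | rfl | (exact absurd h (by decide))

end Var

namespace Arr

/-- Numbering of the arrays. -/
def code : Arr → ℕ
  | inp => 0 | row => 1 | prv => 2 | nxt => 3 | wit => 4 | tim => 5 | head => 6 | ptr => 7
  | con => 8 | stk => 9 | qrow => 10

theorem code_injective : Function.Injective code := by
  intro a b h
  cases a <;> cases b <;> first | rfl | (exact absurd h (by decide))

theorem code_lt (a : Arr) : a.code < 16 := by cases a <;> decide

end Arr

/-- States of structured programs: values of the variables, and the memory. -/
structure PState : Type where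
  var : Var → ℕ
  mem : ℕ → ℕ

namespace PState

/-- Array `a` occupies the memory cells that are congruent to its number modulo `16`. -/
def arr (σ : PState) (a : Arr) (i : ℕ) : ℕ := σ.mem (16 * i + a.code)

/-- Assignment to a variable. -/
def setVar (σ : PState) (x : Var) (c : ℕ) : PState := ⟨Function.update σ.var x c, σ.mem⟩

/-- Assignment to an array cell. -/
def setArr (σ : PState) (a : Arr) (i c : ℕ) : PState :=
  ⟨σ.var, Function.update σ.mem (16 * i + a.code) c⟩

@[simp] theorem setVar_var (σ : PState) (x y : Var) (c : ℕ) :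
    (σ.setVar x c).var y = if y = x then c else σ.var y := by
  simp [setVar, Function.update_apply]

@[simp] theorem setVar_arr (σ : PState) (x : Var) (c : ℕ) (a : Arr) :
    (σ.setVar x c).arr a = σ.arr a := rfl

@[simp] theorem setVar_mem (σ : PState) (x : Var) (c : ℕ) :
    (σ.setVar x c).mem = σ.mem := rfl

@[simp] theorem setArr_var (σ : PState) (a : Arr) (i c : ℕ) :
    (σ.setArr a i c).var = σ.var := rfl

-- All array codes are below `16`, so distinct arrays occupy distinct residue classes of addresses
-- and a write to one is invisible in the others.
@[simp] theorem setArr_arr (σ : PState) (a b : Arr) (i c : ℕ) :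
    (σ.setArr a i c).arr b = if b = a then Function.update (σ.arr a) i c else σ.arr b := by
  funext j
  have ha := a.code_lt
  have hb := b.code_lt
  by_cases h : b = a
  · subst h
    by_cases hj : j = i
    · subst hj; simp [arr, setArr]
    · have : 16 * j + b.code ≠ 16 * i + b.code := by omega
      simp [arr, setArr, Function.update_apply, hj]
  · have hc : b.code ≠ a.code := fun e => h (Arr.code_injective e)
    have : 16 * j + b.code ≠ 16 * i + a.code := by omega
    simp [arr, setArr, Function.update_apply, h, this]

end PState

/-- Expressions. -/
inductive PExpr : Type
  | const (c : ℕ)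
  | var (x : Var)
  | add (a b : PExpr)
  | sub (a b : PExpr)
  | half (a : PExpr)
  | get (r : Arr) (a : PExpr)
  | raw (a : PExpr)

namespace PExpr

/-- The value of an expression. -/
def eval (σ : PState) : PExpr → ℕ
  | const c => c
  | var x => σ.var x
  | add a b => a.eval σ + b.eval σ
  | sub a b => a.eval σ - b.eval σ
  | half a => a.eval σ / 2
  | get r a => σ.arr r (a.eval σ)
  | raw a => σ.mem (a.eval σ)

/-- The number of machine instructions that evaluate the expression. -/
def cost : PExpr → ℕ
  | const _ => 1
  | var _ => 1
  | add a b => a.cost + b.cost + 1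
  | sub a b => a.cost + b.cost + 1
  | half a => a.cost + 1
  | get _ a => a.cost + 7
  | raw a => a.cost + 1

end PExpr

/-- Statements. -/
inductive PStmt : Type
  | skip
  | set (x : Var) (e : PExpr)
  | put (r : Arr) (i e : PExpr)
  | seq (s t : PStmt)
  | ite (e : PExpr) (s t : PStmt)
  | loop (e : PExpr) (s : PStmt)

namespace PStmt

/-- The effect of a statement; `loop e s` repeats `s` as often as the initial value of `e` says. -/
def run : PStmt → PState → PState
  | skip, σ => σ
  | set x e, σ => σ.setVar x (e.eval σ)
  | put r i e, σ => σ.setArr r (i.eval σ) (e.eval σ)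
  | seq s t, σ => t.run (s.run σ)
  | ite e s t, σ => if e.eval σ = 0 then t.run σ else s.run σ
  | loop e s, σ => s.run^[e.eval σ] σ

/-- The number of machine steps that a statement takes. -/
def cost : PStmt → PState → ℕ
  | skip, _ => 0
  | set _ e, _ => e.cost + 1
  | put _ i e, _ => i.cost + e.cost + 7
  | seq s t, σ => s.cost σ + t.cost (s.run σ)
  | ite e s t, σ => e.cost + if e.eval σ = 0 then 1 + t.cost σ else 2 + s.cost σ
  | loop e s, σ => e.cost + 2 + ∑ r ∈ Finset.range (e.eval σ), (s.cost (s.run^[r] σ) + 4)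

end PStmt

/-- The register of a program variable. -/
def varReg (x : Var) : ℕ := 3 * x.code

/-- The registers for intermediate results. -/
def tmpReg (d : ℕ) : ℕ := 3 * d + 1

/-- The registers for loop counters. -/
def cntReg (d : ℕ) : ℕ := 3 * d + 2

/-- Code that replaces `tmpReg d` by the address of cell number `tmpReg d` of array `r`. -/
def addrCode (r : Arr) (d : ℕ) : RamProg :=
  [.add (tmpReg d) (tmpReg d) (tmpReg d), .add (tmpReg d) (tmpReg d) (tmpReg d),
   .add (tmpReg d) (tmpReg d) (tmpReg d), .add (tmpReg d) (tmpReg d) (tmpReg d),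
   .const (tmpReg (d + 1)) r.code, .add (tmpReg d) (tmpReg d) (tmpReg (d + 1))]

/-- Code that evaluates an expression into `tmpReg d`. -/
def PExpr.compile : PExpr → ℕ → RamProg
  | const c, d => [.const (tmpReg d) c]
  | var x, d => [.move (tmpReg d) (varReg x)]
  | add a b, d => a.compile d ++ (b.compile (d + 1) ++ [.add (tmpReg d) (tmpReg d) (tmpReg (d + 1))])
  | sub a b, d => a.compile d ++ (b.compile (d + 1) ++ [.sub (tmpReg d) (tmpReg d) (tmpReg (d + 1))])
  | half a, d => a.compile d ++ [.half (tmpReg d) (tmpReg d)]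
  | get r a, d => a.compile d ++ (addrCode r d ++ [.load (tmpReg d) (tmpReg d)])
  | raw a, d => a.compile d ++ [.load (tmpReg d) (tmpReg d)]

/-- Code for a statement that starts at address `b`, inside `d` loops. -/
def PStmt.compile : PStmt → ℕ → ℕ → RamProg
  | skip, _, _ => []
  | set x e, _, _ => e.compile 0 ++ [.move (varReg x) (tmpReg 0)]
  | put r i e, _, _ => i.compile 0 ++ (addrCode r 0 ++
      (e.compile 1 ++ [.store (tmpReg 0) (tmpReg 1)]))
  | seq s t, b, d => s.compile b d ++ t.compile (b + (s.compile b d).length) d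
  | ite e s t, b, d =>
      let s' := s.compile (b + (e.compile 0).length + 1) d
      let b' := b + (e.compile 0).length + 1 + s'.length + 1
      let t' := t.compile b' d
      e.compile 0 ++ ([.jzero (tmpReg 0) b'] ++ (s' ++ ([.jump (b' + t'.length)] ++ t')))
  | loop e s, b, d =>
      let l := b + (e.compile 0).length + 1
      let s' := s.compile (l + 3) (d + 1)
      e.compile 0 ++ ([.move (cntReg d) (tmpReg 0)] ++ ([.jzero (cntReg d) (l + 3 + s'.length + 1),
        .const (tmpReg 0) 1, .sub (cntReg d) (cntReg d) (tmpReg 0)] ++ (s' ++ [.jump l])))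

/-! ### Correctness of the compilation -/

/-- The code `l` stands in the program `p` from address `b` on. -/
def CodeAt (p : RamProg) (b : ℕ) (l : RamProg) : Prop := ∀ i, ∀ h : i < l.length, p[b + i]? = some l[i]

theorem CodeAt.append_iff {p : RamProg} {b : ℕ} {l₁ l₂ : RamProg} :
    CodeAt p b (l₁ ++ l₂) ↔ CodeAt p b l₁ ∧ CodeAt p (b + l₁.length) l₂ := by
  constructor
  · intro h
    refine ⟨fun i hi => ?_, fun i hi => ?_⟩
    · rw [h i (by simp; omega), List.getElem_append_left hi]
    · rw [Nat.add_assoc, h (l₁.length + i) (by simp; omega), List.getElem_append_right (by omega)]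
      simp
  · rintro ⟨h₁, h₂⟩ i hi
    by_cases hl : i < l₁.length
    · rw [List.getElem_append_left hl, h₁ i hl]
    · have := h₂ (i - l₁.length) (by simp at hi; omega)
      rw [List.getElem_append_right (by omega), ← this]
      congr 1; omega

theorem CodeAt.step_eq {p : RamProg} {b : ℕ} {i : RamInstr} {l : RamProg} (h : CodeAt p b (i :: l))
    {c : RamConfig} (hc : c.pc = b) : p.step c = i.exec c := by
  have := h 0 (by simp)
  simp only [RamProg.step, hc]
  simp at this
  simp [this]

theorem CodeAt.tail {p : RamProg} {b : ℕ} {i : RamInstr} {l : RamProg} (h : CodeAt p b (i :: l)) :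
    CodeAt p (b + 1) l :=
  (CodeAt.append_iff (l₁ := [i]).1 h).2

/-- The machine state `c` represents the program state `σ`. -/
structure Represents (c : RamConfig) (σ : PState) : Prop where
  reg : ∀ x, c.reg (varReg x) = σ.var x
  mem : c.mem = σ.mem

theorem varReg_ne_tmpReg (x : Var) (d : ℕ) : varReg x ≠ tmpReg d := by
  simp only [varReg, tmpReg]; omega

theorem cntReg_ne_tmpReg (x d : ℕ) : cntReg x ≠ tmpReg d := by
  simp only [cntReg, tmpReg]; omega

theorem varReg_ne_cntReg (x : Var) (d : ℕ) : varReg x ≠ cntReg d := by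
  simp only [varReg, cntReg]; omega

theorem varReg_inj {x y : Var} : varReg x = varReg y ↔ x = y := by
  constructor
  · intro h
    apply Var.code_injective
    simp only [varReg] at h; omega
  · rintro rfl; rfl

/-- `c'` differs from `c` only in intermediate results from number `d` on, and in the program
counter. -/
structure SameBelow (d : ℕ) (c c' : RamConfig) : Prop where
  reg : ∀ r, (∀ d' ≥ d, r ≠ tmpReg d') → c'.reg r = c.reg r
  mem : c'.mem = c.mem

theorem tmpReg_inj {a b : ℕ} : tmpReg a = tmpReg b ↔ a = b := by
  simp only [tmpReg]; omega

theorem SameBelow.trans {d : ℕ} {c c' c'' : RamConfig} (h : SameBelow d c c')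
    (h' : SameBelow d c' c'') : SameBelow d c c'' :=
  ⟨fun r hr => (h'.reg r hr).trans (h.reg r hr), h'.mem.trans h.mem⟩

theorem SameBelow.mono {d d' : ℕ} (hd : d' ≤ d) {c c' : RamConfig} (h : SameBelow d c c') :
    SameBelow d' c c' :=
  ⟨fun r hr => h.reg r fun e he => hr e (hd.trans he), h.mem⟩

theorem SameBelow.update {d d' : ℕ} (hd : d ≤ d') (c : RamConfig) (pc v : ℕ) :
    SameBelow d c ⟨pc, Function.update c.reg (tmpReg d') v, c.mem⟩ :=
  ⟨fun r hr => by simp [Function.update_apply, hr d' hd], rfl⟩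

theorem SameBelow.represents {d : ℕ} {c c' : RamConfig} {σ : PState} (h : SameBelow d c c')
    (hc : Represents c σ) : Represents c' σ :=
  ⟨fun x => (h.reg _ fun _ _ => varReg_ne_tmpReg _ _).trans (hc.reg x), h.mem.trans hc.mem⟩

theorem SameBelow.cnt {d : ℕ} {c c' : RamConfig} (h : SameBelow d c c') (x : ℕ) :
    c'.reg (cntReg x) = c.reg (cntReg x) :=
  h.reg _ fun _ _ => cntReg_ne_tmpReg _ _

/-- `p` goes from `c` to `c'` in `t` steps. -/
def Steps (p : RamProg) (c c' : RamConfig) (t : ℕ) : Prop := p.step^[t] c = c'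

theorem Steps.trans {p : RamProg} {c c' c'' : RamConfig} {t t' : ℕ} (h : Steps p c c' t)
    (h' : Steps p c' c'' t') : Steps p c c'' (t + t') := by
  simp only [Steps] at *
  rw [Nat.add_comm, Function.iterate_add_apply, h, h']

theorem Steps.single {p : RamProg} {c : RamConfig} {b : ℕ} {i : RamInstr} {l : RamProg}
    (h : CodeAt p b (i :: l)) (hc : c.pc = b) : Steps p c (i.exec c) 1 := by
  simp [Steps, h.step_eq hc]

theorem PExpr.length_compile (e : PExpr) (d : ℕ) : (e.compile d).length = e.cost := by
  induction e generalizing d <;> simp_all [PExpr.compile, PExpr.cost, addrCode] <;> omega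

/-- Four doublings multiply by `16`; this replaces the multiplication that the machine does not
have. -/
theorem addrCode_correct {p : RamProg} {b d : ℕ} {r : Arr} {c : RamConfig}
    (h : CodeAt p b (addrCode r d)) (hc : c.pc = b) :
    ∃ c', Steps p c c' 6 ∧ c'.pc = b + 6 ∧ SameBelow d c c' ∧
      c'.reg (tmpReg d) = 16 * c.reg (tmpReg d) + r.code := by
  have hne : tmpReg d ≠ tmpReg (d + 1) := by simp [tmpReg_inj]
  have h1 := h.tail
  have h2 := h1.tail
  have h3 := h2.tail
  have h4 := h3.tail
  have h5 := h4.tail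
  refine ⟨_, (((((Steps.single h hc).trans (Steps.single h1 ?_)).trans
    (Steps.single h2 ?_)).trans (Steps.single h3 ?_)).trans (Steps.single h4 ?_)).trans
    (Steps.single h5 ?_), ?_, ⟨?_, ?_⟩, ?_⟩
  any_goals simp [RamInstr.exec, hc]
  · intro x hx
    simp [Function.update_apply, hx d le_rfl, hx (d + 1) (by omega)]
  · simp [Function.update_apply, hne, hne.symm]
    ring

/-- Temporaries form a stack: the second operand is evaluated from level `d + 1` on, and `SameBelow`
guarantees that the first one survives in `tmpReg d`. -/
theorem PExpr.compile_correct (e : PExpr) {p : RamProg} {b d : ℕ} {c : RamConfig} {σ : PState}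
    (h : CodeAt p b (e.compile d)) (hc : c.pc = b) (hr : Represents c σ) :
    ∃ c', Steps p c c' e.cost ∧ c'.pc = b + e.cost ∧ SameBelow d c c' ∧
      c'.reg (tmpReg d) = e.eval σ := by
  induction e generalizing b d c with
  | const k =>
    exact ⟨_, Steps.single h hc, by simp [RamInstr.exec, hc, cost], SameBelow.update le_rfl _ _ _,
      by simp [RamInstr.exec, eval]⟩
  | var x =>
    exact ⟨_, Steps.single h hc, by simp [RamInstr.exec, hc, cost], SameBelow.update le_rfl _ _ _,
      by simp [RamInstr.exec, eval, hr.reg]⟩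
  | half a ih =>
    simp only [compile, CodeAt.append_iff, length_compile] at h
    obtain ⟨c₁, s₁, p₁, f₁, r₁⟩ := ih h.1 hc hr
    exact ⟨_, s₁.trans (Steps.single h.2 p₁), by simp [RamInstr.exec, p₁, cost, Nat.add_assoc],
      f₁.trans (SameBelow.update le_rfl _ _ _), by simp [RamInstr.exec, eval, r₁]⟩
  | raw a ih =>
    simp only [compile, CodeAt.append_iff, length_compile] at h
    obtain ⟨c₁, s₁, p₁, f₁, r₁⟩ := ih h.1 hc hr
    exact ⟨_, s₁.trans (Steps.single h.2 p₁), by simp [RamInstr.exec, p₁, cost, Nat.add_assoc],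
      f₁.trans (SameBelow.update le_rfl _ _ _),
      by simp [RamInstr.exec, eval, r₁, (f₁.represents hr).mem]⟩
  | get r a ih =>
    simp only [compile, CodeAt.append_iff, length_compile] at h
    obtain ⟨c₁, s₁, p₁, f₁, r₁⟩ := ih h.1 hc hr
    obtain ⟨c₂, s₂, p₂, f₂, r₂⟩ := addrCode_correct h.2.1 p₁
    refine ⟨_, (s₁.trans s₂).trans (Steps.single h.2.2 p₂), by simp [RamInstr.exec, p₂, cost, Nat.add_assoc],
      (f₁.trans f₂).trans (SameBelow.update le_rfl _ _ _), ?_⟩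
    simp [RamInstr.exec, eval, r₂, r₁, (f₂.represents (f₁.represents hr)).mem, PState.arr]
  | add a b' iha ihb =>
    simp only [compile, CodeAt.append_iff, length_compile] at h
    obtain ⟨c₁, s₁, p₁, f₁, r₁⟩ := iha h.1 hc hr
    obtain ⟨c₂, s₂, p₂, f₂, r₂⟩ := ihb h.2.1 p₁ (f₁.represents hr)
    refine ⟨_, (s₁.trans s₂).trans (Steps.single h.2.2 p₂),
      by simp [RamInstr.exec, p₂, cost, Nat.add_assoc],
      (f₁.trans (f₂.mono (by omega))).trans (SameBelow.update le_rfl _ _ _), ?_⟩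
    have := f₂.reg (tmpReg d) fun d' hd' => by simp only [ne_eq, tmpReg_inj]; omega
    simp [RamInstr.exec, eval, r₂, r₁, this]
  | sub a b' iha ihb =>
    simp only [compile, CodeAt.append_iff, length_compile] at h
    obtain ⟨c₁, s₁, p₁, f₁, r₁⟩ := iha h.1 hc hr
    obtain ⟨c₂, s₂, p₂, f₂, r₂⟩ := ihb h.2.1 p₁ (f₁.represents hr)
    refine ⟨_, (s₁.trans s₂).trans (Steps.single h.2.2 p₂),
      by simp [RamInstr.exec, p₂, cost, Nat.add_assoc],
      (f₁.trans (f₂.mono (by omega))).trans (SameBelow.update le_rfl _ _ _), ?_⟩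
    have := f₂.reg (tmpReg d) fun d' hd' => by simp only [ne_eq, tmpReg_inj]; omega
    simp [RamInstr.exec, eval, r₂, r₁, this]

/-- The last clause makes nested loops work: a loop at depth `d` has its body compiled at depth `d +
1`, so the induction hypothesis says that the body leaves the counter `cntReg d` alone. -/
theorem PStmt.compile_correct (s : PStmt) {p : RamProg} {b d : ℕ} {c : RamConfig} {σ : PState}
    (h : CodeAt p b (s.compile b d)) (hc : c.pc = b) (hr : Represents c σ) :
    ∃ c', Steps p c c' (s.cost σ) ∧ c'.pc = b + (s.compile b d).length ∧ Represents c' (s.run σ) ∧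
      ∀ k < d, c'.reg (cntReg k) = c.reg (cntReg k) := by
  induction s generalizing b d c σ with
  | skip => exact ⟨c, rfl, by simp [compile, hc], hr, fun _ _ => rfl⟩
  | set x e =>
    simp only [compile, CodeAt.append_iff, PExpr.length_compile] at h
    obtain ⟨c₁, s₁, p₁, f₁, r₁⟩ := e.compile_correct h.1 hc hr
    have hr₁ := f₁.represents hr
    refine ⟨_, s₁.trans (Steps.single h.2 p₁),
      by simp [RamInstr.exec, p₁, compile, PExpr.length_compile, Nat.add_assoc], ⟨?_, ?_⟩, ?_⟩
    · intro y
      simp [RamInstr.exec, run, Function.update_apply, varReg_inj, r₁, hr₁.reg]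
    · simp [RamInstr.exec, run, hr₁.mem]
    · intro k _
      simp [RamInstr.exec, Function.update_apply, (varReg_ne_cntReg x k).symm, f₁.cnt]
  | put r i e =>
    simp only [compile, CodeAt.append_iff, PExpr.length_compile] at h
    obtain ⟨c₁, s₁, p₁, f₁, r₁⟩ := i.compile_correct h.1 hc hr
    obtain ⟨c₂, s₂, p₂, f₂, r₂⟩ := addrCode_correct h.2.1 p₁
    have hr₂ := f₂.represents (f₁.represents hr)
    obtain ⟨c₃, s₃, p₃, f₃, r₃⟩ := e.compile_correct h.2.2.1 (by simp [p₂, addrCode]) hr₂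
    have hr₃ := f₃.represents hr₂
    have h0 := f₃.reg (tmpReg 0) fun d' hd' => by simp only [ne_eq, tmpReg_inj]; omega
    refine ⟨(RamInstr.store (tmpReg 0) (tmpReg 1)).exec c₃, ?_, ?_, ⟨?_, ?_⟩, ?_⟩
    rotate_left
    · simp [RamInstr.exec, p₃, compile, PExpr.length_compile, addrCode]; omega
    · intro y
      simp [RamInstr.exec, run, hr₃.reg]
    · simp [RamInstr.exec, run, hr₃.mem, PState.setArr, h0, r₃, r₂, r₁]
    · intro k _
      simp [RamInstr.exec, f₃.cnt, f₂.cnt, f₁.cnt]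
    · have := ((s₁.trans s₂).trans s₃).trans (Steps.single h.2.2.2 (by simp [p₃, addrCode]))
      convert this using 1
      simp [cost]; omega
  | seq s t ihs iht =>
    simp only [compile, CodeAt.append_iff] at h
    obtain ⟨c₁, s₁, p₁, f₁, k₁⟩ := ihs h.1 hc hr
    obtain ⟨c₂, s₂, p₂, f₂, k₂⟩ := iht h.2 p₁ f₁
    exact ⟨c₂, s₁.trans s₂, by simp [compile, p₂, Nat.add_assoc], f₂,
      fun k hk => (k₂ k hk).trans (k₁ k hk)⟩
  | ite e s t ihs iht =>
    simp only [compile, CodeAt.append_iff, PExpr.length_compile, List.length_cons,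
      List.length_nil, zero_add] at h
    obtain ⟨he, hz, hs, hj, ht⟩ := h
    obtain ⟨c₁, s₁, p₁, f₁, r₁⟩ := e.compile_correct he hc hr
    have hr₁ := f₁.represents hr
    have hz' := s₁.trans (Steps.single hz p₁)
    by_cases h0 : e.eval σ = 0
    · obtain ⟨c₂, s₂, p₂, f₂, k₂⟩ := iht (c := (RamInstr.jzero (tmpReg 0)
        (b + e.cost + 1 + (s.compile (b + e.cost + 1) d).length + 1)).exec c₁) ht
        (by simp [RamInstr.exec, r₁, h0]) ⟨fun x => hr₁.reg x, hr₁.mem⟩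
      refine ⟨c₂, ?_, ?_, ?_, ?_⟩
      · have := hz'.trans s₂
        convert this using 1
        simp [cost, h0]; omega
      · rw [p₂]; simp [compile, PExpr.length_compile]; omega
      · simpa [run, h0] using f₂
      · intro k hk
        rw [k₂ k hk]; exact f₁.cnt k
    · obtain ⟨c₂, s₂, p₂, f₂, k₂⟩ := ihs (c := (RamInstr.jzero (tmpReg 0)
        (b + e.cost + 1 + (s.compile (b + e.cost + 1) d).length + 1)).exec c₁) hs
        (by simp [RamInstr.exec, r₁, h0, p₁]) ⟨fun x => hr₁.reg x, hr₁.mem⟩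
      refine ⟨(RamInstr.jump (b + e.cost + 1 + (s.compile (b + e.cost + 1) d).length + 1 +
          (t.compile (b + e.cost + 1 + (s.compile (b + e.cost + 1) d).length + 1)
            d).length)).exec c₂, ?_, ?_, ?_, ?_⟩
      rotate_left
      · simp [compile, RamInstr.exec, PExpr.length_compile]; omega
      · simp only [run, h0, if_false]
        exact ⟨f₂.reg, f₂.mem⟩
      · intro k hk
        refine (k₂ k hk).trans ?_
        exact f₁.cnt k
      · have := (hz'.trans s₂).trans (Steps.single hj p₂)
        convert this using 1
        simp [cost, h0]; omega
  | loop e s ih =>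
    have hlen : ((loop e s).compile b d).length =
        e.cost + 4 + (s.compile (b + e.cost + 1 + 3) (d + 1)).length + 1 := by
      simp [compile, PExpr.length_compile]; omega
    simp only [compile, PExpr.length_compile] at h
    set l := b + e.cost + 1 with hl
    set s' := s.compile (l + 3) (d + 1) with hs'
    simp only [CodeAt.append_iff, PExpr.length_compile, List.length_cons,
      List.length_nil, zero_add] at h
    obtain ⟨he, hm, hz, hb, hj⟩ := h
    obtain ⟨c₁, s₁, p₁, f₁, r₁⟩ := e.compile_correct he hc hr
    have hr₁ := f₁.represents hr
    have s₂ := s₁.trans (Steps.single hm p₁)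
    set c₂ := (RamInstr.move (cntReg d) (tmpReg 0)).exec c₁ with hc₂
    have hr₂ : Represents c₂ σ :=
      ⟨fun x => by simp [hc₂, RamInstr.exec, Function.update_apply, varReg_ne_cntReg, hr₁.reg],
        hr₁.mem⟩
    have p₂ : c₂.pc = l := by simp [hc₂, RamInstr.exec, p₁, hl]
    have n₂ : c₂.reg (cntReg d) = e.eval σ := by simp [hc₂, RamInstr.exec, r₁]
    have k₂ : ∀ k < d, c₂.reg (cntReg k) = c.reg (cntReg k) := by
      intro k hk
      have : cntReg k ≠ cntReg d := by simp only [cntReg]; omega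
      simp [hc₂, RamInstr.exec, Function.update_apply, this, f₁.cnt]
    -- Induction on the number `N` of remaining iterations, from the loop test on. A round has four
    -- instructions besides the body: test, constant `1`, decrement, jump back. The final test
    -- accounts for the extra `1`.
    have key : ∀ N c σ, c.pc = l → Represents c σ → c.reg (cntReg d) = N →
        ∃ c', Steps p c c' (∑ r ∈ Finset.range N, (s.cost (s.run^[r] σ) + 4) + 1) ∧
          c'.pc = l + 3 + s'.length + 1 ∧ Represents c' (s.run^[N] σ) ∧
          ∀ k < d, c'.reg (cntReg k) = c.reg (cntReg k) := by
      intro N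
      induction N with
      | zero =>
        intro c σ hp hr hN
        refine ⟨(RamInstr.jzero (cntReg d) (l + 3 + s'.length + 1)).exec c,
          by simpa using Steps.single hz hp, ?_, ⟨hr.reg, hr.mem⟩, fun _ _ => rfl⟩
        simp [RamInstr.exec, hN]
      | succ N ihN =>
        intro c σ hp hr hN
        have t₁ := ((Steps.single hz hp).trans (Steps.single hz.tail
          (by simp [RamInstr.exec, hN, hp, hl]))).trans (Steps.single hz.tail.tail
          (by simp [RamInstr.exec, hN, hp, hl]))
        set c₃ := (RamInstr.sub (cntReg d) (cntReg d) (tmpReg 0)).exec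
          ((RamInstr.const (tmpReg 0) 1).exec
            ((RamInstr.jzero (cntReg d) (l + 3 + s'.length + 1)).exec c)) with hc₃
        have q₃ : c₃.pc = l + 3 := by simp [hc₃, RamInstr.exec, hN, hp]
        have hr₃ : Represents c₃ σ :=
          ⟨fun x => by simp [hc₃, RamInstr.exec, Function.update_apply, varReg_ne_cntReg,
            varReg_ne_tmpReg, hr.reg], hr.mem⟩
        have n₃ : c₃.reg (cntReg d) = N := by
          simp [hc₃, RamInstr.exec, hN, cntReg_ne_tmpReg]
        have k₃ : ∀ k < d, c₃.reg (cntReg k) = c.reg (cntReg k) := by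
          intro k hk
          have : cntReg k ≠ cntReg d := by simp only [cntReg]; omega
          simp [hc₃, RamInstr.exec, Function.update_apply, this, cntReg_ne_tmpReg]
        obtain ⟨c₄, t₄, q₄, hr₄, k₄⟩ := ih hb q₃ hr₃
        have t₅ := (t₁.trans t₄).trans (Steps.single hj q₄)
        obtain ⟨c₆, t₆, q₆, hr₆, k₆⟩ := ihN ((RamInstr.jump l).exec c₄) (s.run σ)
          (by simp [RamInstr.exec]) ⟨hr₄.reg, hr₄.mem⟩
          (by rw [← n₃]; exact k₄ d (by omega))
        refine ⟨c₆, ?_, q₆, ?_, ?_⟩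
        · have := t₅.trans t₆
          convert this using 1
          rw [Finset.sum_range_succ']
          simp only [Function.iterate_succ_apply, Function.iterate_zero_apply]
          omega
        · simpa [Function.iterate_succ_apply] using hr₆
        · intro k hk
          rw [k₆ k hk]
          exact (k₄ k (by omega)).trans (k₃ k hk)
    obtain ⟨c', t', q', hr', k'⟩ := key _ c₂ σ p₂ hr₂ n₂
    refine ⟨c', ?_, ?_, hr', fun k hk => (k' k hk).trans (k₂ k hk)⟩
    · have := s₂.trans t'
      convert this using 1
      simp [cost]; omega
    · rw [q', hlen]; omega

/-- The state in which a program is started on input `x`. -/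
def PState.start (x : List ℕ) : PState := ⟨fun _ => 0, fun a => x.getD a 0⟩

/-- `res` has number `0`, so its register is the output register `0`. -/
theorem PStmt.outputsWithin (s : PStmt) (x : List ℕ) {y T : ℕ}
    (hy : (s.run (PState.start x)).var .res = y) (hT : s.cost (PState.start x) ≤ T) :
    RamProg.OutputsWithin (s.compile 0 0) x y T := by
  obtain ⟨c', h₁, h₂, h₃, -⟩ := s.compile_correct (p := s.compile 0 0) (b := 0) (d := 0)
    (c := RamProg.init x) (σ := PState.start x) (fun i hi => by simp [hi]) rfl
    ⟨fun _ => rfl, rfl⟩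
  refine ⟨_, hT, ?_, ?_⟩
  · rw [show _ = c' from h₁]
    simp [RamProg.Halted, h₂]
  · rw [show _ = c' from h₁, ← hy, ← h₃.reg]; rfl

/-! ### Reasoning about programs -/

namespace PStmt

/-- The variables that a statement may change. -/
def vars : PStmt → List Var
  | skip => []
  | set x _ => [x]
  | put _ _ _ => []
  | seq s t => s.vars ++ t.vars
  | ite _ s t => s.vars ++ t.vars
  | loop _ s => s.vars

/-- The arrays that a statement may change. -/
def arrs : PStmt → List Arr
  | skip => []
  | set _ _ => []
  | put r _ _ => [r]
  | seq s t => s.arrs ++ t.arrs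
  | ite _ s t => s.arrs ++ t.arrs
  | loop _ s => s.arrs

theorem run_var (s : PStmt) {x : Var} (hx : x ∉ s.vars) (σ : PState) :
    (s.run σ).var x = σ.var x := by
  induction s generalizing σ with
  | skip => rfl
  | set y e => simp_all [vars, run]
  | put r i e => rfl
  | seq s t ihs iht => simp_all [vars, run]
  | ite e s t ihs iht =>
    simp only [vars, List.mem_append, not_or] at hx
    simp only [run]; split
    · exact iht hx.2 σ
    · exact ihs hx.1 σ
  | loop e s ih =>
    simp only [run]
    generalize e.eval σ = N
    induction N with
    | zero => rfl
    | succ N ihN => rw [Function.iterate_succ_apply', ih hx, ihN]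

theorem run_arr (s : PStmt) {r : Arr} (hr : r ∉ s.arrs) (σ : PState) :
    (s.run σ).arr r = σ.arr r := by
  induction s generalizing σ with
  | skip => rfl
  | set y e => rfl
  | put r' i e => simp_all [arrs, run]
  | seq s t ihs iht => simp_all [arrs, run]
  | ite e s t ihs iht =>
    simp only [arrs, List.mem_append, not_or] at hr
    simp only [run]; split
    · exact iht hr.2 σ
    · exact ihs hr.1 σ
  | loop e s ih =>
    simp only [run]
    generalize e.eval σ = N
    induction N with
    | zero => rfl
    | succ N ihN => rw [Function.iterate_succ_apply', ih hr, ihN]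

/-- From state `σ` the statement `s` leads, in at most `B` steps, to a state with property `Q`. -/
def Spec (s : PStmt) (σ : PState) (Q : PState → Prop) (B : ℕ) : Prop :=
  Q (s.run σ) ∧ s.cost σ ≤ B

/-- The syntactic frame (`run_var`, `run_arr`) is handed to the continuation here and in `Spec.seq`
and `Spec.loop`. Postconditions therefore need not list what stays unchanged; at each use,
membership is settled by `decide`. -/
theorem Spec.mono {s : PStmt} {σ : PState} {Q Q' : PState → Prop} {B B' : ℕ} (h : s.Spec σ Q B)
    (hQ : ∀ τ, (∀ x ∉ s.vars, τ.var x = σ.var x) → (∀ r ∉ s.arrs, τ.arr r = σ.arr r) →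
      Q τ → Q' τ) (hB : B ≤ B') : s.Spec σ Q' B' :=
  ⟨hQ _ (fun _ hx => s.run_var hx σ) (fun _ hr => s.run_arr hr σ) h.1, h.2.trans hB⟩

theorem Spec.seq {s t : PStmt} {σ : PState} {Q R : PState → Prop} {B B' : ℕ} (h : s.Spec σ Q B)
    (h' : ∀ τ, (∀ x ∉ s.vars, τ.var x = σ.var x) → (∀ r ∉ s.arrs, τ.arr r = σ.arr r) →
      Q τ → t.Spec τ R B') : (s.seq t).Spec σ R (B + B') := by
  obtain ⟨h₁, h₂⟩ := h' _ (fun _ hx => s.run_var hx σ) (fun _ hr => s.run_arr hr σ) h.1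
  exact ⟨h₁, Nat.add_le_add h.2 h₂⟩

theorem Spec.ite {e : PExpr} {s t : PStmt} {σ : PState} {Q : PState → Prop} {B : ℕ}
    (hs : e.eval σ ≠ 0 → s.Spec σ Q B) (ht : e.eval σ = 0 → t.Spec σ Q B) :
    (s.ite e t).Spec σ Q (e.cost + 2 + B) := by
  by_cases h : e.eval σ = 0
  · obtain ⟨h₁, h₂⟩ := ht h
    exact ⟨by simpa [run, h] using h₁, by simp [cost, h]; omega⟩
  · obtain ⟨h₁, h₂⟩ := hs h
    exact ⟨by simpa [run, h] using h₁, by simp [cost, h]; omega⟩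

/-- The count `N` is read once on entry, so the body may overwrite the variables of `e`. The summand
`4` per round is the loop overhead of the compiled code. -/
theorem Spec.loop {e : PExpr} {s : PStmt} {σ : PState} {N : ℕ} (I : ℕ → PState → Prop) {B : ℕ}
    (hN : e.eval σ = N) (h0 : I 0 σ)
    (hs : ∀ r < N, ∀ τ, (∀ x ∉ s.vars, τ.var x = σ.var x) → (∀ r ∉ s.arrs, τ.arr r = σ.arr r) →
      I r τ → s.Spec τ (I (r + 1)) B) :
    (s.loop e).Spec σ (I N) (e.cost + 2 + N * (B + 4)) := by
  have hv : ∀ r, (∀ x ∉ s.vars, (s.run^[r] σ).var x = σ.var x) := by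
    intro r x hx
    induction r with
    | zero => rfl
    | succ r ih => rw [Function.iterate_succ_apply', s.run_var hx, ih]
  have ha : ∀ r, (∀ x ∉ s.arrs, (s.run^[r] σ).arr x = σ.arr x) := by
    intro r x hx
    induction r with
    | zero => rfl
    | succ r ih => rw [Function.iterate_succ_apply', s.run_arr hx, ih]
  have hI : ∀ r ≤ N, I r (s.run^[r] σ) := by
    intro r
    induction r with
    | zero => intro _; exact h0
    | succ r ih =>
      intro hr
      rw [Function.iterate_succ_apply']
      exact (hs r (by omega) _ (hv r) (ha r) (ih (by omega))).1
  refine ⟨by simpa [run, hN] using hI N le_rfl, ?_⟩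
  simp only [cost, hN]
  refine Nat.add_le_add_left ?_ _
  refine (Finset.sum_le_card_nsmul _ _ (B + 4) fun r hr => ?_).trans (by simp)
  have hr' := Finset.mem_range.1 hr
  exact Nat.add_le_add_right (hs r hr' _ (hv r) (ha r) (hI r hr'.le)).2 4

end PStmt

namespace PExpr

instance : Coe Var PExpr := ⟨PExpr.var⟩
instance (k : ℕ) : OfNat PExpr k := ⟨PExpr.const k⟩
instance : Add PExpr := ⟨PExpr.add⟩
instance : Sub PExpr := ⟨PExpr.sub⟩

@[simp] theorem eval_var (σ : PState) (x : Var) : (PExpr.var x).eval σ = σ.var x := rfl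
@[simp] theorem eval_zero (σ : PState) : (0 : PExpr).eval σ = 0 := rfl
@[simp] theorem eval_one (σ : PState) : (1 : PExpr).eval σ = 1 := rfl
@[simp] theorem eval_two (σ : PState) : (2 : PExpr).eval σ = 2 := rfl
@[simp] theorem eval_three (σ : PState) : (3 : PExpr).eval σ = 3 := rfl
@[simp] theorem eval_four (σ : PState) : (4 : PExpr).eval σ = 4 := rfl
@[simp] theorem eval_add (σ : PState) (a b : PExpr) : (a + b).eval σ = a.eval σ + b.eval σ := rfl
@[simp] theorem eval_sub (σ : PState) (a b : PExpr) : (a - b).eval σ = a.eval σ - b.eval σ := rfl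
@[simp] theorem eval_half (σ : PState) (a : PExpr) : a.half.eval σ = a.eval σ / 2 := rfl
@[simp] theorem eval_get (σ : PState) (r : Arr) (a : PExpr) :
    (PExpr.get r a).eval σ = σ.arr r (a.eval σ) := rfl
@[simp] theorem eval_raw (σ : PState) (a : PExpr) : a.raw.eval σ = σ.mem (a.eval σ) := rfl

end PExpr

namespace PStmt

@[simp] theorem run_skip (σ : PState) : skip.run σ = σ := rfl
@[simp] theorem run_set (x : Var) (e : PExpr) (σ : PState) :
    (set x e).run σ = σ.setVar x (e.eval σ) := rfl
@[simp] theorem run_put (r : Arr) (i e : PExpr) (σ : PState) :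
    (put r i e).run σ = σ.setArr r (i.eval σ) (e.eval σ) := rfl
@[simp] theorem run_seq (s t : PStmt) (σ : PState) : (seq s t).run σ = t.run (s.run σ) := rfl
@[simp] theorem run_ite (e : PExpr) (s t : PStmt) (σ : PState) :
    (ite e s t).run σ = if e.eval σ = 0 then t.run σ else s.run σ := rfl

/-- Statements without loops. -/
def loopFree : PStmt → Bool
  | skip => true
  | set _ _ => true
  | put _ _ _ => true
  | seq s t => s.loopFree && t.loopFree
  | ite _ s t => s.loopFree && t.loopFree
  | loop _ _ => false

/-- A bound for the cost of a statement without loops. -/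
def bound : PStmt → ℕ
  | skip => 0
  | set _ e => e.cost + 1
  | put _ i e => i.cost + e.cost + 7
  | seq s t => s.bound + t.bound
  | ite e s t => e.cost + 2 + (s.bound + t.bound)
  | loop _ _ => 0

theorem cost_le_bound {s : PStmt} (hs : s.loopFree = true) (σ : PState) : s.cost σ ≤ s.bound := by
  induction s generalizing σ with
  | skip => exact le_rfl
  | set x e => exact le_rfl
  | put r i e => exact le_rfl
  | seq s t ihs iht =>
    simp only [loopFree, Bool.and_eq_true] at hs
    exact Nat.add_le_add (ihs hs.1 _) (iht hs.2 _)
  | ite e s t ihs iht =>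
    simp only [loopFree, Bool.and_eq_true] at hs
    have h1 := ihs hs.1 σ
    have h2 := iht hs.2 σ
    simp only [cost, bound]; split <;> omega
  | loop e s => simp [loopFree] at hs

theorem Spec.of_loopFree {s : PStmt} {σ : PState} {Q : PState → Prop} {B : ℕ}
    (hs : s.loopFree = true) (hB : s.bound ≤ B) (hQ : Q (s.run σ)) : s.Spec σ Q B :=
  ⟨hQ, (cost_le_bound hs σ).trans hB⟩

theorem Spec.le {s : PStmt} {σ : PState} {Q : PState → Prop} {B B' : ℕ}
    (h : s.Spec σ Q B) (hB : B ≤ B') : s.Spec σ Q B' := ⟨h.1, h.2.trans hB⟩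

theorem Spec.set_seq {x : Var} {e : PExpr} {t : PStmt} {σ : PState} {Q : PState → Prop} {B : ℕ}
    (h : t.Spec (σ.setVar x (e.eval σ)) Q B) :
    (PStmt.seq (set x e) t).Spec σ Q (e.cost + 1 + B) :=
  ⟨h.1, Nat.add_le_add_left h.2 _⟩

theorem Spec.put_seq {r : Arr} {i e : PExpr} {t : PStmt} {σ : PState} {Q : PState → Prop} {B : ℕ}
    (h : t.Spec (σ.setArr r (i.eval σ) (e.eval σ)) Q B) :
    (PStmt.seq (put r i e) t).Spec σ Q (i.cost + e.cost + 7 + B) :=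
  ⟨h.1, Nat.add_le_add_left h.2 _⟩

end PStmt

infixr:60 " ;; " => PStmt.seq

open PStmt PExpr

/-! ## The pointer phase -/

/-- Compare the elements at which the pointers number `i` and `j` stand, and record a violated
constraint. -/
def checkPair : PStmt :=
  set .val (get .con Var.idx + get .inp (get .row (get .ptr Var.i) + get .ptr Var.j)) ;;
  -- With truncated subtraction the inner sum is the distance of `val` from `1`, so the branch is
  -- taken exactly if `val = 1`, that is, if table entry and demand differ. A constraint code of `2`
  -- never gives the sum `1`.
  ite (1 - ((Var.val - 1) + (1 - Var.val)))
    (set .found 1 ;;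
      ite (get .con Var.idx) (set .fi Var.j ;; set .fj Var.i) (set .fi Var.i ;; set .fj Var.j))
    skip ;;
  set .idx (Var.idx + 1) ;;
  set .j (Var.j + 1)

/-- Look for a violated constraint between the pointers `0, …, m - 1`. -/
def findViolation : PStmt :=
  set .found 0 ;; set .idx 0 ;; set .i 0 ;;
  loop Var.m (set .j 0 ;; loop Var.m checkPair ;; set .i (Var.i + 1))

/-- Move pointer number `fi` to the next element of its chain, or fail if there is none. -/
def advance : PStmt :=
  set .x (get .ptr Var.fi) ;;
  put .wit Var.x (get .ptr Var.fj) ;;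
  put .tim Var.x Var.t ;;
  ite (get .nxt Var.x) (put .ptr Var.fi (get .nxt Var.x - 1)) (set .fail 1 ;; set .last Var.x)

/-- One round of the pointer phase. -/
def phaseStep : PStmt :=
  set .t (Var.t + 1) ;; findViolation ;; ite Var.found (ite Var.fail skip advance) skip

/-- The pointer phase: advance pointers until all constraints hold or a chain is exhausted. -/
def phase : PStmt :=
  set .acc 0 ;; loop Var.m (set .acc (Var.acc + Var.n)) ;; set .fail 0 ;; set .t 0 ;;
  loop Var.acc phaseStep

/-- The entry of the order table for the elements `a` and `b`. -/
def PState.table (σ : PState) (a b : ℕ) : ℕ := σ.arr .inp (σ.arr .row a + b)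

/-- The constraint between the pointers `a` and `b` is violated and requires that `a` advances.
Constraints are coded by `1` for `≤` and `0` for `≰`. -/
def Violated (con : ℕ → ℕ) (m : ℕ) (tab : ℕ → ℕ → ℕ) (ptr : ℕ → ℕ) (a b : ℕ) : Prop :=
  (con (a * m + b) = 0 ∧ tab (ptr a) (ptr b) = 1) ∨ (con (b * m + a) = 1 ∧ tab (ptr b) (ptr a) = 0)

/-- All constraints hold. -/
def AllHold (con : ℕ → ℕ) (m : ℕ) (tab : ℕ → ℕ → ℕ) (ptr : ℕ → ℕ) : Prop :=
  ∀ a < m, ∀ b < m, con (a * m + b) + tab (ptr a) (ptr b) ≠ 1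

/-- All `m * m` pairs are scanned, and later violations overwrite earlier ones; any single violation
is good enough. The index `idx` runs along with the two loops so that no product has to be computed.
-/
theorem findViolation_spec (σ : PState) {m : ℕ} (hm : σ.var .m = m) :
    findViolation.Spec σ (fun τ =>
      (τ.var .found = 0 ∧ AllHold (σ.arr .con) m σ.table (σ.arr .ptr)) ∨
      (τ.var .found ≠ 0 ∧ τ.var .fi < m ∧ τ.var .fj < m ∧
        Violated (σ.arr .con) m σ.table (σ.arr .ptr) (τ.var .fi) (τ.var .fj)))
      (200 * (m + 1) ^ 2) := by
  apply Spec.le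
  · apply Spec.set_seq
    apply Spec.set_seq
    apply Spec.set_seq
    refine (Spec.loop (N := m) (B := 20 + 100 * m) (fun r τ => τ.var .i = r ∧ τ.var .idx = r * m ∧
      ((τ.var .found = 0 ∧ ∀ a < r, ∀ b < m,
          σ.arr .con (a * m + b) + σ.table (σ.arr .ptr a) (σ.arr .ptr b) ≠ 1) ∨
        (τ.var .found ≠ 0 ∧ τ.var .fi < m ∧ τ.var .fj < m ∧
        Violated (σ.arr .con) m σ.table (σ.arr .ptr) (τ.var .fi) (τ.var .fj)))) ?_ ?_ ?_).mono
        ?_ le_rfl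
    · simp [hm]
    · simp
    · rintro r hr τ hv ha ⟨hi, hidx, hI⟩
      apply Spec.le
      · apply Spec.set_seq
        apply Spec.seq (Q := fun τ => τ.var .i = r ∧ τ.var .idx = r * m + m ∧
          ((τ.var .found = 0 ∧ ∀ a < r + 1, ∀ b < m,
            σ.arr .con (a * m + b) + σ.table (σ.arr .ptr a) (σ.arr .ptr b) ≠ 1) ∨
          (τ.var .found ≠ 0 ∧ τ.var .fi < m ∧ τ.var .fj < m ∧
          Violated (σ.arr .con) m σ.table (σ.arr .ptr) (τ.var .fi) (τ.var .fj))))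
        · refine (Spec.loop (N := m) (B := 90) (fun s τ => τ.var .i = r ∧ τ.var .j = s ∧
            τ.var .idx = r * m + s ∧
            ((τ.var .found = 0 ∧ (∀ a < r, ∀ b < m,
                σ.arr .con (a * m + b) + σ.table (σ.arr .ptr a) (σ.arr .ptr b) ≠ 1) ∧
              ∀ b < s, σ.arr .con (r * m + b) + σ.table (σ.arr .ptr r) (σ.arr .ptr b) ≠ 1) ∨
              (τ.var .found ≠ 0 ∧ τ.var .fi < m ∧ τ.var .fj < m ∧
              Violated (σ.arr .con) m σ.table (σ.arr .ptr) (τ.var .fi) (τ.var .fj)))) ?_ ?_ ?_).mono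
              ?_ le_rfl
          · have := hv .m (by decide)
            simpa [hm] using this
          · simpa [hi, hidx] using hI
          · rintro s hs υ hv' ha' ⟨hi', hj', hidx', hI'⟩
            refine Spec.of_loopFree rfl (by decide) ?_
            have e1 : υ.arr .con = σ.arr .con := by
              rw [ha' .con (by decide), PState.setVar_arr, ha .con (by decide)]; rfl
            have e2 : υ.arr .inp = σ.arr .inp := by
              rw [ha' .inp (by decide), PState.setVar_arr, ha .inp (by decide)]; rfl
            have e3 : υ.arr .row = σ.arr .row := by
              rw [ha' .row (by decide), PState.setVar_arr, ha .row (by decide)]; rfl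
            have e4 : υ.arr .ptr = σ.arr .ptr := by
              rw [ha' .ptr (by decide), PState.setVar_arr, ha .ptr (by decide)]; rfl
            set T := σ.arr .con (r * m + s) + σ.table (σ.arr .ptr r) (σ.arr .ptr s) with hT
            have hT' : T = σ.arr .con (r * m + s) +
              σ.arr .inp (σ.arr .row (σ.arr .ptr r) + σ.arr .ptr s) := rfl
            by_cases h1 : T = 1
            -- A sum of `1` is `0 + 1` or `1 + 0`: in the first case the row pointer must advance,
            -- in the second the column pointer.
            · have hc : σ.arr .con (r * m + s) = 0 ∨ σ.arr .con (r * m + s) = 1 := by omega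
              rcases hc with hc | hc
              · have : σ.table (σ.arr .ptr r) (σ.arr .ptr s) = 1 := by omega
                have this' : σ.arr .inp (σ.arr .row (σ.arr .ptr r) + σ.arr .ptr s) = 1 := this
                simp [checkPair, e1, e2, e3, e4, hi', hj', hidx', this', hc, hr, hs, Violated, this]
                omega
              · have : σ.table (σ.arr .ptr r) (σ.arr .ptr s) = 0 := by omega
                have this' : σ.arr .inp (σ.arr .row (σ.arr .ptr r) + σ.arr .ptr s) = 0 := this
                simp [checkPair, e1, e2, e3, e4, hi', hj', hidx', this', hc, hr, hs, Violated, this]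
                omega
            · have h2 : 1 - ((T - 1) + (1 - T)) = 0 := by omega
              simp [checkPair, e1, e2, e3, e4, hi', hj', hidx', ← hT', h2]
              refine ⟨by omega, ?_⟩
              rcases hI' with ⟨f, hA, hB⟩ | hI'
              · left
                refine ⟨f, hA, fun b hb => ?_⟩
                rcases Nat.lt_or_eq_of_le hb with hb | rfl
                · exact hB b hb
                · exact h1
              · right; exact hI'
          · rintro υ - - ⟨hi', hj', hidx', hI'⟩
            refine ⟨hi', hidx', ?_⟩
            rcases hI' with ⟨f, hA, hB⟩ | hI'
            · left
              refine ⟨f, fun a ha b hb => ?_⟩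
              rcases Nat.lt_succ_iff_lt_or_eq.1 ha with ha | rfl
              · exact hA a ha b hb
              · exact hB b hb
            · exact Or.inr hI'
        · rintro υ - - ⟨hi', hidx', hI'⟩
          refine Spec.of_loopFree (B := 4) rfl (by decide) ?_
          simp only [run_set, PState.setVar_var, eval_add, eval_var, eval_one, hi', hidx']
          simp only [if_true, reduceCtorEq, if_false]
          exact ⟨trivial, by ring, hI'⟩
      · simp only [PExpr.cost]
        show 1 + 1 + (1 + 2 + m * (90 + 4) + 4) ≤ _
        omega
    · rintro τ - - ⟨-, -, h⟩
      exact h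
  · show 1 + 1 + (1 + 1 + (1 + 1 + (1 + 2 + m * (20 + 100 * m + 4)))) ≤ _
    nlinarith

/-- Stated for any invariant `K` that advances preserve, since the search is used both for
antichains and for solutions. Each advance raises the sum of the potentials of the `m` pointers,
which are below `n`, so `m * n` rounds suffice. While rounds keep advancing, the round number equals
the number of advances and serves as time stamp; rounds after success or failure are idle. -/
theorem phase_spec (σ : PState) {m n : ℕ} (hm : σ.var .m = m) (hn : σ.var .n = n)
    (K : ℕ → (ℕ → ℕ) → (ℕ → ℕ) → (ℕ → ℕ) → Prop) (pot : ℕ → ℕ)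
    (h0 : K 0 (σ.arr .ptr) (σ.arr .wit) (σ.arr .tim))
    (hK : ∀ t ptr wit tim, K t ptr wit tim → ∀ a < m, ∀ b < m,
      Violated (σ.arr .con) m σ.table ptr a b → σ.arr .nxt (ptr a) ≠ 0 →
      K (t + 1) (Function.update ptr a (σ.arr .nxt (ptr a) - 1))
        (Function.update wit (ptr a) (ptr b)) (Function.update tim (ptr a) (t + 1)))
    (hpot : ∀ t ptr wit tim, K t ptr wit tim → ∀ a < m, pot (ptr a) < n ∧
      (σ.arr .nxt (ptr a) ≠ 0 → pot (ptr a) < pot (σ.arr .nxt (ptr a) - 1))) :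
    phase.Spec σ (fun τ =>
      (τ.var .fail = 0 ∧ ∃ t, K t (τ.arr .ptr) (τ.arr .wit) (τ.arr .tim) ∧
        AllHold (σ.arr .con) m σ.table (τ.arr .ptr)) ∨
      (τ.var .fail ≠ 0 ∧ τ.var .acc = m * n ∧ ∃ t < m * n, ∃ ptr wit tim, ∃ a < m, ∃ b < m,
        K t ptr wit tim ∧ Violated (σ.arr .con) m σ.table ptr a b ∧ σ.arr .nxt (ptr a) = 0 ∧
        τ.var .last = ptr a ∧ τ.arr .wit = Function.update wit (ptr a) (ptr b) ∧
        τ.arr .tim = Function.update tim (ptr a) (t + 1)))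
      (500 * (m + 1) ^ 3 * (n + 1)) := by
  apply Spec.le
  · apply Spec.set_seq
    apply Spec.seq (Q := fun τ => τ.var .acc = m * n)
    · refine Spec.loop (N := m) (B := 10) (fun r τ => τ.var .acc = r * n) ?_ ?_ ?_
      · simp [hm]
      · simp
      · intro r hr τ hv ha hI
        have := hv .n (by decide)
        simp at this
        refine Spec.of_loopFree rfl (by decide) ?_
        simp [hI, this, hn]; ring
    · intro τ hv ha hacc
      apply Spec.set_seq
      apply Spec.set_seq
      refine (Spec.loop (N := m * n) (B := 400 * (m + 1) ^ 2) (fun r τ => τ.var .t = r ∧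
        ((τ.var .fail = 0 ∧ K r (τ.arr .ptr) (τ.arr .wit) (τ.arr .tim) ∧
            r ≤ ∑ a ∈ Finset.range m, pot (τ.arr .ptr a)) ∨
          (τ.var .fail = 0 ∧ ∃ t, K t (τ.arr .ptr) (τ.arr .wit) (τ.arr .tim) ∧
            AllHold (σ.arr .con) m σ.table (τ.arr .ptr)) ∨
          (τ.var .fail ≠ 0 ∧ ∃ t < m * n, ∃ ptr wit tim, ∃ a < m, ∃ b < m,
            K t ptr wit tim ∧ Violated (σ.arr .con) m σ.table ptr a b ∧ σ.arr .nxt (ptr a) = 0 ∧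
            τ.var .last = ptr a ∧ τ.arr .wit = Function.update wit (ptr a) (ptr b) ∧
            τ.arr .tim = Function.update tim (ptr a) (t + 1)))) ?_ ?_ ?_).mono ?_ le_rfl
      · simp [hacc]
      · refine ⟨by simp, Or.inl ⟨by simp, ?_, by simp⟩⟩
        simp only [PState.setVar_arr]
        rw [ha .ptr (by decide), ha .wit (by decide), ha .tim (by decide)]
        exact h0
      · rintro r hr υ hv' ha' ⟨ht, hI⟩
        have hcon : υ.arr .con = σ.arr .con := by
          rw [ha' .con (by decide), PState.setVar_arr, PState.setVar_arr, ha .con (by decide)]; rfl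
        have hnxt : υ.arr .nxt = σ.arr .nxt := by
          rw [ha' .nxt (by decide), PState.setVar_arr, PState.setVar_arr, ha .nxt (by decide)]; rfl
        have htab : υ.table = σ.table := by
          funext a b
          simp only [PState.table]
          rw [ha' .inp (by decide), ha' .row (by decide), PState.setVar_arr, PState.setVar_arr,
            PState.setVar_arr, PState.setVar_arr, ha .inp (by decide), ha .row (by decide)]; rfl
        have hm' : υ.var .m = m := by
          have h1 := hv' .m (by decide)
          have h2 := hv .m (by decide)
          simp at h1 h2
          rw [h1, h2, hm]
        apply Spec.le
        · apply Spec.set_seq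
          apply Spec.seq (findViolation_spec _ (m := m) (by simpa using hm'))
          intro ω hvω haω hω
          refine Spec.of_loopFree (B := 100) rfl (by decide) ?_
          have ep : ω.arr .ptr = υ.arr .ptr := haω .ptr (by decide)
          have ew : ω.arr .wit = υ.arr .wit := haω .wit (by decide)
          have et : ω.arr .tim = υ.arr .tim := haω .tim (by decide)
          have en : ω.arr .nxt = σ.arr .nxt := (haω .nxt (by decide)).trans hnxt
          have etv : ω.var .t = r + 1 := by simpa [ht] using hvω .t (by decide)
          have ef : ω.var .fail = υ.var .fail := by simpa using hvω .fail (by decide)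
          have el : ω.var .last = υ.var .last := by simpa using hvω .last (by decide)
          have etab : (υ.setVar .t ((var .t + 1 : PExpr).eval υ)).table = σ.table := htab
          simp only [PState.setVar_arr, hcon] at hω
          rw [etab] at hω
          by_cases hf : ω.var .fail = 0
          · rcases hω with ⟨f0, hS⟩ | ⟨f1, hfi, hfj, hV⟩
            · simp only [run_ite, eval_var, f0, if_true, run_skip]
              refine ⟨etv, Or.inr (Or.inl ⟨hf, ?_⟩)⟩
              rw [ep, ew, et]
              rcases hI with ⟨-, hK', -⟩ | ⟨-, hK'⟩ | ⟨h, -⟩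
              · exact ⟨r, hK', hS⟩
              · exact hK'
              · exact absurd (ef.symm.trans hf) h
            -- A violation was found and no failure has occurred, so the search is still advancing:
            -- were it already settled, `AllHold` would contradict the violation.
            · have hI' : K r (υ.arr .ptr) (υ.arr .wit) (υ.arr .tim) ∧
                  r ≤ ∑ a ∈ Finset.range m, pot (υ.arr .ptr a) := by
                rcases hI with ⟨-, hK', hs⟩ | ⟨-, t, hK', hS⟩ | ⟨h, -⟩
                · exact ⟨hK', hs⟩
                · exfalso
                  rcases hV with ⟨h1, h2⟩ | ⟨h1, h2⟩
                  · exact hS _ hfi _ hfj (by omega)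
                  · exact hS _ hfj _ hfi (by omega)
                · exact absurd (ef.symm.trans hf) h
              obtain ⟨hK', hs⟩ := hI'
              by_cases hx : σ.arr .nxt (υ.arr .ptr (ω.var .fi)) = 0
              · refine ⟨?_, Or.inr (Or.inr ⟨?_, r, hr, υ.arr .ptr, υ.arr .wit, υ.arr .tim,
                  ω.var .fi, hfi, ω.var .fj, hfj, hK', hV, hx, ?_, ?_, ?_⟩)⟩ <;>
                simp [advance, f1, hf, en, ep, ew, et, hx, etv]
              · refine ⟨?_, Or.inl ⟨?_, ?_, ?_⟩⟩
                · simp [advance, f1, hf, en, ep, hx, etv]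
                · simp [advance, f1, hf, en, ep, hx]
                · simpa [advance, f1, hf, en, ep, hx, ew, et, etv] using
                    hK r _ _ _ hK' _ hfi _ hfj hV hx
                · have := (hpot r _ _ _ hK' _ hfi).2 hx
                  simp only [advance, run_ite, eval_var, f1, hf, run_seq, run_set, run_put,
                    PState.setVar_arr, PState.setVar_var, PState.setArr_arr, PState.setArr_var,
                    eval_get, en, ep, hx, if_true, if_false, reduceCtorEq, eval_sub, eval_one]
                  refine Nat.succ_le_of_lt (lt_of_le_of_lt hs (Finset.sum_lt_sum ?_
                    ⟨ω.var .fi, Finset.mem_range.2 hfi, ?_⟩))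
                  · intro a _
                    by_cases hae : a = ω.var .fi
                    · subst hae; simpa using this.le
                    · simp [hae]
                  · simpa using this
          · have hf' : υ.var .fail ≠ 0 := by rwa [← ef]
            have hrun : (ite Var.found (ite Var.fail skip advance) skip).run ω = ω := by
              simp [hf]
            rw [hrun]
            refine ⟨etv, Or.inr (Or.inr ⟨hf, ?_⟩)⟩
            rw [ew, et, el]
            rcases hI with ⟨h, -⟩ | ⟨h, -⟩ | ⟨-, h⟩
            · exact absurd h hf'
            · exact absurd h hf'
            · exact h
        · show 1 + 1 + 1 + 1 + (200 * (m + 1) ^ 2 + 100) ≤ _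
          nlinarith
      · rintro υ hv' - ⟨-, hI⟩
        rcases hI with ⟨hf, hK', hs⟩ | hI | ⟨hf, hI⟩
        · left
          refine ⟨hf, _, hK', ?_⟩
          -- After `m * n` advances the potentials sum to at least `m * n`, although each is below
          -- `n`. This forces `m = 0`, where the constraints hold vacuously.
          intro a ha
          exfalso
          have hle : ∑ a ∈ Finset.range m, pot (υ.arr .ptr a) < ∑ a ∈ Finset.range m, n :=
            Finset.sum_lt_sum_of_nonempty ⟨a, Finset.mem_range.2 ha⟩
              fun i hi => (hpot _ _ _ _ hK' i (Finset.mem_range.1 hi)).1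
          simp at hle
          omega
        · exact Or.inl hI
        · right
          refine ⟨hf, ?_, hI⟩
          have := hv' .acc (by decide)
          simpa [hacc] using this
  · show 1 + 1 + (1 + 2 + m * (10 + 4) + (1 + 1 + (1 + 1 + (1 + 2 + m * n *
      (400 * (m + 1) ^ 2 + 4))))) ≤ _
    have h3 : m * n ≤ (m + 1) ^ 2 * (m * n) := Nat.le_mul_of_pos_left _ (by positivity)
    have h4 : m + 1 ≤ (m + 1) ^ 3 := Nat.le_self_pow (by omega) _
    nlinarith [Nat.zero_le ((m + 1) ^ 2 * n)]

/-! ## Chain covers -/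

/-- `tab` is the 0/1-table of a partial order on `{0, …, n - 1}`. -/
structure IsOrderTable (tab : ℕ → ℕ → ℕ) (n : ℕ) : Prop where
  le_one : ∀ a < n, ∀ b < n, tab a b ≤ 1
  refl : ∀ a < n, tab a a = 1
  trans : ∀ a < n, ∀ b < n, ∀ c < n, tab a b = 1 → tab b c = 1 → tab a c = 1
  antisymm : ∀ a < n, ∀ b < n, tab a b = 1 → tab b a = 1 → a = b

/-- Antichains have at most `w` elements. -/
def WidthLE (tab : ℕ → ℕ → ℕ) (n w : ℕ) : Prop :=
  ∀ (m : ℕ) (f : ℕ → ℕ), (∀ i < m, f i < n) →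
    (∀ i < m, ∀ j < m, i ≠ j → tab (f i) (f j) ≠ 1) → m ≤ w

/-- The number of elements strictly below `x`. -/
def height (tab : ℕ → ℕ → ℕ) (n x : ℕ) : ℕ :=
  ((Finset.range n).filter fun y => tab y x = 1 ∧ y ≠ x).card

theorem height_lt {tab : ℕ → ℕ → ℕ} {n x : ℕ} (hx : x < n) : height tab n x < n := by
  have : (Finset.range n).filter (fun y => tab y x = 1 ∧ y ≠ x) ⊂ Finset.range n := by
    refine Finset.filter_ssubset.2 ⟨x, Finset.mem_range.2 hx, by simp⟩
  have := Finset.card_lt_card this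
  rwa [Finset.card_range] at this

/-- Makes the height a potential for pointers that climb chains, and a measure for descending along
predecessors. -/
theorem IsOrderTable.height_lt_height {tab : ℕ → ℕ → ℕ} {n x y : ℕ} (h : IsOrderTable tab n)
    (hx : x < n) (hy : y < n) (hxy : tab x y = 1) (hne : x ≠ y) :
    height tab n x < height tab n y := by
  refine Finset.card_lt_card (Finset.ssubset_iff_of_subset ?_ |>.2 ⟨x, ?_, ?_⟩)
  · intro z hz
    simp only [Finset.mem_filter, Finset.mem_range] at hz ⊢
    refine ⟨hz.1, h.trans z hz.1 x hx y hy hz.2.1 hxy, ?_⟩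
    rintro rfl
    exact hne (h.antisymm x hx z hy hxy hz.2.1)
  · simp [hx, hxy, hne]
  · simp

/-- `prv` codes a partial map on `{0, …, v - 1}`, by predecessors in chains: `0` for none and
`y + 1` for `y`. -/
structure IsMatching (tab : ℕ → ℕ → ℕ) (prv : ℕ → ℕ) (v : ℕ) : Prop where
  lt : ∀ x < v, prv x ≠ 0 → prv x - 1 < v
  le : ∀ x < v, prv x ≠ 0 → tab (prv x - 1) x = 1
  ne : ∀ x < v, prv x ≠ 0 → prv x - 1 ≠ x
  inj : ∀ x < v, ∀ y < v, prv x ≠ 0 → prv x = prv y → x = y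

/-- The number of chains. -/
def chainCount (prv : ℕ → ℕ) (v : ℕ) : ℕ := ((Finset.range v).filter fun x => prv x = 0).card

theorem chainCount_succ (prv : ℕ → ℕ) (v : ℕ) :
    chainCount prv (v + 1) = chainCount prv v + if prv v = 0 then 1 else 0 := by
  simp only [chainCount, Finset.range_add_one, Finset.filter_insert]
  split <;> simp

theorem chainCount_congr {prv prv' : ℕ → ℕ} {v : ℕ} (h : ∀ x < v, prv x = 0 ↔ prv' x = 0) :
    chainCount prv v = chainCount prv' v := by
  refine congrArg Finset.card (Finset.filter_congr fun x hx => h x (Finset.mem_range.1 hx))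

/-- Chains are counted by their least elements, and `y` ceases to be one. -/
theorem chainCount_update {prv : ℕ → ℕ} {v y c : ℕ} (hy : y < v) (h : prv y = 0) :
    chainCount (Function.update prv y (c + 1)) v + 1 = chainCount prv v := by
  have : (Finset.range v).filter (fun x => Function.update prv y (c + 1) x = 0) =
      ((Finset.range v).filter fun x => prv x = 0).erase y := by
    ext x
    by_cases hx : x = y <;> simp [hx]
  rw [chainCount, this, Finset.card_erase_add_one (by simp [hy, h]), chainCount]

/-- The single step of an exchange: `y` may already have a predecessor, which is then dropped, but
`x` must not yet have a successor, since otherwise injectivity would fail. -/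
theorem IsMatching.update {tab : ℕ → ℕ → ℕ} {prv : ℕ → ℕ} {v x y : ℕ} (h : IsMatching tab prv v)
    (hx : x < v) (hxy : tab x y = 1) (hne : x ≠ y) (hfree : ∀ z < v, prv z ≠ x + 1) :
    IsMatching tab (Function.update prv y (x + 1)) v := by
  refine ⟨fun z hz h0 => ?_, fun z hz h0 => ?_, fun z hz h0 => ?_, fun z hz u hu h0 he => ?_⟩
  · by_cases e : z = y
    · subst e; simpa using hx
    · simp [e] at h0 ⊢; exact h.lt z hz h0
  · by_cases e : z = y
    · subst e; simpa using hxy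
    · simp [e] at h0 ⊢; exact h.le z hz h0
  · by_cases e : z = y
    · subst e; simpa using hne
    · simp [e] at h0 ⊢; exact h.ne z hz h0
  · by_cases e : z = y <;> by_cases e' : u = y
    · rw [e, e']
    · subst e; simp [e'] at he; exact absurd he.symm (hfree u hu)
    · subst e'; simp [e] at he; exact absurd he (hfree z hz)
    · simp [e, e'] at he h0; exact h.inj z hz u hu h0 he

/-- The successor map `nxt` and the list `head 0, …, head (m - 1)` of least elements fit to the
predecessor map `prv`. -/
structure IsChainData (prv nxt head : ℕ → ℕ) (v m : ℕ) : Prop where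
  prv_nxt : ∀ x < v, nxt x ≠ 0 → nxt x - 1 < v ∧ prv (nxt x - 1) = x + 1
  nxt_prv : ∀ y < v, prv y ≠ 0 → nxt (prv y - 1) = y + 1
  head_lt : ∀ i < m, head i < v ∧ prv (head i) = 0
  head_inj : ∀ i < m, ∀ j < m, head i = head j → i = j
  head_surj : ∀ y < v, prv y = 0 → ∃ i < m, head i = y

/-! ### Successors, least elements, and the antichain constraints -/

/-- Compute successors and least elements of the chains from predecessors. -/
def scanChains : PStmt :=
  set .i 0 ;;
  loop Var.v (put .nxt Var.i 0 ;; put .tim Var.i 0 ;; set .i (Var.i + 1)) ;;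
  set .m 0 ;; set .i 0 ;;
  loop Var.v (ite (get .prv Var.i) (put .nxt (get .prv Var.i - 1) (Var.i + 1))
    (put .head Var.m Var.i ;; put .ptr Var.m Var.i ;; set .m (Var.m + 1)) ;; set .i (Var.i + 1))

/-- Only `prv` is maintained through insertions and exchanges; everything else about the chains is
recomputed from it in linear time. Memory may hold remnants of the input, so `nxt` and `tim` must be
cleared explicitly. -/
theorem scanChains_spec (σ : PState) {tab : ℕ → ℕ → ℕ} {v : ℕ} (hv : σ.var .v = v)
    (hM : IsMatching tab (σ.arr .prv) v) :
    scanChains.Spec σ (fun τ => τ.var .m = chainCount (σ.arr .prv) v ∧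
      IsChainData (σ.arr .prv) (τ.arr .nxt) (τ.arr .head) v (τ.var .m) ∧
      (∀ i < τ.var .m, τ.arr .ptr i = τ.arr .head i) ∧ ∀ x < v, τ.arr .tim x = 0)
      (200 * (v + 1)) := by
  set P := σ.arr .prv with hP
  apply Spec.le
  · apply Spec.set_seq
    apply Spec.seq (Q := fun τ => ∀ x < v, τ.arr .nxt x = 0 ∧ τ.arr .tim x = 0)
    · refine (Spec.loop (N := v) (B := 40) (fun r τ => τ.var .i = r ∧
        ∀ x < r, τ.arr .nxt x = 0 ∧ τ.arr .tim x = 0) ?_ ?_ ?_).mono (fun τ _ _ h => h.2) le_rfl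
      · simp [hv]
      · simp
      · rintro r hr τ - - ⟨hi, hI⟩
        refine Spec.of_loopFree rfl (by decide) ?_
        simp only [run_seq, run_put, run_set, PState.setVar_var, PState.setVar_arr,
          PState.setArr_arr, PState.setArr_var, eval_var, eval_zero, eval_add, eval_one, hi,
          if_true, if_false, reduceCtorEq, true_and]
        intro x hx
        by_cases e : x = r
        · simp [e]
        · simpa [e] using hI x (by omega)
    · intro τ hvτ haτ hz
      have hv1 : τ.var .v = v := by rw [hvτ .v (by decide)]; simpa using hv
      have hp1 : τ.arr .prv = P := haτ .prv (by decide)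
      apply Spec.set_seq
      apply Spec.set_seq
      refine (Spec.loop (N := v) (B := 100) (fun r τ => τ.var .i = r ∧
        τ.var .m = chainCount P r ∧
        (∀ x < v, τ.arr .nxt x ≠ 0 → τ.arr .nxt x - 1 < r ∧ P (τ.arr .nxt x - 1) = x + 1) ∧
        (∀ y < r, P y ≠ 0 → τ.arr .nxt (P y - 1) = y + 1) ∧
        (∀ i < τ.var .m, τ.arr .head i < r ∧ P (τ.arr .head i) = 0) ∧
        (∀ i < τ.var .m, ∀ j < τ.var .m, τ.arr .head i = τ.arr .head j → i = j) ∧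
        (∀ y < r, P y = 0 → ∃ i < τ.var .m, τ.arr .head i = y) ∧
        (∀ i < τ.var .m, τ.arr .ptr i = τ.arr .head i) ∧ ∀ x < v, τ.arr .tim x = 0)
        ?_ ?_ ?_).mono ?_ le_rfl
      · simpa using hv1
      · simp [chainCount]
        exact ⟨fun x hx => (hz x hx).1, fun x hx => (hz x hx).2⟩
      · rintro r hr υ hvυ haυ ⟨hi, hm, h1, h2, h3, h4, h5, h6, h7⟩
        have hp2 : υ.arr .prv = P := by
          rw [haυ .prv (by decide)]; simpa using hp1
        refine Spec.of_loopFree rfl (by decide) ?_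
        by_cases h0 : P r = 0
        · simp only [run_seq, run_ite, run_put, run_set, PState.setVar_var, PState.setVar_arr,
            PState.setArr_arr, PState.setArr_var, eval_var, eval_zero, eval_add, eval_one, eval_get,
            hi, hp2, h0, if_true, if_false, reduceCtorEq, true_and, chainCount_succ, hm]
          rw [hm] at h3 h4 h5 h6
          set M := chainCount P r
          refine ⟨fun x hx hx0 => ⟨by have := (h1 x hx hx0).1; omega, (h1 x hx hx0).2⟩,
            fun y hy hy0 => ?_, fun i hi' => ?_, fun i hi' j hj' he => ?_, fun y hy hy0 => ?_,
            fun i hi' => ?_, h7⟩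
          · by_cases e : y = r
            · subst e; exact absurd h0 hy0
            · exact h2 y (by omega) hy0
          · by_cases e : i = M
            · simp [e, h0]
            · have := h3 i (by omega)
              simp only [ne_eq, e, not_false_eq_true, Function.update_of_ne]
              exact ⟨by omega, this.2⟩
          · by_cases e : i = M <;> by_cases e' : j = M
            · omega
            · have := (h3 j (by omega)).1
              simp [e, e'] at he; omega
            · have := (h3 i (by omega)).1
              simp [e, e'] at he; omega
            · simp [e, e'] at he
              exact h4 i (by omega) j (by omega) he
          · by_cases e : y = r
            · exact ⟨M, by omega, by simp [e]⟩
            · obtain ⟨i, hi', he⟩ := h5 y (by omega) hy0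
              exact ⟨i, by omega, by rw [Function.update_of_ne (by omega)]; exact he⟩
          · by_cases e : i = M
            · simp [e]
            · simpa [e] using h6 i (by omega)
        · simp only [run_seq, run_ite, run_put, run_set, PState.setVar_var, PState.setVar_arr,
            PState.setArr_arr, PState.setArr_var, eval_var, eval_zero, eval_add, eval_sub, eval_one,
            eval_get, hi, hp2, h0, if_true, if_false, reduceCtorEq, true_and, chainCount_succ, hm]
          rw [hm] at h3 h4 h5 h6
          refine ⟨rfl, fun x hx hx0 => ?_, fun y hy hy0 => ?_, fun i hi' => ?_, h4,
            fun y hy hy0 => ?_, h6, h7⟩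
          · by_cases e : x = P r - 1
            · subst e; simp; omega
            · simp [e] at hx0 ⊢
              have := h1 x hx hx0
              exact ⟨by omega, this.2⟩
          · by_cases e : y = r
            · simp [e]
            -- Injectivity of the matching: the new successor entry does not overwrite an older one.
            · have : P y - 1 ≠ P r - 1 := by
                intro he
                exact e (hM.inj y (by omega) r hr hy0 (by omega))
              simpa [this] using h2 y (by omega) hy0
          · have := h3 i hi'
            exact ⟨by omega, this.2⟩
          · by_cases e : y = r
            · subst e; exact absurd hy0 h0
            · exact h5 y (by omega) hy0
      · rintro υ - - ⟨-, hm, h1, h2, h3, h4, h5, h6, h7⟩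
        exact ⟨hm, ⟨h1, h2, h3, h4, h5⟩, h6, h7⟩
  · show 1 + 1 + (1 + 2 + v * (40 + 4) + (1 + 1 + (1 + 1 + (1 + 2 + v * (100 + 4))))) ≤ _
    omega

/-- Set up the constraints that all pointers stand at incomparable elements. -/
def demandAntichain : PStmt :=
  set .idx 0 ;; set .i 0 ;;
  loop Var.m (set .j 0 ;;
    -- Here `x` is the distance of `i` and `j`, so the code is `2` (no demand) on the diagonal and
    -- `0` (`≰`) off it.
    loop Var.m (set .x ((Var.i - Var.j) + (Var.j - Var.i)) ;; put .con Var.idx (2 - (Var.x + Var.x)) ;;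
      set .idx (Var.idx + 1) ;; set .j (Var.j + 1)) ;;
    set .i (Var.i + 1))

theorem mul_add_inj {m a b c d : ℕ} (hb : b < m) (hd : d < m) (h : a * m + b = c * m + d) :
    a = c ∧ b = d := by
  have hm : 0 < m := by omega
  have h1 : (a * m + b) / m = a := by
    rw [Nat.add_comm, Nat.add_mul_div_right _ _ hm, Nat.div_eq_of_lt hb, Nat.zero_add]
  have h2 : (c * m + d) / m = c := by
    rw [Nat.add_comm, Nat.add_mul_div_right _ _ hm, Nat.div_eq_of_lt hd, Nat.zero_add]
  have : a = c := by rw [← h1, ← h2, h]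
  subst this
  exact ⟨rfl, by omega⟩

theorem demandAntichain_spec (σ : PState) {m : ℕ} (hm : σ.var .m = m) :
    demandAntichain.Spec σ (fun τ =>
      ∀ a < m, ∀ b < m, τ.arr .con (a * m + b) = if a = b then 2 else 0)
      (100 * (m + 1) ^ 2) := by
  apply Spec.le
  · apply Spec.set_seq
    apply Spec.set_seq
    refine (Spec.loop (N := m) (B := 20 + 60 * m) (fun r τ => τ.var .i = r ∧ τ.var .idx = r * m ∧
      ∀ a, ∀ b < m, a * m + b < r * m → τ.arr .con (a * m + b) = if a = b then 2 else 0)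
      ?_ ?_ ?_).mono ?_ le_rfl
    · simp [hm]
    · simp
    · rintro r hr τ hv ha ⟨hi, hidx, hI⟩
      apply Spec.le
      · apply Spec.set_seq
        apply Spec.seq (Q := fun τ => τ.var .i = r ∧ τ.var .idx = r * m + m ∧
          ∀ a, ∀ b < m, a * m + b < r * m + m → τ.arr .con (a * m + b) = if a = b then 2 else 0)
        · refine (Spec.loop (N := m) (B := 50) (fun s τ => τ.var .i = r ∧ τ.var .j = s ∧
            τ.var .idx = r * m + s ∧
            ∀ a, ∀ b < m, a * m + b < r * m + s → τ.arr .con (a * m + b) = if a = b then 2 else 0)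
            ?_ ?_ ?_).mono (fun τ _ _ h => ⟨h.1, h.2.2.1, h.2.2.2⟩) le_rfl
          · have := hv .m (by decide)
            simpa [hm] using this
          · simpa [hi, hidx] using hI
          · rintro s hs υ - - ⟨hi', hj', hidx', hI'⟩
            refine Spec.of_loopFree rfl (by decide) ?_
            simp only [run_seq, run_put, run_set, PState.setVar_var, PState.setVar_arr,
              PState.setArr_arr, PState.setArr_var, eval_var, eval_two, eval_add, eval_sub,
              eval_one, hi', hj', hidx', if_true, if_false, reduceCtorEq, true_and]
            refine ⟨by omega, fun a b hb hab => ?_⟩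
            by_cases e : a * m + b = r * m + s
            · obtain ⟨rfl, rfl⟩ := mul_add_inj hb hs e
              simp only [Function.update_self]
              split <;> omega
            · rw [Function.update_of_ne e]
              exact hI' a b hb (by omega)
        · rintro υ - - ⟨hi', hidx', hI'⟩
          refine Spec.of_loopFree (B := 4) rfl (by decide) ?_
          simp only [run_set, PState.setVar_var, PState.setVar_arr, eval_add, eval_var, eval_one,
            hi', hidx', if_true, reduceCtorEq, if_false, Nat.succ_mul, true_and]
          exact hI'
      · show 1 + 1 + (1 + 2 + m * (50 + 4) + 4) ≤ _
        omega
    · rintro τ - - ⟨-, -, h⟩ a ha b hb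
      refine h a b hb ?_
      calc a * m + b < a * m + m := by omega
        _ = (a + 1) * m := by ring
        _ ≤ m * m := Nat.mul_le_mul_right _ ha
  · show 1 + 1 + (1 + 1 + (1 + 2 + m * (20 + 60 * m + 4))) ≤ _
    nlinarith

/-! ### Augmenting paths -/

/-- Witnesses for the advances of the pointers, in the order of the times `tim`. -/
structure IsTrail (tab : ℕ → ℕ → ℕ) (prv wit tim : ℕ → ℕ) (v : ℕ) : Prop where
  lt : ∀ x < v, tim x ≠ 0 → wit x < v
  le : ∀ x < v, tim x ≠ 0 → tab x (wit x) = 1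
  ne : ∀ x < v, tim x ≠ 0 → x ≠ wit x
  back : ∀ x < v, tim x ≠ 0 → prv (wit x) = 0 ∨
    (tim (prv (wit x) - 1) ≠ 0 ∧ tim (prv (wit x) - 1) < tim x)

/-- Follow the witnesses backwards and exchange the edges of the matching. -/
def exchange : PStmt :=
  set .finish 0 ;; set .cur Var.last ;;
  loop Var.acc (ite Var.finish skip
    (set .y (get .wit Var.cur) ;; set .x (get .prv Var.y) ;; put .prv Var.y (Var.cur + 1) ;;
      ite Var.x (set .cur (Var.x - 1)) (set .finish 1)))

/-- At each moment `cur` has no successor. It is linked below its witness `y`, which lies above it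
in the order; the old predecessor of `y` thereby loses its successor and becomes the new `cur`. Its
time stamp is smaller, so the walk ends within `N` rounds, and it ends at a `y` that was the least
element of a chain, whose linking removes one chain. The entries of `prv` still to be read belong to
earlier stamps and are untouched, which is the last clause of the invariant. -/
theorem exchange_spec (σ : PState) {tab : ℕ → ℕ → ℕ} {v N : ℕ} (hN : σ.var .acc = N)
    (hM : IsMatching tab (σ.arr .prv) v)
    (hT : IsTrail tab (σ.arr .prv) (σ.arr .wit) (σ.arr .tim) v)
    (hl : σ.var .last < v) (hl0 : σ.arr .tim (σ.var .last) ≠ 0)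
    (hlN : σ.arr .tim (σ.var .last) ≤ N) (hfree : ∀ y < v, σ.arr .prv y ≠ σ.var .last + 1) :
    exchange.Spec σ (fun τ => IsMatching tab (τ.arr .prv) v ∧
      chainCount (τ.arr .prv) v + 1 = chainCount (σ.arr .prv) v) (100 * (N + 1)) := by
  set P := σ.arr .prv with hP
  set W := σ.arr .wit with hW
  set T := σ.arr .tim with hTdef
  apply Spec.le
  · apply Spec.set_seq
    apply Spec.set_seq
    refine (Spec.loop (N := N) (B := 70) (fun r τ =>
      (τ.var .finish = 0 ∧ τ.var .cur < v ∧ T (τ.var .cur) ≠ 0 ∧ T (τ.var .cur) + r ≤ N ∧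
        IsMatching tab (τ.arr .prv) v ∧ (∀ y < v, τ.arr .prv y ≠ τ.var .cur + 1) ∧
        chainCount (τ.arr .prv) v = chainCount P v ∧
        ∀ z < v, (P z = 0 ∨ T (P z - 1) < T (τ.var .cur)) → τ.arr .prv z = P z) ∨
      (τ.var .finish ≠ 0 ∧ IsMatching tab (τ.arr .prv) v ∧
        chainCount (τ.arr .prv) v + 1 = chainCount P v)) ?_ ?_ ?_).mono ?_ le_rfl
    · simp [hN]
    · left
      simp only [PState.setVar_var, PState.setVar_arr, eval_zero, eval_var, if_true, if_false,
        reduceCtorEq]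
      exact ⟨trivial, hl, hl0, hlN, hM, hfree, rfl, fun _ _ _ => rfl⟩
    · rintro r hr τ hv ha hI
      have hw : τ.arr .wit = W := ha .wit (by decide)
      refine Spec.of_loopFree rfl (by decide) ?_
      rcases hI with ⟨h0, hc, hc0, hcN, hM', hf, hn, hz⟩ | ⟨h0, h⟩
      · set c := τ.var .cur with hcdef
        have hyv := hT.lt c hc hc0
        have hback := hT.back c hc hc0
        have hpy : τ.arr .prv (W c) = P (W c) :=
          hz _ hyv (hback.imp id fun h => h.2)
        have hM'' := hM'.update hc (hT.le c hc hc0) (hT.ne c hc hc0) hf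
        by_cases hp : P (W c) = 0
        · right
          simp only [run_ite, run_seq, run_set, run_put, PState.setVar_var, PState.setVar_arr,
            PState.setArr_arr, PState.setArr_var, eval_var, eval_get, eval_add, eval_sub, eval_one,
            h0, hw, hpy, ← hcdef, hp, if_true, if_false, reduceCtorEq]
          exact ⟨one_ne_zero, hM'', (chainCount_update hyv (hpy.trans hp)).trans hn⟩
        · left
          simp only [run_ite, run_seq, run_set, run_put, PState.setVar_var, PState.setVar_arr,
            PState.setArr_arr, PState.setArr_var, eval_var, eval_get, eval_add, eval_sub, eval_one,
            h0, hw, hpy, ← hcdef, hp, if_true, if_false, reduceCtorEq]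
          obtain ⟨ht0, htlt⟩ := hback.resolve_left hp
          -- The goal left for `he` is that the new `cur` has no successor: by injectivity of the
          -- old matching its only one was `W c`, which now follows `c`, and `c` differs from it
          -- because `c` had no successor. The next goal is the chain count, unchanged because `W c`
          -- has a predecessor before and after.
          refine ⟨trivial, hM.lt _ hyv hp, ht0, by omega, hM'', fun y hy he => ?_, ?_, fun z hzv h => ?_⟩
          · by_cases e : y = W c
            · subst e
              simp at he
              exact hf _ hy (by rw [hpy]; omega)
            · simp [e] at he
              exact e (hM'.inj _ hy _ hyv (by omega) (by rw [he, hpy]; omega))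
          · rw [← hn]
            refine chainCount_congr fun x hx => ?_
            by_cases e : x = W c
            · subst e; simp [hpy, hp]
            · simp [e]
          · by_cases e : z = W c
            · subst e
              rcases h with h | h
              · exact absurd h hp
              · exact absurd h (lt_irrefl _)
            · rw [Function.update_of_ne e]
              exact hz z hzv (h.imp id fun h => h.trans htlt)
      · right
        simp only [run_ite, eval_var, h0, if_false, run_skip]
        exact ⟨h0, h⟩
    · rintro τ - - (⟨-, -, h0, hN', -⟩ | ⟨-, h⟩)
      -- After `N` rounds the stamp of `cur` would have to be `0`, but it is not.
      · omega
      · exact h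
  · show 1 + 1 + (1 + 1 + (1 + 2 + N * (70 + 4))) ≤ _
    omega

/-- The invariant of the pointer phase that looks for an antichain. -/
structure AntichainSearch (tab : ℕ → ℕ → ℕ) (prv : ℕ → ℕ) (v m t : ℕ) (ptr wit tim : ℕ → ℕ) :
    Prop where
  trail : IsTrail tab prv wit tim v
  ptr_lt : ∀ i < m, ptr i < v
  before : ∀ i < m, prv (ptr i) = 0 ∨ tim (prv (ptr i) - 1) ≠ 0
  tim_ptr : ∀ i < m, tim (ptr i) = 0
  down : ∀ x < v, tim x ≠ 0 → prv x = 0 ∨ tim (prv x - 1) ≠ 0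
  inj : ∀ i < m, ∀ j < m, ptr i = ptr j → i = j
  tim_le : ∀ x < v, tim x ≤ t

/-- Elements below a pointer in its chain were left earlier. Hence the predecessor of the witness
`ptr b`, if there is one, has a stamp at most `t`, less than the new stamp `t + 1`. Kept apart from
`AntichainSearch.advance` because it is also needed for the last, failing step, where there is no
element to advance to. -/
theorem AntichainSearch.trail_update {tab : ℕ → ℕ → ℕ} {prv : ℕ → ℕ} {v m t : ℕ}
    {ptr wit tim : ℕ → ℕ} (h : AntichainSearch tab prv v m t ptr wit tim)
    (hM : IsMatching tab prv v) {a b : ℕ} (ha : a < m) (hb : b < m) (hab : a ≠ b)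
    (hle : tab (ptr a) (ptr b) = 1) :
    IsTrail tab prv (Function.update wit (ptr a) (ptr b)) (Function.update tim (ptr a) (t + 1)) v := by
  have hne : ptr a ≠ ptr b := fun e => hab (h.inj a ha b hb e)
  refine ⟨fun x hx hx0 => ?_, fun x hx hx0 => ?_, fun x hx hx0 => ?_, fun x hx hx0 => ?_⟩
  · by_cases e : x = ptr a
    · subst e; simpa using h.ptr_lt b hb
    · simp [e] at hx0 ⊢; exact h.trail.lt x hx hx0
  · by_cases e : x = ptr a
    · subst e; simpa using hle
    · simp [e] at hx0 ⊢; exact h.trail.le x hx hx0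
  · by_cases e : x = ptr a
    · subst e; simpa using hne
    · simp [e] at hx0 ⊢; exact h.trail.ne x hx hx0
  · by_cases e : x = ptr a
    · subst e
      simp only [Function.update_self]
      refine (h.before b hb).imp id fun h0 => ?_
      have hne' : prv (ptr b) - 1 ≠ ptr a := by
        intro e; rw [e] at h0; exact h0 (h.tim_ptr a ha)
      rw [Function.update_of_ne hne']
      refine ⟨h0, ?_⟩
      -- The disjunction in `before` is not exclusive: with no predecessor, `prv (ptr b) - 1` is the
      -- default `0`, whose stamp must be bounded as well; `0 < v` permits this.
      by_cases hp : prv (ptr b) = 0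
      · rw [hp] at h0 ⊢
        have hv : 0 < v := by have := h.ptr_lt a ha; omega
        exact Nat.lt_succ_of_le (h.tim_le _ (by simpa using hv))
      · exact Nat.lt_succ_of_le (h.tim_le _ (hM.lt _ (h.ptr_lt b hb) hp))
    · simp only [Function.update_of_ne e] at hx0 ⊢
      refine (h.trail.back x hx hx0).imp id fun ⟨h0, h1⟩ => ?_
      have hne' : prv (wit x) - 1 ≠ ptr a := by
        intro e; rw [e] at h0; exact h0 (h.tim_ptr a ha)
      rw [Function.update_of_ne hne']
      exact ⟨h0, h1⟩

/-- Stamped elements form an initial segment of each chain and the pointers stand just above it. The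
successor of `ptr a` is therefore unstamped, and no other pointer stands there: either would require
`ptr a` to be stamped already. -/
theorem AntichainSearch.advance {tab : ℕ → ℕ → ℕ} {prv nxt head : ℕ → ℕ} {v m t : ℕ}
    {ptr wit tim : ℕ → ℕ} (h : AntichainSearch tab prv v m t ptr wit tim)
    (hM : IsMatching tab prv v) (hC : IsChainData prv nxt head v m)
    {a b : ℕ} (ha : a < m) (hb : b < m) (hab : a ≠ b)
    (hle : tab (ptr a) (ptr b) = 1) (hnxt : nxt (ptr a) ≠ 0) :
    AntichainSearch tab prv v m (t + 1) (Function.update ptr a (nxt (ptr a) - 1))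
      (Function.update wit (ptr a) (ptr b)) (Function.update tim (ptr a) (t + 1)) := by
  obtain ⟨hyv, hpy⟩ := hC.prv_nxt _ (h.ptr_lt a ha) hnxt
  have hyne : nxt (ptr a) - 1 ≠ ptr a := by
    have := hM.ne _ hyv (by omega)
    intro e
    rw [hpy] at this
    omega
  have hmono : ∀ z, tim z ≠ 0 → Function.update tim (ptr a) (t + 1) z ≠ 0 := by
    intro z hz
    by_cases e : z = ptr a
    · simp [e]
    · simpa [e] using hz
  have hty : tim (nxt (ptr a) - 1) = 0 := by
    by_contra h0
    rcases h.down _ hyv h0 with h1 | h1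
    · omega
    · rw [hpy] at h1; exact h1 (h.tim_ptr a ha)
  refine ⟨h.trail_update hM ha hb hab hle, fun i hi => ?_, fun i hi => ?_, fun i hi => ?_,
    fun x hx hx0 => ?_, fun i hi j hj he => ?_, fun x hx => ?_⟩
  · by_cases e : i = a
    · subst e; simpa using hyv
    · simpa [e] using h.ptr_lt i hi
  · by_cases e : i = a
    · subst e; simp [hpy]
    · rw [Function.update_of_ne e]
      exact (h.before i hi).imp id (hmono _)
  · by_cases e : i = a
    · subst e; simp [hyne, hty]
    · have : ptr i ≠ ptr a := fun e' => e (h.inj i hi a ha e')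
      simpa [e, this] using h.tim_ptr i hi
  · by_cases e : x = ptr a
    · subst e
      exact (h.before a ha).imp id (hmono _)
    · rw [Function.update_of_ne e] at hx0
      exact (h.down x hx hx0).imp id (hmono _)
  · have key : ∀ j < m, nxt (ptr a) - 1 ≠ ptr j := by
      intro j hj e
      rcases h.before j hj with h1 | h1
      · rw [← e] at h1; omega
      · rw [← e, hpy] at h1; exact h1 (h.tim_ptr a ha)
    by_cases e : i = a <;> by_cases e' : j = a
    · rw [e, e']
    · simp [e, e'] at he; exact absurd he (key j hj)
    · simp [e, e'] at he; exact absurd he.symm (key i hi)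
    · simp [e, e'] at he; exact h.inj i hi j hj he
  · by_cases e : x = ptr a
    · simp [e]
    · simpa [e] using (h.tim_le x hx).trans (Nat.le_succ t)

theorem violated_antichain {con : ℕ → ℕ} {m : ℕ} {tab : ℕ → ℕ → ℕ} {ptr : ℕ → ℕ} {a b : ℕ}
    (hcon : ∀ a < m, ∀ b < m, con (a * m + b) = if a = b then 2 else 0) (ha : a < m) (hb : b < m)
    (h : Violated con m tab ptr a b) : a ≠ b ∧ tab (ptr a) (ptr b) = 1 := by
  rcases h with ⟨h1, h2⟩ | ⟨h1, -⟩
  · rw [hcon a ha b hb] at h1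
    refine ⟨?_, h2⟩
    rintro rfl
    simp at h1
  · rw [hcon b hb a ha] at h1
    split at h1 <;> omega

/-! ### The chain cover by successive insertion -/

/-- Add the element number `v` to the chain cover of the elements with smaller numbers. -/
def insertElement : PStmt :=
  put .prv Var.v 0 ;; set .v (Var.v + 1) ;; scanChains ;; demandAntichain ;; phase ;;
  ite Var.fail exchange skip

/-- With the new singleton there are at most `w + 1` chains. A failing search yields an exchange and
one chain less; a successful one exhibits an antichain with one element per chain, so the number of
chains is at most `w` already. -/
theorem insertElement_spec (σ : PState) {v n w : ℕ} (hn : σ.var .n = n) (hv : σ.var .v = v)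
    (hvn : v < n) (hO : IsOrderTable σ.table n) (hW : WidthLE σ.table n w)
    (hM : IsMatching σ.table (σ.arr .prv) v) (hc : chainCount (σ.arr .prv) v ≤ w) :
    insertElement.Spec σ (fun τ => τ.var .v = v + 1 ∧ IsMatching σ.table (τ.arr .prv) (v + 1) ∧
      chainCount (τ.arr .prv) (v + 1) ≤ w) (2000 * (w + 2) ^ 3 * (n + 1)) := by
  set P := Function.update (σ.arr .prv) v 0 with hP
  have hPM : IsMatching σ.table P (v + 1) := by
    have hold : ∀ x < v, P x = σ.arr .prv x := fun x hx => by simp [hP, hx.ne]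
    have hlt : ∀ x < v + 1, P x ≠ 0 → x < v := by
      intro x hx h0
      by_contra h
      have : x = v := by omega
      subst this
      simp [hP] at h0
    refine ⟨fun x hx h0 => ?_, fun x hx h0 => ?_, fun x hx h0 => ?_, fun x hx y hy h0 he => ?_⟩
    · have h1 := hlt x hx h0
      rw [hold x h1] at h0 ⊢
      have := hM.lt x h1 h0
      omega
    · have h1 := hlt x hx h0
      rw [hold x h1] at h0 ⊢
      exact hM.le x h1 h0
    · have h1 := hlt x hx h0
      rw [hold x h1] at h0 ⊢
      exact hM.ne x h1 h0
    · have h1 := hlt x hx h0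
      have h2 := hlt y hy (by rwa [← he])
      rw [hold x h1] at h0
      rw [hold x h1, hold y h2] at he
      exact hM.inj x h1 y h2 h0 he
  have hPc : chainCount P (v + 1) ≤ w + 1 := by
    rw [chainCount_succ, chainCount_congr (prv' := σ.arr .prv) fun x hx => by
      simp [hP, hx.ne]]
    split <;> omega
  apply Spec.le
  · apply Spec.put_seq
    apply Spec.set_seq
    set σ₁ := (σ.setArr .prv ((var .v : PExpr).eval σ) ((0 : PExpr).eval σ)).setVar .v
      ((var .v + 1 : PExpr).eval (σ.setArr .prv ((var .v : PExpr).eval σ) ((0 : PExpr).eval σ)))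
      with hσ₁
    have hprv₁ : σ₁.arr .prv = P := by simp [hσ₁, hv, hP]
    have hv₁ : σ₁.var .v = v + 1 := by simp [hσ₁, hv]
    have hn₁ : σ₁.var .n = n := by simp [hσ₁, hn]
    have htab₁ : σ₁.table = σ.table := by
      funext a b
      simp [PState.table, hσ₁]
    have hs := scanChains_spec σ₁ (tab := σ.table) hv₁ (by rw [hprv₁]; exact hPM)
    rw [hprv₁] at hs
    apply hs.seq
    rintro τ hvτ haτ ⟨hm, hC, hptr, htim⟩
    have hprvτ : τ.arr .prv = P := (haτ .prv (by decide)).trans hprv₁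
    set m := τ.var .m with hmdef
    have hmw : m ≤ w + 1 := by omega
    apply ((demandAntichain_spec τ hmdef.symm).le (B' := 100 * (w + 2) ^ 2)
      (Nat.mul_le_mul_left _ (Nat.pow_le_pow_left (by omega) 2))).seq
    intro υ hvυ haυ hcon
    have hnυ : υ.var .n = n := by rw [hvυ .n (by decide), hvτ .n (by decide), hn₁]
    have hvυ' : υ.var .v = v + 1 := by rw [hvυ .v (by decide), hvτ .v (by decide), hv₁]
    have hmυ : υ.var .m = m := by rw [hvυ .m (by decide)]
    have hprvυ : υ.arr .prv = P := (haυ .prv (by decide)).trans hprvτ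
    have htabυ : υ.table = σ.table := by
      rw [← htab₁]
      funext a b
      simp only [PState.table]
      rw [haυ .inp (by decide), haυ .row (by decide), haτ .inp (by decide), haτ .row (by decide)]
    have hCυ : IsChainData P (υ.arr .nxt) (υ.arr .head) (v + 1) m := by
      rw [haυ .nxt (by decide), haυ .head (by decide)]; exact hC
    have hptrυ : ∀ i < m, υ.arr .ptr i = υ.arr .head i := by
      rw [haυ .ptr (by decide), haυ .head (by decide)]; exact hptr
    have htimυ : ∀ x < v + 1, υ.arr .tim x = 0 := by
      rw [haυ .tim (by decide)]; exact htim
    have hph := phase_spec υ (m := m) (n := n) hmυ hnυ (AntichainSearch σ.table P (v + 1) m)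
      (height σ.table n) ?_ ?_ ?_
    · refine (hph.seq (B' := 200 * ((w + 2) * (n + 1))) ?_).le
        (B' := 500 * (w + 2) ^ 3 * (n + 1) + 200 * ((w + 2) * (n + 1))) ?_
      · intro ω hvω haω hω
        have hprvω : ω.arr .prv = P := (haω .prv (by decide)).trans hprvυ
        rw [htabυ] at hω
        have hvω' : ω.var .v = v + 1 := (hvω .v (by decide)).trans hvυ'
        apply Spec.le
        · apply Spec.ite (B := 100 * (m * n + 1))
          · intro hf
            have hf : ω.var .fail ≠ 0 := hf
            rcases hω with ⟨h, -⟩ | ⟨-, hacc, t, ht, ptr, wit, tim, a, ha, b, hb, hK, hV, hx, hl,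
              hwω, htω⟩
            · exact absurd h hf
            obtain ⟨hab, hle⟩ := violated_antichain hcon ha hb hV
            have hpa := hK.ptr_lt a ha
            refine (exchange_spec ω (tab := σ.table) (v := v + 1) hacc (by rw [hprvω]; exact hPM)
              ?_ ?_ ?_ ?_ ?_).mono ?_ le_rfl
            · rw [hprvω, hwω, htω]
              exact hK.trail_update hPM ha hb hab hle
            · rw [hl]; exact hpa
            · rw [hl, htω]; simp
            · rw [hl, htω]; simp; omega
            -- A `y` with predecessor `last` would be its successor, but the search failed because
            -- `nxt` is `0` there.
            · intro y hy he
              rw [hprvω, hl] at he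
              have := hCυ.nxt_prv y hy (by omega)
              rw [he, Nat.add_sub_cancel, hx] at this
              omega
            · rintro ψ hvψ - ⟨h1, h2⟩
              refine ⟨(hvψ .v (by decide)).trans hvω', h1, ?_⟩
              rw [hprvω] at h2
              omega
          · intro hf
            have hf : ω.var .fail = 0 := hf
            rcases hω with ⟨-, t, hK, hA⟩ | ⟨h, -⟩
            swap
            · exact absurd hf h
            refine Spec.of_loopFree rfl (Nat.zero_le _) ?_
            simp only [run_skip, hprvω]
            refine ⟨hvω', hPM, ?_⟩
            rw [← hm]
            refine hW m (ω.arr .ptr) (fun i hi => ?_) fun i hi j hj hij h1 => ?_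
            · have := hK.ptr_lt i hi
              omega
            · exact hA i hi j hj (by rw [hcon i hi j hj, if_neg hij, h1])
        · show 1 + 2 + 100 * (m * n + 1) ≤ _
          have : m * n ≤ (w + 2) * n := Nat.mul_le_mul_right _ (by omega)
          nlinarith
      · have : (m + 1) ^ 3 ≤ (w + 2) ^ 3 := Nat.pow_le_pow_left (by omega) 3
        have := Nat.mul_le_mul_right (n + 1) (Nat.mul_le_mul_left 500 this)
        omega
    · refine ⟨⟨fun x hx h0 => absurd (htimυ x hx) h0, fun x hx h0 => absurd (htimυ x hx) h0,
        fun x hx h0 => absurd (htimυ x hx) h0, fun x hx h0 => absurd (htimυ x hx) h0⟩,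
        fun i hi => ?_, fun i hi => ?_, fun i hi => ?_, fun x hx h0 => absurd (htimυ x hx) h0,
        fun i hi j hj he => ?_, fun x hx => (htimυ x hx).le⟩
      · rw [hptrυ i hi]; exact (hCυ.head_lt i hi).1
      · rw [hptrυ i hi]; exact Or.inl (hCυ.head_lt i hi).2
      · rw [hptrυ i hi]; exact htimυ _ (hCυ.head_lt i hi).1
      · rw [hptrυ i hi, hptrυ j hj] at he
        exact hCυ.head_inj i hi j hj he
    · intro t ptr wit tim hK a ha b hb hV hx
      rw [htabυ] at hV
      obtain ⟨hab, hle⟩ := violated_antichain hcon ha hb hV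
      exact hK.advance hPM hCυ ha hb hab hle hx
    · intro t ptr wit tim hK a ha
      have hpa := hK.ptr_lt a ha
      refine ⟨height_lt (by omega), fun hx => ?_⟩
      obtain ⟨hyv, hpy⟩ := hCυ.prv_nxt _ hpa hx
      have h1 := hPM.le _ hyv (by omega)
      have h2 := hPM.ne _ hyv (by omega)
      rw [hpy, Nat.add_sub_cancel] at h1 h2
      exact hO.height_lt_height (by omega) (by omega) h1 h2
  · show 1 + 1 + 7 + (1 + 1 + 1 + 1 + (200 * (v + 1 + 1) + (100 * (w + 2) ^ 2 +
      (500 * (w + 2) ^ 3 * (n + 1) + 200 * ((w + 2) * (n + 1)))))) ≤ _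
    have h2 : (w + 2) ^ 2 ≤ (w + 2) ^ 3 := Nat.pow_le_pow_right (by omega) (by omega)
    have h3 : w + 2 ≤ (w + 2) ^ 3 := Nat.le_self_pow (by omega) _
    have h4 := Nat.mul_le_mul_right (n + 1) h3
    have h5 := Nat.le_mul_of_pos_right ((w + 2) ^ 3) (Nat.succ_pos n)
    have h6 : n + 1 ≤ (w + 2) ^ 3 * (n + 1) := Nat.le_mul_of_pos_left _ (by positivity)
    rw [Nat.mul_assoc, Nat.mul_assoc]
    simp only [Nat.succ_eq_add_one] at h5
    omega

/-- Compute a chain cover of the poset. -/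
def coverByChains : PStmt := set .v 0 ;; loop Var.n insertElement ;; scanChains

/-- The final scan is needed because the last insertion may have changed `prv` after `nxt` and
`head` were computed. -/
theorem coverByChains_spec (σ : PState) {n w : ℕ} (hn : σ.var .n = n)
    (hO : IsOrderTable σ.table n) (hW : WidthLE σ.table n w) :
    coverByChains.Spec σ (fun τ => τ.var .m ≤ w ∧ IsMatching σ.table (τ.arr .prv) n ∧
      IsChainData (τ.arr .prv) (τ.arr .nxt) (τ.arr .head) n (τ.var .m))
      (2500 * (w + 2) ^ 3 * (n + 1) ^ 2) := by
  apply Spec.le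
  · apply Spec.set_seq
    apply Spec.seq
    · refine Spec.loop (N := n) (fun r τ => τ.var .v = r ∧
        IsMatching σ.table (τ.arr .prv) r ∧ chainCount (τ.arr .prv) r ≤ w)
        (B := 2000 * (w + 2) ^ 3 * (n + 1)) ?_ ?_ ?_
      · simp [hn]
      · exact ⟨rfl, ⟨by simp, by simp, by simp, by simp⟩, Nat.zero_le _⟩
      · rintro r hr τ hvτ haτ ⟨hv, hM, hc⟩
        have htab : τ.table = σ.table := by
          funext a b
          simp only [PState.table]
          rw [haτ .inp (by decide), haτ .row (by decide)]; rfl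
        have := insertElement_spec τ (v := r) (n := n) (w := w)
          (by rw [hvτ .n (by decide)]; simpa using hn) hv hr (by rwa [htab]) (by rwa [htab])
          (by rwa [htab]) hc
        rwa [htab] at this
    · rintro τ hvτ haτ ⟨hv, hM, hc⟩
      refine (scanChains_spec τ hv hM).mono ?_ le_rfl
      rintro υ hvυ haυ ⟨hm, hC, -, -⟩
      rw [haυ .prv (by decide)]
      exact ⟨by omega, hM, hC⟩
  · show 1 + 1 + (1 + 2 + n * (2000 * (w + 2) ^ 3 * (n + 1) + 4) + 200 * (n + 1)) ≤ _
    have h3 : 1 ≤ (w + 2) ^ 3 := Nat.one_le_pow _ _ (by omega)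
    have h6 : n + 1 ≤ (w + 2) ^ 3 * (n + 1) := Nat.le_mul_of_pos_left _ (by positivity)
    have h7 : (w + 2) ^ 3 * (n + 1) ≤ (w + 2) ^ 3 * (n + 1) ^ 2 :=
      Nat.mul_le_mul_left _ (Nat.le_self_pow (by omega) _)
    nlinarith

/-! ## Reading the input -/

/-- Move the input into the array `inp`. -/
def readInput : PStmt :=
  set .n (raw 0) ;; set .q (raw 1) ;; set .len (raw 2) ;; set .hi (Var.len + 3) ;;
  loop Var.n (set .hi (Var.hi + Var.n)) ;; set .size Var.hi ;;
  loop Var.size (set .hi (Var.hi - 1) ;; put .inp Var.hi (raw Var.hi))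

/-- Cell `a` moves to cell `16 * a` of the same memory. Going downwards is safe: the target is never
below the source, so no unread cell is overwritten. Beyond the input both cells contain `0`, so
equality holds for every `a`. -/
theorem readInput_spec (σ : PState) {n q len : ℕ} (hn : σ.mem 0 = n) (hq : σ.mem 1 = q)
    (hlen : σ.mem 2 = len) (hz : ∀ a, len + 3 + n * n ≤ a → σ.mem a = 0) :
    readInput.Spec σ (fun τ => τ.var .n = n ∧ τ.var .q = q ∧ τ.var .len = len ∧
      τ.var .size = len + 3 + n * n ∧ ∀ a, τ.arr .inp a = σ.mem a)
      (200 * (len + 1) * (n + 1) ^ 2) := by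
  set L := len + 3 + n * n with hL
  apply Spec.le
  · apply Spec.set_seq
    apply Spec.set_seq
    apply Spec.set_seq
    apply Spec.set_seq
    apply Spec.seq (Q := fun τ => τ.var .hi = L ∧ τ.mem = σ.mem)
    · refine Spec.loop (N := n) (B := 10) (fun r τ => τ.var .hi = len + 3 + r * n ∧ τ.mem = σ.mem)
        ?_ ?_ ?_
      · simp [hn]
      · simp [hlen]
      · rintro r hr τ hv ha ⟨hI, hmem⟩
        have := hv .n (by decide)
        simp [hn] at this
        refine Spec.of_loopFree rfl (by decide) ?_
        simp [hI, this, hmem]; ring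
    · rintro τ hv ha ⟨hhi, hmem⟩
      have h1 : τ.var .n = n := by simpa [hn] using hv .n (by decide)
      have h2 : τ.var .q = q := by simpa [hq] using hv .q (by decide)
      have h3 : τ.var .len = len := by simpa [hlen] using hv .len (by decide)
      apply Spec.set_seq
      refine (Spec.loop (N := L) (B := 30) (fun r τ => τ.var .hi = L - r ∧
        (∀ a, L - r ≤ a → τ.arr .inp a = σ.mem a) ∧ ∀ a < L - r, τ.mem a = σ.mem a)
        ?_ ?_ ?_).mono ?_ le_rfl
      · simp [hhi]
      · refine ⟨by simp [hhi], fun a ha' => ?_, fun a ha' => by simp [hmem]⟩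
        simp only [PState.setVar_arr, PState.arr, hmem]
        have h1 := hz a ha'
        have h2 := hz (16 * a + Arr.inp.code) (by simp only [Nat.sub_zero] at ha'; omega)
        rw [PState.setVar_mem, hmem, h1, h2]
      · rintro r hr υ - - ⟨hI, hA, hB⟩
        refine Spec.of_loopFree rfl (by decide) ?_
        have e : L - r - 1 = L - (r + 1) := by omega
        simp only [run_seq, run_set, run_put, PState.setVar_var, PState.setArr_arr,
          PState.setVar_arr, PState.setArr_var, eval_var, eval_sub, eval_one, eval_raw,
          PState.setVar_mem, hI, if_true, e, true_and]
        refine ⟨fun a ha' => ?_, fun a ha' => ?_⟩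
        · by_cases h : a = L - (r + 1)
          · subst h
            rw [Function.update_self]
            exact hB _ (by omega)
          · rw [Function.update_of_ne h]
            exact hA a (by omega)
        · have : a ≠ 16 * (L - (r + 1)) + Arr.inp.code := by omega
          simp only [PState.setArr, PState.setVar_mem, Function.update_of_ne this]
          exact hB a (by omega)
      · rintro υ hv' ha' ⟨-, hA, -⟩
        refine ⟨?_, ?_, ?_, ?_, fun a => hA a (by omega)⟩
        · simpa [h1] using hv' .n (by decide)
        · simpa [h2] using hv' .q (by decide)
        · simpa [h3] using hv' .len (by decide)
        · simpa [hhi] using hv' .size (by decide)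
  · show 1 + 1 + 1 + (1 + 1 + 1 + (1 + 1 + 1 + (1 + 1 + 1 + 1 + (1 + 2 + n * (10 + 4) +
      (1 + 1 + (1 + 2 + L * (30 + 4))))))) ≤ _
    rw [hL]
    nlinarith [Nat.zero_le (len * (n * n)), Nat.zero_le (len * n)]

/-- Compute the addresses of the rows of the order table. -/
def findRows : PStmt :=
  set .i 0 ;; set .x 3 ;; loop Var.n (put .row Var.i Var.x ;; set .x (Var.x + Var.n) ;; set .i (Var.i + 1))

theorem findRows_spec (σ : PState) {n : ℕ} (hn : σ.var .n = n) :
    findRows.Spec σ (fun τ => ∀ a < n, τ.arr .row a = 3 + a * n) (100 * (n + 1)) := by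
  apply Spec.le
  · apply Spec.set_seq
    apply Spec.set_seq
    refine (Spec.loop (N := n) (B := 40) (fun r τ => τ.var .i = r ∧ τ.var .x = 3 + r * n ∧
      ∀ a < r, τ.arr .row a = 3 + a * n) ?_ ?_ ?_).mono (fun τ _ _ h => h.2.2) le_rfl
    · simp [hn]
    · simp
    · rintro r hr τ hv - ⟨hi, hx, hI⟩
      have hn' : τ.var .n = n := by simpa [hn] using hv .n (by decide)
      refine Spec.of_loopFree rfl (by decide) ?_
      simp only [run_seq, run_set, run_put, PState.setVar_var, PState.setArr_arr,
          PState.setVar_arr, PState.setArr_var, eval_var, eval_add, eval_one, hi, hx, hn',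
          if_true, if_false, reduceCtorEq, true_and]
      refine ⟨by ring, fun a ha => ?_⟩
      by_cases h : a = r
      · simp [h]
      · rw [Function.update_of_ne h]; exact hI a (by omega)
  · show 1 + 1 + (1 + 1 + (1 + 2 + n * (40 + 4))) ≤ _
    omega

/-! ## Evaluating the quantifier-free part -/

namespace QFFormula

/-- The truth value of a formula when `x_i ≤ x_j` is read as `M i j` and `x_i = x_j` as
`M i j ∧ M j i`. -/
def Holds {q : ℕ} (M : ℕ → ℕ → Prop) : QFFormula q → Prop
  | eq i j => M i j ∧ M j i
  | le i j => M i j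
  | ne i j => ¬ (M i j ∧ M j i)
  | nle i j => ¬ M i j
  | and ψ₁ ψ₂ => ψ₁.Holds M ∧ ψ₂.Holds M
  | or ψ₁ ψ₂ => ψ₁.Holds M ∨ ψ₂.Holds M

theorem holds_congr {q : ℕ} {M M' : ℕ → ℕ → Prop} (h : ∀ i < q, ∀ j < q, M i j ↔ M' i j)
    (ψ : QFFormula q) : ψ.Holds M ↔ ψ.Holds M' := by
  induction ψ with
  | eq i j => simp only [Holds, h i i.2 j j.2, h j j.2 i i.2]
  | le i j => simp only [Holds, h i i.2 j j.2]
  | ne i j => simp only [Holds, h i i.2 j j.2, h j j.2 i i.2]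
  | nle i j => simp only [Holds, h i i.2 j j.2]
  | and ψ₁ ψ₂ h₁ h₂ => simp only [Holds, h₁, h₂]
  | or ψ₁ ψ₂ h₁ h₂ => simp only [Holds, h₁, h₂]

theorem length_encode_le {q : ℕ} (ψ : QFFormula q) : ψ.encode.length ≤ ψ.size := by
  induction ψ <;> simp_all [encode, size] <;> omega

end QFFormula

/-- Process a connective. -/
def evalConnective : PStmt :=
  set .sp (Var.sp - 1) ;; set .x (get .stk (Var.sp - 1)) ;; set .y (get .stk Var.sp) ;;
  ite (Var.tok - 4) (put .stk (Var.sp - 1) (Var.x + Var.y))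
    (put .stk (Var.sp - 1) (1 - ((1 - Var.x) + (1 - Var.y)))) ;;
  set .pos (Var.pos + 1)

/-- Process a literal. -/
def evalLiteral : PStmt :=
  set .i (get .inp (Var.pos + 1)) ;; set .j (get .inp (Var.pos + 2)) ;;
  set .x (get .con (get .qrow Var.i + Var.j)) ;; set .y (get .con (get .qrow Var.j + Var.i)) ;;
  set .y (1 - ((1 - Var.x) + (1 - Var.y))) ;;
  ite Var.tok (ite (Var.tok - 1) (ite (Var.tok - 2)
    (put .stk Var.sp (1 - Var.x)) (put .stk Var.sp (1 - Var.y)))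
    (put .stk Var.sp Var.x)) (put .stk Var.sp Var.y) ;;
  set .sp (Var.sp + 1) ;; set .pos (Var.pos + 3)

/-- Process the next symbol of the code of the formula. -/
def evalToken : PStmt :=
  ite (Var.size - Var.pos)
    (set .tok (get .inp Var.pos) ;; ite (Var.tok - 3) evalConnective evalLiteral)
    skip

/-- Evaluate the quantifier-free part, reading `x_i ≤ x_j` from the array `con`. -/
def evalFormula : PStmt :=
  set .pos (Var.size - Var.len) ;; set .sp 0 ;; loop Var.len evalToken ;; set .val (get .stk 0)

theorem evalToken_frame (σ : PState) (t : ℕ) :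
    (evalToken.run^[t] σ).var .size = σ.var .size ∧ (evalToken.run^[t] σ).arr .inp = σ.arr .inp ∧
    (evalToken.run^[t] σ).arr .con = σ.arr .con ∧ (evalToken.run^[t] σ).arr .qrow = σ.arr .qrow := by
  induction t with
  | zero => exact ⟨rfl, rfl, rfl, rfl⟩
  | succ t ih =>
    simp only [Function.iterate_succ_apply']
    rw [run_var _ (by decide), run_arr _ (by decide), run_arr _ (by decide), run_arr _ (by decide)]
    exact ih

/-- Treats the four kinds of literals at once, by their code `c`. On the stack any nonzero number
means true. -/
theorem evalToken_literal {q : ℕ} (ψ : QFFormula q) (σ : PState) {p s c : ℕ} {i j : Fin q} {P : Prop}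
    (hp : σ.var .pos = p) (hs : σ.var .sp = s)
    (hsize : p + ψ.encode.length ≤ σ.var .size)
    (hinp : ∀ i, ∀ h : i < ψ.encode.length, σ.arr .inp (p + i) = ψ.encode[i])
    (hrow : ∀ i < q, σ.arr .qrow i = i * q)
    (he : ψ.encode = [c, (i : ℕ), (j : ℕ)]) (hc : c < 4)
    (hP : (if c = 0 then 1 - ((1 - σ.arr .con (i * q + j)) + (1 - σ.arr .con (j * q + i)))
        else if c = 1 then σ.arr .con (i * q + j)
        else if c = 2 then 1 - (1 - ((1 - σ.arr .con (i * q + j)) + (1 - σ.arr .con (j * q + i))))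
        else 1 - σ.arr .con (i * q + j)) ≠ 0 ↔ P) :
    ∃ t ≤ ψ.encode.length, (evalToken.run^[t] σ).var .pos = p + ψ.encode.length ∧
      (evalToken.run^[t] σ).var .sp = s + 1 ∧
      ((evalToken.run^[t] σ).arr .stk s ≠ 0 ↔ P) ∧
      ∀ i < s, (evalToken.run^[t] σ).arr .stk i = σ.arr .stk i := by
  have h0 : σ.arr .inp p = c := by simpa [he] using hinp 0 (by simp [he])
  have h1 : σ.arr .inp (p + 1) = i := by simpa [he] using hinp 1 (by simp [he])
  have h2 : σ.arr .inp (p + 2) = j := by simpa [he] using hinp 2 (by simp [he])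
  have hsz : σ.var .size - p ≠ 0 := by simp [he] at hsize; omega
  refine ⟨1, by simp [he], ?_⟩
  rw [← hP]
  have hc' : c = 0 ∨ c = 1 ∨ c = 2 ∨ c = 3 := by omega
  rcases hc' with rfl | rfl | rfl | rfl <;>
  · simp [evalToken, evalLiteral, hp, hs, hsz, h0, h1, h2, hrow i i.2, hrow j j.2, he]
    intro a ha
    rw [Function.update_of_ne (by omega)]

theorem evalToken_connective (σ : PState) {p s c : ℕ} (hp : σ.var .pos = p)
    (hs : σ.var .sp = s + 2) (hsize : p < σ.var .size) (hinp : σ.arr .inp p = c) (hc : 4 ≤ c) :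
    (evalToken.run σ).var .pos = p + 1 ∧ (evalToken.run σ).var .sp = s + 1 ∧
      (evalToken.run σ).arr .stk = Function.update (σ.arr .stk) s
        (if c = 4 then 1 - ((1 - σ.arr .stk s) + (1 - σ.arr .stk (s + 1)))
          else σ.arr .stk s + σ.arr .stk (s + 1)) := by
  have hsz : σ.var .size - p ≠ 0 := by omega
  have hc3 : c - 3 ≠ 0 := by omega
  by_cases h4 : c = 4
  · simp [evalToken, evalConnective, hp, hs, hsz, hinp, h4]
  · have hc4 : c - 4 ≠ 0 := by omega
    simp [evalToken, evalConnective, hp, hs, hsz, hinp, h4, hc3, hc4]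

/-- Takes the two induction hypotheses as arguments so that both connectives share the proof.
Disjunction is a sum of natural numbers, conjunction a truncated difference. -/
theorem evalToken_binary {q : ℕ} {ψ₁ ψ₂ : QFFormula q} (σ : PState) {p s c : ℕ}
    (ih₁ : ∀ (σ : PState) {p s : ℕ}, σ.var .pos = p → σ.var .sp = s →
      p + ψ₁.encode.length ≤ σ.var .size →
      (∀ i, ∀ h : i < ψ₁.encode.length, σ.arr .inp (p + i) = ψ₁.encode[i]) →
      (∀ i < q, σ.arr .qrow i = i * q) →
      ∃ t ≤ ψ₁.encode.length, (evalToken.run^[t] σ).var .pos = p + ψ₁.encode.length ∧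
      (evalToken.run^[t] σ).var .sp = s + 1 ∧
      ((evalToken.run^[t] σ).arr .stk s ≠ 0 ↔
        ψ₁.Holds fun i j => σ.arr .con (i * q + j) ≠ 0) ∧
      ∀ i < s, (evalToken.run^[t] σ).arr .stk i = σ.arr .stk i)
    (ih₂ : ∀ (σ : PState) {p s : ℕ}, σ.var .pos = p → σ.var .sp = s →
      p + ψ₂.encode.length ≤ σ.var .size →
      (∀ i, ∀ h : i < ψ₂.encode.length, σ.arr .inp (p + i) = ψ₂.encode[i]) →
      (∀ i < q, σ.arr .qrow i = i * q) →
      ∃ t ≤ ψ₂.encode.length, (evalToken.run^[t] σ).var .pos = p + ψ₂.encode.length ∧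
      (evalToken.run^[t] σ).var .sp = s + 1 ∧
      ((evalToken.run^[t] σ).arr .stk s ≠ 0 ↔
        ψ₂.Holds fun i j => σ.arr .con (i * q + j) ≠ 0) ∧
      ∀ i < s, (evalToken.run^[t] σ).arr .stk i = σ.arr .stk i)
    (hp : σ.var .pos = p) (hs : σ.var .sp = s)
    (hsize : p + (ψ₁.encode ++ ψ₂.encode ++ [c]).length ≤ σ.var .size)
    (hinp : ∀ i, ∀ h : i < (ψ₁.encode ++ ψ₂.encode ++ [c]).length,
      σ.arr .inp (p + i) = (ψ₁.encode ++ ψ₂.encode ++ [c])[i])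
    (hrow : ∀ i < q, σ.arr .qrow i = i * q) (hc : 4 ≤ c) :
    ∃ t ≤ (ψ₁.encode ++ ψ₂.encode ++ [c]).length,
      (evalToken.run^[t] σ).var .pos = p + (ψ₁.encode ++ ψ₂.encode ++ [c]).length ∧
      (evalToken.run^[t] σ).var .sp = s + 1 ∧
      ((evalToken.run^[t] σ).arr .stk s ≠ 0 ↔
        if c = 4 then (ψ₁.Holds fun i j => σ.arr .con (i * q + j) ≠ 0) ∧
            (ψ₂.Holds fun i j => σ.arr .con (i * q + j) ≠ 0)
          else (ψ₁.Holds fun i j => σ.arr .con (i * q + j) ≠ 0) ∨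
            (ψ₂.Holds fun i j => σ.arr .con (i * q + j) ≠ 0)) ∧
      ∀ i < s, (evalToken.run^[t] σ).arr .stk i = σ.arr .stk i := by
  have hl : (ψ₁.encode ++ ψ₂.encode ++ [c]).length =
      ψ₁.encode.length + ψ₂.encode.length + 1 := by simp; omega
  rw [hl] at hsize ⊢
  obtain ⟨t₁, ht₁, hp₁, hs₁, hv₁, hk₁⟩ := ih₁ σ hp hs (by omega) (fun i hi => by
    rw [hinp i (by omega), List.getElem_append_left (by simp; omega),
      List.getElem_append_left hi]) hrow
  obtain ⟨hz₁, hi₁, hc₁, hr₁⟩ := evalToken_frame σ t₁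
  obtain ⟨t₂, ht₂, hp₂, hs₂, hv₂, hk₂⟩ := ih₂ _ hp₁ hs₁ (by omega) (fun i hi => by
    rw [hi₁, Nat.add_assoc, hinp (ψ₁.encode.length + i) (by omega),
      List.getElem_append_left (by simp; omega), List.getElem_append_right (by omega)]
    simp) (by rwa [hr₁])
  obtain ⟨hz₂, hi₂, hc₂, hr₂⟩ := evalToken_frame (evalToken.run^[t₁] σ) t₂
  obtain ⟨hp₃, hs₃, hk₃⟩ := evalToken_connective _ (c := c) hp₂ hs₂ (by omega) (by
    rw [hi₂, hi₁, Nat.add_assoc, hinp _ (by omega), List.getElem_append_right (by simp)]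
    simp) hc
  refine ⟨(t₁ + t₂) + 1, by omega, ?_⟩
  rw [Function.iterate_succ_apply', Nat.add_comm t₁ t₂, Function.iterate_add_apply, hp₃, hs₃, hk₃,
    Function.update_self]
  refine ⟨by omega, rfl, ?_, fun i hi => ?_⟩
  · rw [hc₁] at hv₂
    rw [hk₂ s (by omega), ← hv₁, ← hv₂]
    split <;> omega
  · rw [Function.update_of_ne (by omega), hk₂ i (by omega), hk₁ i hi]

/-- The usual invariant of postfix evaluation: the code of `ψ` pushes one value and leaves the stack
below it intact. The number `t` of rounds can be less than the length, since a literal takes one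
round for three symbols. -/
theorem evalToken_correct {q : ℕ} (ψ : QFFormula q) (σ : PState) {p s : ℕ}
    (hp : σ.var .pos = p) (hs : σ.var .sp = s)
    (hsize : p + ψ.encode.length ≤ σ.var .size)
    (hinp : ∀ i, ∀ h : i < ψ.encode.length, σ.arr .inp (p + i) = ψ.encode[i])
    (hrow : ∀ i < q, σ.arr .qrow i = i * q) :
    ∃ t ≤ ψ.encode.length, (evalToken.run^[t] σ).var .pos = p + ψ.encode.length ∧
      (evalToken.run^[t] σ).var .sp = s + 1 ∧
      ((evalToken.run^[t] σ).arr .stk s ≠ 0 ↔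
        ψ.Holds fun i j => σ.arr .con (i * q + j) ≠ 0) ∧
      ∀ i < s, (evalToken.run^[t] σ).arr .stk i = σ.arr .stk i := by
  induction ψ generalizing σ p s with
  | eq i j =>
    refine evalToken_literal (QFFormula.eq i j) σ hp hs hsize hinp hrow rfl (by omega) ?_
    simp only [QFFormula.Holds, if_true]; omega
  | le i j =>
    refine evalToken_literal (QFFormula.le i j) σ hp hs hsize hinp hrow rfl (by omega) ?_
    simp [QFFormula.Holds]
  | ne i j =>
    refine evalToken_literal (QFFormula.ne i j) σ hp hs hsize hinp hrow rfl (by omega) ?_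
    simp [QFFormula.Holds]; omega
  | nle i j =>
    refine evalToken_literal (QFFormula.nle i j) σ hp hs hsize hinp hrow rfl (by omega) ?_
    simp [QFFormula.Holds]; omega
  | and ψ₁ ψ₂ ih₁ ih₂ => exact evalToken_binary σ ih₁ ih₂ hp hs hsize hinp hrow le_rfl
  | or ψ₁ ψ₂ ih₁ ih₂ => exact evalToken_binary σ ih₁ ih₂ hp hs hsize hinp hrow (by omega)

theorem evalFormula_spec {q : ℕ} (ψ : QFFormula q) (σ : PState) {len : ℕ}
    (hlen : σ.var .len = len) (hψ : len = ψ.encode.length) (hsize : len ≤ σ.var .size)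
    (hinp : ∀ i, ∀ h : i < ψ.encode.length,
      σ.arr .inp (σ.var .size - len + i) = ψ.encode[i])
    (hrow : ∀ i < q, σ.arr .qrow i = i * q) :
    evalFormula.Spec σ (fun τ => τ.var .val ≠ 0 ↔ ψ.Holds fun i j => σ.arr .con (i * q + j) ≠ 0)
      (500 * (len + 1)) := by
  apply Spec.le
  · apply Spec.set_seq
    apply Spec.set_seq
    set σ₁ := (σ.setVar .pos ((var .size - var .len : PExpr).eval σ)).setVar .sp
      ((0 : PExpr).eval (σ.setVar .pos ((var .size - var .len : PExpr).eval σ))) with hσ₁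
    apply Spec.seq (Q := fun τ => τ = evalToken.run^[len] σ₁)
    · refine Spec.loop (N := len) (B := 400) (fun r τ => τ = evalToken.run^[r] σ₁) ?_ rfl ?_
      · simp [hσ₁, hlen]
      · rintro r hr τ - - rfl
        exact Spec.of_loopFree rfl (by decide) (Function.iterate_succ_apply' _ _ _).symm
    · rintro τ - - rfl
      refine Spec.of_loopFree (B := 20) rfl (by decide) ?_
      obtain ⟨t, ht, hp, hs, hv, -⟩ := evalToken_correct ψ σ₁ (p := σ.var .size - len) (s := 0)
        (by simp [hσ₁, hlen]) (by simp [hσ₁])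
        (by have : σ₁.var .size = σ.var .size := by simp [hσ₁]
            omega) hinp hrow
      -- The code stands at the end of the input, so once it is consumed the remaining rounds of the
      -- loop do nothing.
      have hstay : ∀ r, evalToken.run^[r] (evalToken.run^[t] σ₁) = evalToken.run^[t] σ₁ := by
        intro r
        induction r with
        | zero => rfl
        | succ r ih =>
          rw [Function.iterate_succ_apply', ih]
          have h1 := (evalToken_frame σ₁ t).1
          have h2 : σ₁.var .size = σ.var .size := by simp [hσ₁]
          have : (evalToken.run^[t] σ₁).var .size - (evalToken.run^[t] σ₁).var .pos = 0 := by omega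
          simp [evalToken, this] at this ⊢
      have hfin : evalToken.run^[len] σ₁ = evalToken.run^[t] σ₁ := by
        obtain ⟨r, rfl⟩ : ∃ r, len = r + t := ⟨len - t, by omega⟩
        rw [Function.iterate_add_apply, hstay]
      have hcon : σ₁.arr .con = σ.arr .con := rfl
      rw [hcon] at hv
      rw [hfin]
      simpa using hv
  · show 1 + 1 + 1 + 1 + (1 + 1 + (1 + 2 + len * (400 + 4) + 20)) ≤ _
    omega

/-! ## Guessing the order type and the chains -/

/-- Write the binary digits of the guess into the array `con`. -/
def writeBits : PStmt :=
  set .x Var.guess ;; set .idx 0 ;;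
  loop Var.bits (put .con Var.idx (Var.x - ((half Var.x) + (half Var.x))) ;; set .x (half Var.x) ;;
    set .idx (Var.idx + 1))

theorem writeBits_spec (σ : PState) {g B : ℕ} (hg : σ.var .guess = g) (hB : σ.var .bits = B) :
    writeBits.Spec σ (fun τ => ∀ p < B, τ.arr .con p = g / 2 ^ p % 2) (100 * (B + 1)) := by
  apply Spec.le
  · apply Spec.set_seq
    apply Spec.set_seq
    refine (Spec.loop (N := B) (B := 40) (fun r τ => τ.var .idx = r ∧ τ.var .x = g / 2 ^ r ∧
      ∀ p < r, τ.arr .con p = g / 2 ^ p % 2) ?_ ?_ ?_).mono (fun τ _ _ h => h.2.2) le_rfl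
    · simp [hB]
    · simp [hg]
    · rintro r hr τ - - ⟨hi, hx, hI⟩
      refine Spec.of_loopFree rfl (by decide) ?_
      simp only [run_seq, run_set, run_put, PState.setVar_var, PState.setArr_arr,
          PState.setVar_arr, PState.setArr_var, eval_var, eval_add, eval_sub, eval_half, eval_one,
          hi, hx, if_true, if_false, reduceCtorEq, true_and]
      refine ⟨by rw [Nat.div_div_eq_div_mul, pow_succ], fun p hp => ?_⟩
      by_cases h : p = r
      · subst h
        rw [Function.update_self]
        omega
      · rw [Function.update_of_ne h]; exact hI p (by omega)
  · show 1 + 1 + (1 + 1 + (1 + 2 + B * (40 + 4))) ≤ _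
    omega

/-- Put each pointer at the least element of the chain that is guessed for it. -/
def placePointers : PStmt :=
  set .ok 1 ;; set .idx Var.qq ;; set .i 0 ;;
  loop Var.q (set .found 0 ;; set .j 0 ;;
    loop Var.k (ite (get .con Var.idx) (put .ptr Var.i (get .head Var.j) ;; set .found 1) skip ;;
      set .idx (Var.idx + 1) ;; set .j (Var.j + 1)) ;;
    ite Var.found skip (set .ok 0) ;; set .i (Var.i + 1))

/-- The bits from `Q` on are a `q × k` matrix. A row with several ones is tolerated (the last one
counts); only a row without ones makes the guess invalid. -/
theorem placePointers_spec (σ : PState) {q k Q : ℕ} (hq : σ.var .q = q) (hk : σ.var .k = k)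
    (hQ : σ.var .qq = Q) :
    placePointers.Spec σ (fun τ =>
      (τ.var .ok ≠ 0 → ∀ i < q, ∃ j < k, σ.arr .con (Q + i * k + j) ≠ 0 ∧
        τ.arr .ptr i = σ.arr .head j) ∧
      ((∀ i < q, ∃ j < k, σ.arr .con (Q + i * k + j) ≠ 0) → τ.var .ok ≠ 0))
      (100 * ((q + 1) * (k + 1))) := by
  set C := σ.arr .con with hC
  set H := σ.arr .head with hH
  apply Spec.le
  · apply Spec.set_seq
    apply Spec.set_seq
    apply Spec.set_seq
    refine (Spec.loop (N := q) (B := 40 + 70 * k) (fun r τ => τ.var .i = r ∧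
      τ.var .idx = Q + r * k ∧
      (τ.var .ok ≠ 0 → ∀ i < r, ∃ j < k, C (Q + i * k + j) ≠ 0 ∧ τ.arr .ptr i = H j) ∧
      ((∀ i < r, ∃ j < k, C (Q + i * k + j) ≠ 0) → τ.var .ok ≠ 0)) ?_ ?_ ?_).mono
      (fun τ _ _ h => h.2.2) le_rfl
    · simp [hq]
    · simp [hQ]
    · rintro r hr τ hv ha ⟨hi, hidx, h1, h2⟩
      have hCτ : τ.arr .con = C := ha .con (by decide)
      have hHτ : τ.arr .head = H := ha .head (by decide)
      have hkτ : τ.var .k = k := by simpa [hk] using hv .k (by decide)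
      apply Spec.le
      · apply Spec.set_seq
        apply Spec.set_seq
        apply Spec.seq
        · refine Spec.loop (N := k) (B := 60) (fun s υ => υ.var .j = s ∧ υ.var .i = r ∧
            υ.var .idx = Q + r * k + s ∧
            (υ.var .found ≠ 0 → ∃ j < s, C (Q + r * k + j) ≠ 0 ∧ υ.arr .ptr r = H j) ∧
            ((∃ j < s, C (Q + r * k + j) ≠ 0) → υ.var .found ≠ 0) ∧
            ∀ i < r, υ.arr .ptr i = τ.arr .ptr i) ?_ ?_ ?_
          · simp [hkτ]
          · simp [hi, hidx]
          · rintro s hs υ - haυ ⟨hj, hi', hidx', g1, g2, g3⟩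
            have hCυ : υ.arr .con = C := (haυ .con (by decide)).trans hCτ
            have hHυ : υ.arr .head = H := (haυ .head (by decide)).trans hHτ
            refine Spec.of_loopFree rfl (by decide) ?_
            by_cases h0 : C (Q + r * k + s) = 0
            · simp only [run_seq, run_ite, run_set, run_put, run_skip, PState.setVar_var,
                PState.setArr_arr, PState.setVar_arr, PState.setArr_var, eval_var, eval_get,
                eval_add, eval_one, hj, hi', hidx', hCυ, h0, if_true, if_false, reduceCtorEq,
                true_and]
              refine ⟨rfl, fun hf => ?_, fun ⟨j, hj', h⟩ => ?_, g3⟩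
              · obtain ⟨j, hj', h⟩ := g1 hf
                exact ⟨j, by omega, h⟩
              · by_cases e : j = s
                · subst e; exact absurd h0 h
                · exact g2 ⟨j, by omega, h⟩
            · simp only [run_seq, run_ite, run_set, run_put, run_skip, PState.setVar_var,
                PState.setArr_arr, PState.setVar_arr, PState.setArr_var, eval_var, eval_get,
                eval_add, eval_one, hj, hi', hidx', hCυ, hHυ, h0, if_true, if_false, reduceCtorEq,
                true_and]
              refine ⟨rfl, fun hf => ⟨s, by omega, h0, by simp⟩, fun _ => one_ne_zero,
                fun i hi => ?_⟩
              rw [Function.update_of_ne (by omega)]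
              exact g3 i hi
        · rintro υ hvυ - ⟨-, hi', hidx', g1, g2, g3⟩
          have hok : υ.var .ok = τ.var .ok := by simpa using hvυ .ok (by decide)
          refine Spec.of_loopFree (B := 20) rfl (by decide) ?_
          by_cases hf : υ.var .found = 0
          · simp only [run_seq, run_ite, run_set, run_skip, PState.setVar_var,
              PState.setVar_arr, eval_var, eval_add, eval_one, eval_zero, hf, hi', hidx', if_true,
              if_false, reduceCtorEq, true_and]
            refine ⟨by ring, fun h => absurd rfl h, fun h => ?_⟩
            exact absurd hf (g2 (h r (by omega)))
          · simp only [run_seq, run_ite, run_set, run_skip, PState.setVar_var,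
              PState.setVar_arr, eval_var, eval_add, eval_one, eval_zero, hf, hi', hidx', if_true,
              if_false, reduceCtorEq, true_and, hok]
            refine ⟨by ring, fun h i hi'' => ?_, fun h => h2 fun i hi => h i (by omega)⟩
            by_cases e : i = r
            · subst e; exact g1 hf
            · rw [g3 i (by omega)]; exact h1 h i (by omega)
      · show 1 + 1 + (1 + 1 + (1 + 2 + k * (60 + 4) + 20)) ≤ _
        omega
  · show 1 + 1 + (1 + 1 + (1 + 1 + (1 + 2 + q * (40 + 70 * k + 4)))) ≤ _
    nlinarith

/-! ### Solutions along chains and the test of one guess -/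

/-- `y` is in the chain of `x`, above `x` or equal to it. -/
def ChainReach (nxt : ℕ → ℕ) : ℕ → ℕ → Prop := Relation.ReflTransGen fun x y => nxt x = y + 1

theorem ChainReach.le {tab : ℕ → ℕ → ℕ} {prv nxt head : ℕ → ℕ} {n k x y : ℕ}
    (hO : IsOrderTable tab n) (hM : IsMatching tab prv n) (hC : IsChainData prv nxt head n k)
    (h : ChainReach nxt x y) (hx : x < n) : y < n ∧ tab x y = 1 := by
  induction h with
  | refl => exact ⟨hx, hO.refl x hx⟩
  | @tail y z _ hyz ih =>
    obtain ⟨hy, hxy⟩ := ih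
    have h1 := hC.prv_nxt y hy (by omega)
    rw [hyz, Nat.add_sub_cancel] at h1
    have h2 := hM.le z h1.1 (by omega)
    rw [h1.2, Nat.add_sub_cancel] at h2
    exact ⟨h1.1, hO.trans x hx y hy z h1.1 hxy h2⟩

/-- Descend along predecessors; the height decreases, so a least element of some chain is reached.
-/
theorem exists_chainReach {tab : ℕ → ℕ → ℕ} {prv nxt head : ℕ → ℕ} {n k : ℕ}
    (hO : IsOrderTable tab n) (hM : IsMatching tab prv n) (hC : IsChainData prv nxt head n k)
    {y : ℕ} (hy : y < n) : ∃ j < k, ChainReach nxt (head j) y := by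
  induction hh : height tab n y using Nat.strong_induction_on generalizing y with
  | _ h ih =>
    by_cases h0 : prv y = 0
    · obtain ⟨j, hj, rfl⟩ := hC.head_surj y hy h0
      exact ⟨j, hj, Relation.ReflTransGen.refl⟩
    · have hlt := hM.lt y hy h0
      obtain ⟨j, hj, hr⟩ := ih _ (hh ▸ hO.height_lt_height hlt hy (hM.le y hy h0) (hM.ne y hy h0))
        hlt rfl
      exact ⟨j, hj, hr.tail (hC.nxt_prv y hy h0)⟩

/-- The data on which the search for a solution works. -/
structure SearchData {q : ℕ} (ψ : QFFormula q) (n k : ℕ) (σ : PState) : Prop where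
  n_eq : σ.var .n = n
  q_eq : σ.var .q = q
  k_eq : σ.var .k = k
  qq_eq : σ.var .qq = q * q
  bits_eq : σ.var .bits = q * q + q * k
  len_eq : σ.var .len = ψ.encode.length
  size_le : ψ.encode.length ≤ σ.var .size
  code : ∀ i, ∀ h : i < ψ.encode.length,
    σ.arr .inp (σ.var .size - ψ.encode.length + i) = ψ.encode[i]
  qrow : ∀ i < q, σ.arr .qrow i = i * q
  order : IsOrderTable σ.table n
  matching : IsMatching σ.table (σ.arr .prv) n
  chains : IsChainData (σ.arr .prv) (σ.arr .nxt) (σ.arr .head) n k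

theorem SearchData.congr {q : ℕ} {ψ : QFFormula q} {n k : ℕ} {σ τ : PState}
    (h : SearchData ψ n k σ)
    (hv : ∀ x ∈ [Var.n, .q, .k, .qq, .bits, .len, .size], τ.var x = σ.var x)
    (ha : ∀ r ∈ [Arr.inp, .row, .prv, .nxt, .head, .qrow], τ.arr r = σ.arr r) :
    SearchData ψ n k τ := by
  have htab : τ.table = σ.table := by
    funext a b
    simp only [PState.table]
    rw [ha .inp (by decide), ha .row (by decide)]
  refine ⟨?_, ?_, ?_, ?_, ?_, ?_, ?_, ?_, ?_, ?_, ?_, ?_⟩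
  · rw [hv .n (by decide)]; exact h.n_eq
  · rw [hv .q (by decide)]; exact h.q_eq
  · rw [hv .k (by decide)]; exact h.k_eq
  · rw [hv .qq (by decide)]; exact h.qq_eq
  · rw [hv .bits (by decide)]; exact h.bits_eq
  · rw [hv .len (by decide)]; exact h.len_eq
  · rw [hv .size (by decide)]; exact h.size_le
  · rw [hv .size (by decide), ha .inp (by decide)]; exact h.code
  · rw [ha .qrow (by decide)]; exact h.qrow
  · rw [htab]; exact h.order
  · rw [htab, ha .prv (by decide)]; exact h.matching
  · rw [ha .prv (by decide), ha .nxt (by decide), ha .head (by decide)]; exact h.chains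

/-- Test one guess. -/
def tryGuess : PStmt :=
  writeBits ;; evalFormula ;; placePointers ;; set .m Var.q ;;
  ite Var.ok (ite Var.val (phase ;; ite Var.fail skip (set .res 1)) skip) skip ;;
  set .guess (Var.guess + 1)

/-- The formula is satisfied in the poset with order table `tab` on `{0, …, n - 1}`. -/
def SatisfiedIn {q : ℕ} (ψ : QFFormula q) (tab : ℕ → ℕ → ℕ) (n : ℕ) : Prop :=
  ∃ s : ℕ → ℕ, (∀ i < q, s i < n) ∧ ψ.Holds fun i j => tab (s i) (s j) = 1

/-- The guess `g` describes a solution. -/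
def GoodGuess {q : ℕ} (ψ : QFFormula q) (tab : ℕ → ℕ → ℕ) (nxt head : ℕ → ℕ) (n k g : ℕ) : Prop :=
  ∃ s c : ℕ → ℕ, (∀ i < q, s i < n ∧ c i < k ∧ ChainReach nxt (head (c i)) (s i)) ∧
    (ψ.Holds fun i j => tab (s i) (s j) = 1) ∧
    (∀ a < q, ∀ b < q, g / 2 ^ (a * q + b) % 2 = tab (s a) (s b)) ∧
    ∀ i < q, ∀ j < k, (g / 2 ^ (q * q + i * k + j) % 2 ≠ 0 ↔ j = c i)

/-- The cost of testing one guess, up to a factor linear in the size of the poset. -/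
def guessCost (q k len : ℕ) : ℕ :=
  2000 * ((q * q + q * k + 1) + (len + 1) + (q + 1) * (k + 1) + (q + 1) ^ 3)

theorem mul_add_lt_mul {q a b c : ℕ} (ha : a < c) (hb : b < q) : a * q + b < c * q := by
  calc a * q + b < a * q + q := by omega
    _ = (a + 1) * q := by ring
    _ ≤ c * q := Nat.mul_le_mul_right _ ha

/-- Soundness needs nothing of the guess: a successful search ends with pointers that realize
exactly the guessed bits, on which the formula evaluated to true. For completeness, the solution
described by a good guess stays on or above the pointers, so no chain can be exhausted. -/
theorem tryGuess_spec {q : ℕ} (ψ : QFFormula q) {n k g : ℕ} (σ : PState)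
    (hD : SearchData ψ n k σ) (hg : σ.var .guess = g) :
    tryGuess.Spec σ (fun τ => τ.var .guess = g + 1 ∧
      (τ.var .res = σ.var .res ∨ τ.var .res = 1) ∧
      (τ.var .res ≠ σ.var .res → SatisfiedIn ψ σ.table n) ∧
      (GoodGuess ψ σ.table (σ.arr .nxt) (σ.arr .head) n k g → τ.var .res = 1))
      (guessCost q k ψ.encode.length * (n + 1)) := by
  set len := ψ.encode.length with hlen
  apply Spec.le
  · apply (writeBits_spec σ hg hD.bits_eq).seq
    intro σ₁ hv₁ ha₁ hbits
    have hD₁ : SearchData ψ n k σ₁ := by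
      refine hD.congr ?_ ?_
      · intro x hx
        refine hv₁ x ?_
        revert x; decide
      · intro r hr
        refine ha₁ r ?_
        revert r; decide
    apply (evalFormula_spec ψ σ₁ hD₁.len_eq rfl hD₁.size_le hD₁.code hD₁.qrow).seq
    intro σ₂ hv₂ ha₂ hval
    have hD₂ : SearchData ψ n k σ₂ := by
      refine hD₁.congr ?_ ?_
      · intro x hx
        refine hv₂ x ?_
        revert x; decide
      · intro r hr
        refine ha₂ r ?_
        revert r; decide
    apply (placePointers_spec σ₂ hD₂.q_eq hD₂.k_eq hD₂.qq_eq).seq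
    rintro σ₃ hv₃ ha₃ ⟨hok₁, hok₂⟩
    have hD₃ : SearchData ψ n k σ₃ := by
      refine hD₂.congr ?_ ?_
      · intro x hx
        refine hv₃ x ?_
        revert x; decide
      · intro r hr
        refine ha₃ r ?_
        revert r; decide
    have hval₃ : σ₃.var .val = σ₂.var .val := hv₃ .val (by decide)
    have hres₃ : σ₃.var .res = σ.var .res := by
      rw [hv₃ .res (by decide), hv₂ .res (by decide), hv₁ .res (by decide)]
    have hguess₃ : σ₃.var .guess = g := by
      rw [hv₃ .guess (by decide), hv₂ .guess (by decide), hv₁ .guess (by decide), hg]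
    have hcon₃ : ∀ p < q * q + q * k, σ₃.arr .con p = g / 2 ^ p % 2 := by
      rw [ha₃ .con (by decide), ha₂ .con (by decide)]; exact hbits
    have hcon₂ : ∀ p < q * q + q * k, σ₂.arr .con p = g / 2 ^ p % 2 := by
      rw [ha₂ .con (by decide)]; exact hbits
    have htab₃ : σ₃.table = σ.table := by
      funext a b
      simp only [PState.table]
      rw [ha₃ .inp (by decide), ha₃ .row (by decide), ha₂ .inp (by decide), ha₂ .row (by decide),
        ha₁ .inp (by decide), ha₁ .row (by decide)]
    have hnxt₃ : σ₃.arr .nxt = σ.arr .nxt := by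
      rw [ha₃ .nxt (by decide), ha₂ .nxt (by decide), ha₁ .nxt (by decide)]
    have hhead₂ : σ₂.arr .head = σ.arr .head := by
      rw [ha₂ .head (by decide), ha₁ .head (by decide)]
    have hidx : ∀ a < q, ∀ b < q, a * q + b < q * q + q * k := fun a ha b hb =>
      (mul_add_lt_mul ha hb).trans_le (Nat.le_add_right _ _)
    have hidx' : ∀ i < q, ∀ j < k, q * q + i * k + j < q * q + q * k := fun i hi j hj => by
      have := mul_add_lt_mul hi hj
      omega
    have hcon₁ : ∀ p < q * q + q * k, σ₁.arr .con p = g / 2 ^ p % 2 := hbits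
    have hgood : GoodGuess ψ σ.table (σ.arr .nxt) (σ.arr .head) n k g →
        σ₃.var .ok ≠ 0 ∧ σ₃.var .val ≠ 0 := by
      rintro ⟨s, c, h1, h2, h3, h4⟩
      constructor
      · refine hok₂ fun i hi => ⟨c i, (h1 i hi).2.1, ?_⟩
        rw [hcon₂ _ (hidx' i hi _ (h1 i hi).2.1)]
        exact (h4 i hi _ (h1 i hi).2.1).2 rfl
      · rw [hval₃]
        refine hval.2 ((ψ.holds_congr fun i hi j hj => ?_).1 h2)
        have hle := hD.order.le_one _ (h1 i hi).1 _ (h1 j hj).1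
        rw [hcon₁ _ (hidx i hi j hj), h3 i hi j hj]
        omega
    apply Spec.set_seq
    set σ₄ := σ₃.setVar .m ((var .q : PExpr).eval σ₃) with hσ₄
    apply Spec.seq (Q := fun τ => (τ.var .res = σ.var .res ∨ τ.var .res = 1) ∧
      (τ.var .res ≠ σ.var .res → SatisfiedIn ψ σ.table n) ∧
      (GoodGuess ψ σ.table (σ.arr .nxt) (σ.arr .head) n k g → τ.var .res = 1))
    · apply Spec.ite (B := 1 + 2 + (500 * (q + 1) ^ 3 * (n + 1) + 20))
      swap
      · intro h0
        have h0 : σ₃.var .ok = 0 := by simpa [hσ₄] using h0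
        have e : σ₄.var .res = σ.var .res := by simpa [hσ₄] using hres₃
        refine Spec.of_loopFree rfl (Nat.zero_le _) ?_
        rw [run_skip]
        exact ⟨Or.inl e, fun h => absurd e h, fun h => absurd h0 (hgood h).1⟩
      intro h0
      have h0 : σ₃.var .ok ≠ 0 := by simpa [hσ₄] using h0
      apply Spec.ite (B := 500 * (q + 1) ^ 3 * (n + 1) + 20)
      swap
      · intro h1
        have h1 : σ₃.var .val = 0 := by simpa [hσ₄] using h1
        have e : σ₄.var .res = σ.var .res := by simpa [hσ₄] using hres₃
        refine Spec.of_loopFree rfl (Nat.zero_le _) ?_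
        rw [run_skip]
        exact ⟨Or.inl e, fun h => absurd e h, fun h => absurd h1 (hgood h).2⟩
      intro h1
      have h1 : σ₃.var .val ≠ 0 := by simpa [hσ₄] using h1
      have hm₄ : σ₄.var .m = q := by simpa [hσ₄] using hD₃.q_eq
      have hn₄ : σ₄.var .n = n := by simpa [hσ₄] using hD₃.n_eq
      have hcon₄ : ∀ p < q * q + q * k, σ₄.arr .con p = g / 2 ^ p % 2 := hcon₃
      have htab₄ : σ₄.table = σ.table := htab₃
      have hnxt₄ : σ₄.arr .nxt = σ.arr .nxt := hnxt₃
      have hstart : ∀ i < q, ∃ j < k, g / 2 ^ (q * q + i * k + j) % 2 ≠ 0 ∧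
          σ₄.arr .ptr i = σ.arr .head j := by
        intro i hi
        obtain ⟨j, hj, hj1, hj2⟩ := hok₁ h0 i hi
        rw [hcon₂ _ (hidx' i hi j hj)] at hj1
        rw [hhead₂] at hj2
        exact ⟨j, hj, hj1, hj2⟩
      apply Spec.seq
      -- The invariant quantifies over every `s` with the guessed comparisons and the guessed
      -- chains, so one run serves soundness and completeness alike.
      · refine phase_spec σ₄ (m := q) (n := n) hm₄ hn₄ (fun _ ptr _ _ => (∀ i < q, ptr i < n) ∧
          ∀ s : ℕ → ℕ, (∀ a < q, ∀ b < q, g / 2 ^ (a * q + b) % 2 = σ.table (s a) (s b)) →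
            (∀ i < q, ChainReach (σ.arr .nxt) (σ₄.arr .ptr i) (s i)) →
            ∀ i < q, ChainReach (σ.arr .nxt) (ptr i) (s i)) (height σ.table n) ?_ ?_ ?_
        · refine ⟨fun i hi => ?_, fun s _ h => h⟩
          obtain ⟨j, hj, -, e⟩ := hstart i hi
          rw [e]
          exact (hD.chains.head_lt j hj).1
        · rintro t ptr wit tim ⟨hK1, hK2⟩ a ha b hb hV hx
          rw [hnxt₄] at hx ⊢
          rw [htab₄] at hV
          refine ⟨fun i hi => ?_, fun s hs h i hi => ?_⟩
          · by_cases e : i = a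
            · subst e
              simpa using (hD.chains.prv_nxt _ (hK1 i hi) hx).1
            · simpa [e] using hK1 i hi
          · have hr := hK2 s hs h
            by_cases e : i = a
            · subst e
              rw [Function.update_self]
              -- If `s i` is the pointer's own position, transitivity through `ptr b ≤ s b`
              -- contradicts the violated constraint; otherwise `s i` lies on or above the
              -- successor.
              rcases Relation.ReflTransGen.cases_head (hr i hi) with he | ⟨y, hy, hy'⟩
              · exfalso
                obtain ⟨hsb, hle⟩ := (hr b hb).le hD.order hD.matching hD.chains (hK1 b hb)
                rcases hV with ⟨c1, c2⟩ | ⟨c1, c2⟩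
                · rw [hcon₄ _ (hidx i ha b hb), hs i ha b hb, ← he] at c1
                  have := hD.order.trans _ (hK1 i ha) _ (hK1 b hb) _ hsb c2 hle
                  omega
                · rw [hcon₄ _ (hidx b hb i ha), hs b hb i ha, ← he] at c1
                  have := hD.order.trans _ (hK1 b hb) _ hsb _ (hK1 i ha) hle c1
                  omega
              · rw [hy, Nat.add_sub_cancel]; exact hy'
            · rw [Function.update_of_ne e]; exact hr i hi
        · rintro t ptr wit tim ⟨hK1, -⟩ a ha
          rw [hnxt₄]
          refine ⟨height_lt (hK1 a ha), fun hx => ?_⟩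
          obtain ⟨hyv, hpy⟩ := hD.chains.prv_nxt _ (hK1 a ha) hx
          have h1 := hD.matching.le _ hyv (by omega)
          have h2 := hD.matching.ne _ hyv (by omega)
          rw [hpy, Nat.add_sub_cancel] at h1 h2
          exact hD.order.height_lt_height (hK1 a ha) hyv h1 h2
      · intro σ₅ hv₅ ha₅ h₅
        refine Spec.of_loopFree (B := 20) rfl (by decide) ?_
        have e : σ₅.var .res = σ.var .res := by
          rw [hv₅ .res (by decide)]
          simpa [hσ₄] using hres₃
        rw [htab₄, hnxt₄] at h₅
        rcases h₅ with ⟨hf, t, ⟨hK1, -⟩, hA⟩ | ⟨hf, -, t, -, ptr, wit, tim, a, ha, b, hb, ⟨hK1, hK2⟩,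
          hV, hx, -⟩
        · simp only [run_ite, eval_var, hf, if_true, run_set, PState.setVar_var, eval_one]
          refine ⟨Or.inr trivial, fun _ => ⟨σ₅.arr .ptr, hK1, ?_⟩, fun _ => trivial⟩
          rw [hval₃] at h1
          refine (ψ.holds_congr fun i hi j hj => ?_).1 (hval.1 h1)
          -- Bit and table entry are both at most `1` and do not sum to `1`, hence they agree.
          have hA' := hA i hi j hj
          have hle := hD.order.le_one _ (hK1 i hi) _ (hK1 j hj)
          rw [hcon₄ _ (hidx i hi j hj)] at hA'
          rw [hcon₁ _ (hidx i hi j hj)]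
          omega
        · simp only [run_ite, eval_var, hf, if_false, run_skip]
          refine ⟨Or.inl e, fun h => absurd e h, ?_⟩
          rintro ⟨s, c, g1, g2, g3, g4⟩
          exfalso
          have hr := hK2 s g3 (fun i hi => by
            obtain ⟨j, hj, hj1, hj2⟩ := hstart i hi
            rw [hj2, (g4 i hi j hj).1 hj1]
            exact (g1 i hi).2.2)
          -- The same dichotomy at the exhausted chain; here the second case is impossible because
          -- there is no successor.
          rcases Relation.ReflTransGen.cases_head (hr a ha) with he | ⟨y, hy, hy'⟩
          · obtain ⟨hsb, hle⟩ := (hr b hb).le hD.order hD.matching hD.chains (hK1 b hb)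
            rcases hV with ⟨c1, c2⟩ | ⟨c1, c2⟩
            · rw [hcon₄ _ (hidx a ha b hb), g3 a ha b hb, ← he] at c1
              have := hD.order.trans _ (hK1 a ha) _ (hK1 b hb) _ hsb c2 hle
              omega
            · rw [hcon₄ _ (hidx b hb a ha), g3 b hb a ha, ← he] at c1
              have := hD.order.trans _ (hK1 b hb) _ hsb _ (hK1 a ha) hle c1
              omega
          · omega
    · rintro σ₅ hv₅ - h₅
      refine Spec.of_loopFree (B := 10) rfl (by decide) ?_
      have hg₅ : σ₅.var .guess = g := by
        rw [hv₅ .guess (by decide)]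
        simpa [hσ₄] using hguess₃
      simp only [run_set, PState.setVar_var, eval_add, eval_var, eval_one, hg₅, if_true, if_false,
        reduceCtorEq, true_and]
      exact h₅
  · show 100 * (q * q + q * k + 1) + (500 * (len + 1) + (100 * ((q + 1) * (k + 1)) +
      (1 + 1 + (1 + 2 + (1 + 2 + (500 * (q + 1) ^ 3 * (n + 1) + 20)) + 10)))) ≤ _
    have h1 := Nat.one_le_pow 3 (q + 1) (by omega)
    simp only [guessCost]
    generalize q * q + q * k + 1 = A
    generalize (q + 1) * (k + 1) = B
    generalize (q + 1) ^ 3 = D at *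
    nlinarith [Nat.zero_le (A * n), Nat.zero_le (B * n), Nat.zero_le (D * n), Nat.zero_le (len * n)]

/-! ## The whole algorithm -/

/-- The guess is assembled bit by bit from a solution `s` and a choice `c` of chains containing its
values: first the comparison table of `s`, then the indicator matrix of `c`. -/
theorem exists_goodGuess {q : ℕ} {ψ : QFFormula q} {tab : ℕ → ℕ → ℕ} {prv nxt head : ℕ → ℕ}
    {n k : ℕ} (hO : IsOrderTable tab n) (hM : IsMatching tab prv n)
    (hC : IsChainData prv nxt head n k) (h : SatisfiedIn ψ tab n) :
    ∃ g < 2 ^ (q * q + q * k), GoodGuess ψ tab nxt head n k g := by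
  obtain ⟨s, hs, hψ⟩ := h
  have hc : ∀ i, ∃ j, i < q → j < k ∧ ChainReach nxt (head j) (s i) := by
    intro i
    by_cases hi : i < q
    · obtain ⟨j, hj⟩ := exists_chainReach hO hM hC (hs i hi)
      exact ⟨j, fun _ => hj⟩
    · exact ⟨0, fun h => absurd h hi⟩
  choose c hc using hc
  let f : Fin (q * q + q * k) → Bool := fun p =>
    if (p : ℕ) < q * q then decide (tab (s (p / q)) (s (p % q)) = 1)
    else decide ((p - q * q) % k = c ((p - q * q) / k))
  have hbit : ∀ p, ∀ hp : p < q * q + q * k, Nat.ofBits f / 2 ^ p % 2 = (f ⟨p, hp⟩).toNat := by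
    intro p hp
    have h1 := Nat.testBit_ofBits_lt f p hp
    rw [← h1, Nat.toNat_testBit]
  refine ⟨Nat.ofBits f, Nat.ofBits_lt_two_pow f, s, c, fun i hi => ⟨hs i hi, hc i hi⟩, hψ,
    fun a ha b hb => ?_, fun i hi j hj => ?_⟩
  · have h1 := mul_add_lt_mul ha hb
    have hq : 0 < q := by omega
    rw [hbit _ (by omega)]
    have e1 : (a * q + b) / q = a := by
      rw [Nat.add_comm, Nat.add_mul_div_right _ _ hq, Nat.div_eq_of_lt hb, Nat.zero_add]
    have e2 : (a * q + b) % q = b := by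
      rw [Nat.add_comm, Nat.add_mul_mod_self_right, Nat.mod_eq_of_lt hb]
    simp only [f, h1, if_true, e1, e2]
    have := hO.le_one _ (hs a ha) _ (hs b hb)
    by_cases h : tab (s a) (s b) = 1
    · simp [h]
    · simp [h]; omega
  · have h1 := mul_add_lt_mul hi hj
    have hk : 0 < k := by omega
    rw [hbit _ (by omega)]
    have e0 : q * q + i * k + j - q * q = i * k + j := by omega
    have e1 : (i * k + j) / k = i := by
      rw [Nat.add_comm, Nat.add_mul_div_right _ _ hk, Nat.div_eq_of_lt hj, Nat.zero_add]
    have e2 : (i * k + j) % k = j := by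
      rw [Nat.add_comm, Nat.add_mul_mod_self_right, Nat.mod_eq_of_lt hj]
    have e3 : ¬ (q * q + i * k + j < q * q) := by omega
    simp only [f, e3, if_false, e0, e1, e2]
    simp

/-- Compute the number of binary digits of a guess and the number of guesses. -/
def countGuesses : PStmt :=
  set .k Var.m ;; set .i 0 ;; set .qq 0 ;;
  loop Var.q (put .qrow Var.i Var.qq ;; set .qq (Var.qq + Var.q) ;; set .i (Var.i + 1)) ;;
  set .bits Var.qq ;; loop Var.q (set .bits (Var.bits + Var.k)) ;;
  set .acc 1 ;; loop Var.bits (set .acc (Var.acc + Var.acc))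

theorem countGuesses_spec (σ : PState) {q k : ℕ} (hq : σ.var .q = q) (hk : σ.var .m = k) :
    countGuesses.Spec σ (fun τ => τ.var .k = k ∧ τ.var .qq = q * q ∧
      τ.var .bits = q * q + q * k ∧ τ.var .acc = 2 ^ (q * q + q * k) ∧
      ∀ i < q, τ.arr .qrow i = i * q) (100 * (q * q + q * k + q + 1)) := by
  apply Spec.le
  · apply Spec.set_seq
    apply Spec.set_seq
    apply Spec.set_seq
    apply Spec.seq
    · refine Spec.loop (N := q) (B := 40) (fun r τ => τ.var .i = r ∧ τ.var .qq = r * q ∧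
        ∀ i < r, τ.arr .qrow i = i * q) ?_ ?_ ?_
      · simp [hq]
      · simp
      · rintro r hr τ hv - ⟨hi, hx, hI⟩
        have hq' : τ.var .q = q := by simpa [hq] using hv .q (by decide)
        refine Spec.of_loopFree rfl (by decide) ?_
        simp only [run_seq, run_set, run_put, PState.setVar_var, PState.setArr_arr,
          PState.setVar_arr, PState.setArr_var, eval_var, eval_add, eval_one, hi, hx, hq',
          if_true, if_false, reduceCtorEq, true_and]
        refine ⟨by ring, fun a ha => ?_⟩
        by_cases h : a = r
        · simp [h]
        · rw [Function.update_of_ne h]; exact hI a (by omega)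
    · rintro τ hv - ⟨-, hqq, hrow⟩
      have hq' : τ.var .q = q := by simpa [hq] using hv .q (by decide)
      have hk' : τ.var .k = k := by simpa [hk] using hv .k (by decide)
      apply Spec.set_seq
      apply Spec.seq
      · refine Spec.loop (N := q) (B := 10) (fun r τ => τ.var .bits = q * q + r * k) ?_ ?_ ?_
        · simp [hq']
        · simp [hqq]
        · rintro r hr υ hv' - hI
          have hk'' : υ.var .k = k := by simpa [hk'] using hv' .k (by decide)
          refine Spec.of_loopFree rfl (by decide) ?_
          simp [hI, hk'']; ring
      · rintro υ hv' ha' hb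
        have hk'' : υ.var .k = k := by simpa [hk'] using hv' .k (by decide)
        have hqq' : υ.var .qq = q * q := by simpa [hqq] using hv' .qq (by decide)
        have hrow' : ∀ i < q, υ.arr .qrow i = i * q := by
          rw [ha' .qrow (by decide)]; exact hrow
        apply Spec.set_seq
        refine (Spec.loop (N := q * q + q * k) (B := 10) (fun r τ => τ.var .acc = 2 ^ r)
          ?_ ?_ ?_).mono ?_ le_rfl
        · simp [hb]
        · simp
        · rintro r hr ω - - hI
          refine Spec.of_loopFree rfl (by decide) ?_
          simp [hI, pow_succ]; ring
        · intro ω hv'' ha'' h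
          refine ⟨?_, ?_, ?_, h, ?_⟩
          · simpa [hk''] using hv'' .k (by decide)
          · simpa [hqq'] using hv'' .qq (by decide)
          · simpa [hb] using hv'' .bits (by decide)
          · rw [ha'' .qrow (by decide)]; exact hrow'
  · show 1 + 1 + (1 + 1 + (1 + 1 + (1 + 2 + q * (40 + 4) + (1 + 1 + (1 + 2 + q * (10 + 4) +
      (1 + 1 + (1 + 2 + (q * q + q * k) * (10 + 4)))))))) ≤ _
    omega

/-- Try all guesses. -/
def searchAll : PStmt := set .res 0 ;; set .guess 0 ;; loop Var.acc tryGuess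

open Classical in
theorem searchAll_spec {q : ℕ} (ψ : QFFormula q) {n k : ℕ} (σ : PState)
    (hD : SearchData ψ n k σ) (hacc : σ.var .acc = 2 ^ (q * q + q * k)) :
    searchAll.Spec σ (fun τ => τ.var .res = if SatisfiedIn ψ σ.table n then 1 else 0)
      (10 + 2 ^ (q * q + q * k) * (guessCost q k ψ.encode.length * (n + 1) + 4)) := by
  apply Spec.le
  · apply Spec.set_seq
    apply Spec.set_seq
    set σ₁ := (σ.setVar .res ((0 : PExpr).eval σ)).setVar .guess
      ((0 : PExpr).eval (σ.setVar .res ((0 : PExpr).eval σ))) with hσ₁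
    have htab₁ : σ₁.table = σ.table := rfl
    have hD₁ : SearchData ψ n k σ₁ := by
      refine hD.congr ?_ fun r _ => rfl
      intro x hx
      have h1 : x ≠ .res := by rintro rfl; revert hx; decide
      have h2 : x ≠ .guess := by rintro rfl; revert hx; decide
      simp [hσ₁, h1, h2]
    -- Testing a guess overwrites `acc`, which is harmless as the number of rounds is fixed on
    -- entry.
    refine (Spec.loop (N := 2 ^ (q * q + q * k))
      (fun r τ => τ.var .guess = r ∧ (τ.var .res = 0 ∨ τ.var .res = 1) ∧
        (τ.var .res = 1 → SatisfiedIn ψ σ.table n) ∧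
        ((∃ g < r, GoodGuess ψ σ.table (σ.arr .nxt) (σ.arr .head) n k g) → τ.var .res = 1))
      (B := guessCost q k ψ.encode.length * (n + 1)) ?_ ?_ ?_).mono ?_ le_rfl
    · simp [hσ₁, hacc]
    · simp [hσ₁]
    · rintro r hr τ hv ha ⟨hg, h01, h1, h2⟩
      have hDτ : SearchData ψ n k τ := by
        refine hD₁.congr ?_ ?_
        · intro x hx
          refine hv x ?_
          revert x; decide
        · intro r hr
          refine ha r ?_
          revert r; decide
      have htab : τ.table = σ.table := by
        rw [← htab₁]
        funext a b
        simp only [PState.table]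
        rw [ha .inp (by decide), ha .row (by decide)]
      have hnxt : τ.arr .nxt = σ.arr .nxt := ha .nxt (by decide)
      have hhead : τ.arr .head = σ.arr .head := ha .head (by decide)
      refine (tryGuess_spec ψ τ hDτ hg).mono ?_ le_rfl
      rw [htab, hnxt, hhead]
      rintro υ - - ⟨hg', hr', hs', hG⟩
      refine ⟨hg', ?_, fun h => ?_, ?_⟩
      · rcases hr' with h | h
        · rw [h]; exact h01
        · exact Or.inr h
      · by_cases e : υ.var .res = τ.var .res
        · exact h1 (e ▸ h)
        · exact hs' e
      · rintro ⟨g, hgr, hgood⟩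
        by_cases e : g = r
        · subst e; exact hG hgood
        · have := h2 ⟨g, by omega, hgood⟩
          rcases hr' with h | h
          · rw [h, this]
          · exact h
    · rintro τ - - ⟨-, h01, h1, h2⟩
      by_cases h : SatisfiedIn ψ σ.table n
      · rw [if_pos h]
        exact h2 (exists_goodGuess hD.order hD.matching hD.chains h)
      · rw [if_neg h]
        rcases h01 with h0 | h0
        · exact h0
        · exact absurd (h1 h0) h
  · show 1 + 1 + (1 + 1 + (1 + 2 + _)) ≤ _
    omega

/-- The algorithm. -/
def modelCheck : PStmt := readInput ;; findRows ;; coverByChains ;; countGuesses ;; searchAll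

/-- The factor of the running time that depends only on the parameters. -/
def timeFactor (s w : ℕ) : ℕ :=
  200 * (s + 1) + 100 + 2500 * ((w + 2) * (w + 2) * (w + 2)) + 100 * (s * s + s * w + s + 1) + 10 +
    2 ^ (s * s + s * w) * (guessCost s w s + 4)

theorem guessCost_mono {q k l q' k' l' : ℕ} (hq : q ≤ q') (hk : k ≤ k') (hl : l ≤ l') :
    guessCost q k l ≤ guessCost q' k' l' := by
  unfold guessCost
  gcongr

-- Here `w` bounds the antichains and `s` bounds both `q` and the code length; the program sees
-- neither. The actual number `k ≤ w` of chains enters the cost, which is monotone in it.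
open Classical in
theorem modelCheck_spec {q : ℕ} (ψ : QFFormula q) {n w s : ℕ} (σ : PState) {tab : ℕ → ℕ → ℕ}
    (hn : σ.mem 0 = n) (hq : σ.mem 1 = q) (hlen : σ.mem 2 = ψ.encode.length)
    (hz : ∀ a, ψ.encode.length + 3 + n * n ≤ a → σ.mem a = 0)
    (htab : ∀ a < n, ∀ b < n, σ.mem (3 + a * n + b) = tab a b)
    (hcode : ∀ i, ∀ h : i < ψ.encode.length, σ.mem (3 + n * n + i) = ψ.encode[i])
    (hO : IsOrderTable tab n) (hW : WidthLE tab n w) (hqs : q ≤ s) (hls : ψ.encode.length ≤ s) :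
    modelCheck.Spec σ (fun τ => τ.var .res = if SatisfiedIn ψ tab n then 1 else 0)
      (timeFactor s w * (n + 1) ^ 2) := by
  set len := ψ.encode.length with hlen'
  apply Spec.le
  · apply (readInput_spec σ hn hq hlen hz).seq
    rintro σ₁ - - ⟨hn₁, hq₁, hl₁, hs₁, hi₁⟩
    apply (findRows_spec σ₁ hn₁).seq
    intro σ₂ hv₂ ha₂ hr₂
    have hi₂ : ∀ a, σ₂.arr .inp a = σ.mem a := by rw [ha₂ .inp (by decide)]; exact hi₁
    -- The stored table agrees with `tab` only on indices below `n`, so order, width and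
    -- satisfaction are transferred separately below.
    have ht₂ : ∀ a < n, ∀ b < n, σ₂.table a b = tab a b := by
      intro a ha b hb
      rw [PState.table, hr₂ a ha, hi₂, htab a ha b hb]
    have hO₂ : IsOrderTable σ₂.table n := by
      refine ⟨fun a ha b hb => ?_, fun a ha => ?_, fun a ha b hb c hc => ?_, fun a ha b hb => ?_⟩
      · rw [ht₂ a ha b hb]; exact hO.le_one a ha b hb
      · rw [ht₂ a ha a ha]; exact hO.refl a ha
      · rw [ht₂ a ha b hb, ht₂ b hb c hc, ht₂ a ha c hc]; exact hO.trans a ha b hb c hc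
      · rw [ht₂ a ha b hb, ht₂ b hb a ha]; exact hO.antisymm a ha b hb
    have hW₂ : WidthLE σ₂.table n w := by
      intro m f hf h
      refine hW m f hf fun i hi j hj hij => ?_
      rw [← ht₂ _ (hf i hi) _ (hf j hj)]
      exact h i hi j hj hij
    have hn₂ : σ₂.var .n = n := (hv₂ .n (by decide)).trans hn₁
    have hq₂ : σ₂.var .q = q := (hv₂ .q (by decide)).trans hq₁
    have hl₂ : σ₂.var .len = len := (hv₂ .len (by decide)).trans hl₁
    have hs₂ : σ₂.var .size = len + 3 + n * n := (hv₂ .size (by decide)).trans hs₁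
    apply (coverByChains_spec σ₂ hn₂ hO₂ hW₂).seq
    rintro σ₃ hv₃ ha₃ ⟨hm₃, hM₃, hC₃⟩
    set k := σ₃.var .m with hk
    refine ((countGuesses_spec σ₃ ((hv₃ .q (by decide)).trans hq₂) hk.symm).seq
      (B' := 10 + 2 ^ (q * q + q * k) * (guessCost q k len * (n + 1) + 4)) ?_).le
      (B' := 100 * (s * s + s * w + s + 1) +
        (10 + 2 ^ (s * s + s * w) * (guessCost s w s * (n + 1) + 4))) ?_
    · rintro σ₄ hv₄ ha₄ ⟨hk₄, hqq₄, hb₄, hacc₄, hrow₄⟩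
      have htab₄ : σ₄.table = σ₂.table := by
        funext a b
        simp only [PState.table]
        rw [ha₄ .inp (by decide), ha₄ .row (by decide), ha₃ .inp (by decide), ha₃ .row (by decide)]
      have hsz₄ : σ₄.var .size = len + 3 + n * n := by
        rw [hv₄ .size (by decide), hv₃ .size (by decide), hs₂]
      have hD : SearchData ψ n k σ₄ := by
        refine ⟨?_, ?_, hk₄, hqq₄, hb₄, ?_, ?_, ?_, hrow₄, ?_, ?_, ?_⟩
        · rw [hv₄ .n (by decide), hv₃ .n (by decide), hn₂]
        · rw [hv₄ .q (by decide), hv₃ .q (by decide), hq₂]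
        · rw [hv₄ .len (by decide), hv₃ .len (by decide), hl₂]
        · rw [hsz₄]; omega
        · intro i hi
          rw [hsz₄, ha₄ .inp (by decide), ha₃ .inp (by decide), hi₂, ← hcode i hi]
          congr 1
          omega
        · rw [htab₄]; exact hO₂
        · rw [htab₄, ha₄ .prv (by decide)]; exact hM₃
        · rw [ha₄ .prv (by decide), ha₄ .nxt (by decide), ha₄ .head (by decide)]; exact hC₃
      refine (searchAll_spec ψ σ₄ hD hacc₄).mono ?_ le_rfl
      rintro τ - - hτ
      rw [hτ]
      congr 1
      rw [htab₄, eq_iff_iff]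
      unfold SatisfiedIn
      refine exists_congr fun f => and_congr_right fun hf => ?_
      exact ψ.holds_congr fun i hi j hj => by rw [ht₂ _ (hf i hi) _ (hf j hj)]
    · have h1 := guessCost_mono hqs hm₃ hls
      gcongr
      omega
  · show 200 * (len + 1) * (n + 1) ^ 2 + (100 * (n + 1) + (2500 * (w + 2) ^ 3 * (n + 1) ^ 2 +
      (100 * (s * s + s * w + s + 1) +
        (10 + 2 ^ (s * s + s * w) * (guessCost s w s * (n + 1) + 4))))) ≤ _
    have h1 : n + 1 ≤ (n + 1) ^ 2 := Nat.le_self_pow (by omega) _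
    have h2 : 1 ≤ (n + 1) ^ 2 := Nat.one_le_pow _ _ (by omega)
    have h3 : 200 * (len + 1) * (n + 1) ^ 2 ≤ 200 * (s + 1) * (n + 1) ^ 2 := by gcongr
    have h4 : 100 * (n + 1) ≤ 100 * (n + 1) ^ 2 := by gcongr
    have h5 : 100 * (s * s + s * w + s + 1) ≤ 100 * (s * s + s * w + s + 1) * (n + 1) ^ 2 :=
      Nat.le_mul_of_pos_right _ (by omega)
    have h6 : 2 ^ (s * s + s * w) * (guessCost s w s * (n + 1) + 4) ≤
        2 ^ (s * s + s * w) * (guessCost s w s + 4) * (n + 1) ^ 2 := by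
      rw [Nat.mul_assoc]
      refine Nat.mul_le_mul_left _ ?_
      rw [Nat.add_mul]
      exact Nat.add_le_add (Nat.mul_le_mul_left _ h1) (by omega)
    have h7 : timeFactor s w * (n + 1) ^ 2 = 200 * (s + 1) * (n + 1) ^ 2 + 100 * (n + 1) ^ 2 +
        2500 * (w + 2) ^ 3 * (n + 1) ^ 2 + 100 * (s * s + s * w + s + 1) * (n + 1) ^ 2 +
        10 * (n + 1) ^ 2 + 2 ^ (s * s + s * w) * (guessCost s w s + 4) * (n + 1) ^ 2 := by
      unfold timeFactor; ring
    omega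

/-! ## The problem instances -/

theorem getElem?_flatMap_of_length_eq {α β : Type*} (l : List α) (g : α → List β) {m : ℕ}
    (hg : ∀ x, (g x).length = m) (a : ℕ) {b : ℕ} (hb : b < m) :
    (l.flatMap g)[a * m + b]? = l[a]?.bind fun x => (g x)[b]? := by
  induction l generalizing a with
  | nil => simp
  | cons x l ih =>
    cases a with
    | zero =>
      rw [List.flatMap_cons, List.getElem?_append_left (by rw [hg]; omega)]
      simp
    | succ a =>
      have e : (a + 1) * m + b - m = a * m + b := by
        rw [Nat.succ_mul]; omega
      rw [List.flatMap_cons, List.getElem?_append_right (by rw [hg, Nat.succ_mul]; omega), hg, e,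
        ih a]
      simp

section

variable {P : Type*} [PartialOrder P] {n : ℕ}

theorem length_orderTable (e : Fin n ≃ P) : (orderTable e).length = n * n := by
  simp [orderTable, List.length_flatMap]

open Classical in
/-- The order of the poset as a table on `{0, …, n - 1}`. -/
noncomputable def posetTable (e : Fin n ≃ P) (a b : ℕ) : ℕ :=
  if ∃ (ha : a < n) (hb : b < n), e ⟨a, ha⟩ ≤ e ⟨b, hb⟩ then 1 else 0

theorem posetTable_eq_one (e : Fin n ≃ P) {a b : ℕ} (ha : a < n) (hb : b < n) :
    posetTable e a b = 1 ↔ e ⟨a, ha⟩ ≤ e ⟨b, hb⟩ := by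
  simp [posetTable, ha, hb]

theorem getElem?_orderTable (e : Fin n ≃ P) {a b : ℕ} (ha : a < n) (hb : b < n) :
    (orderTable e)[a * n + b]? = some (posetTable e a b) := by
  classical
  rw [orderTable, getElem?_flatMap_of_length_eq _ _ (m := n) (by simp) a hb]
  simp [ha, hb, posetTable]

theorem isOrderTable_posetTable (e : Fin n ≃ P) : IsOrderTable (posetTable e) n := by
  refine ⟨fun a ha b hb => ?_, fun a ha => ?_, fun a ha b hb c hc => ?_, fun a ha b hb => ?_⟩
  · unfold posetTable; split <;> omega
  · rw [posetTable_eq_one e ha ha]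
  · rw [posetTable_eq_one e ha hb, posetTable_eq_one e hb hc, posetTable_eq_one e ha hc]
    exact le_trans
  · rw [posetTable_eq_one e ha hb, posetTable_eq_one e hb ha]
    intro h1 h2
    have := e.injective (le_antisymm h1 h2)
    simpa using this

theorem widthLE_posetTable (e : Fin n ≃ P) : WidthLE (posetTable e) n (posetWidth P) := by
  classical
  intro m f hf h
  let : Fintype P := Fintype.ofEquiv _ e
  let g : Fin m → P := fun i => e ⟨f i, hf i i.2⟩
  have hne : ∀ i j : Fin m, i ≠ j → ¬ g i ≤ g j := by
    intro i j hij hle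
    exact h i i.2 j j.2 (fun he => hij (Fin.ext he)) ((posetTable_eq_one e _ _).2 hle)
  have hinj : Function.Injective g := by
    intro i j hij
    by_contra hn
    exact hne i j hn hij.le
  refine le_csSup ⟨Fintype.card P, ?_⟩ ⟨Finset.univ.map ⟨g, hinj⟩, ?_, by simp⟩
  · rintro k ⟨A, -, rfl⟩
    exact Finset.card_le_univ A
  · intro x hx y hy hxy hle
    simp only [Finset.coe_map, Finset.coe_univ, Set.image_univ, Set.mem_range,
      Function.Embedding.coeFn_mk] at hx hy
    obtain ⟨i, rfl⟩ := hx
    obtain ⟨j, rfl⟩ := hy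
    exact hne i j (fun h => hxy (h ▸ rfl)) hle

/-- Equality is read as `≤` in both directions, which is legitimate by antisymmetry; thus comparison
bits alone determine the truth value. -/
theorem QFFormula.realize_toFormula {q : ℕ} (ψ : QFFormula q) (v : Empty → P) (s : Fin q → P) :
    @FirstOrder.Language.BoundedFormula.Realize FirstOrder.Language.order P
      (FirstOrder.Language.orderStructure P) _ _ ψ.toFormula v s ↔
      ψ.Holds fun i j => ∃ (hi : i < q) (hj : j < q), s ⟨i, hi⟩ ≤ s ⟨j, hj⟩ := by
  let := FirstOrder.Language.orderStructure P
  have : FirstOrder.Language.order.OrderedStructure P := ⟨fun _ => Iff.rfl⟩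
  induction ψ with
  | eq i j => simp [toFormula, Holds, le_antisymm_iff]
  | le i j => simp [toFormula, Holds]
  | ne i j => simp [toFormula, Holds, le_antisymm_iff]
  | nle i j => simp [toFormula, Holds]
  | and ψ₁ ψ₂ h₁ h₂ => simp [toFormula, Holds, h₁, h₂]
  | or ψ₁ ψ₂ h₁ h₂ => simp [toFormula, Holds, h₁, h₂]

theorem ExSentence.models_iff (φ : ExSentence) (e : Fin n ≃ P) :
    φ.Models P ↔ SatisfiedIn φ.body (posetTable e) n := by
  have h1 : φ.Models P ↔ ∃ s : Fin φ.q → P,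
      φ.body.Holds fun i j => ∃ (hi : i < φ.q) (hj : j < φ.q), s ⟨i, hi⟩ ≤ s ⟨j, hj⟩ := by
    let := FirstOrder.Language.orderStructure P
    unfold Models toSentence FirstOrder.Language.Sentence.Realize
    rw [FirstOrder.Language.BoundedFormula.realize_exs]
    exact exists_congr fun s => φ.body.realize_toFormula _ s
  rw [h1]
  constructor
  · rintro ⟨s, hs⟩
    -- The default `0` at indices from `φ.q` on is never evaluated.
    refine ⟨fun i => if h : i < φ.q then e.symm (s ⟨i, h⟩) else 0, fun i hi => by simp [hi], ?_⟩
    refine (φ.body.holds_congr fun i hi j hj => ?_).1 hs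
    simp only [hi, hj, dif_pos, exists_true_left]
    rw [posetTable_eq_one e (Fin.is_lt _) (Fin.is_lt _)]
    simp
  · rintro ⟨s, hs, h⟩
    refine ⟨fun i => e ⟨s i, hs i i.2⟩, (φ.body.holds_congr fun i hi j hj => ?_).1 h⟩
    rw [posetTable_eq_one e (hs i hi) (hs j hj)]
    simp [hi, hj]

end

/-! ### Computability of the parameter bound, and the theorem -/

theorem primrec_two_pow : Primrec fun n : ℕ => 2 ^ n := by
  have h := Primrec.nat_rec₁ (f := fun _ x : ℕ => x + x) 1
    (Primrec.nat_add.comp Primrec.snd Primrec.snd)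
  refine h.of_eq fun n => ?_
  induction n with
  | zero => rfl
  | succ n ih =>
    show (Nat.rec 1 (fun _ x => x + x) n : ℕ) + Nat.rec 1 (fun _ x => x + x) n = _
    rw [ih, pow_succ]; ring

/-- Sums, products and powers of two are primitive recursive; the bound is composed of these. -/
theorem computable_timeFactor : Computable₂ timeFactor := by
  have s : Primrec fun p : ℕ × ℕ => p.1 := Primrec.fst
  have w : Primrec fun p : ℕ × ℕ => p.2 := Primrec.snd
  have c : ∀ k : ℕ, Primrec fun _ : ℕ × ℕ => k := fun k => Primrec.const k
  have add : ∀ {f g : ℕ × ℕ → ℕ}, Primrec f → Primrec g → Primrec fun p => f p + g p :=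
    fun hf hg => Primrec.nat_add.comp hf hg
  have mul : ∀ {f g : ℕ × ℕ → ℕ}, Primrec f → Primrec g → Primrec fun p => f p * g p :=
    fun hf hg => Primrec.nat_mul.comp hf hg
  have s1 := add s (c 1)
  have w1 := add w (c 1)
  have w2 := add w (c 2)
  have bits := add (mul s s) (mul s w)
  have cost := mul (c 2000) (add (add (add (add bits (c 1)) s1) (mul s1 w1)) (mul (mul s1 s1) s1))
  have total := add (add (add (add (add (mul (c 200) s1) (c 100))
    (mul (c 2500) (mul (mul w2 w2) w2))) (mul (c 100) (add (add bits s) (c 1)))) (c 10))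
    (mul (primrec_two_pow.comp bits) (add cost (c 4)))
  refine Primrec₂.to_comp (Primrec.of_eq total fun p => ?_)
  simp only [timeFactor, guessCost, pow_succ, pow_zero, one_mul]

open Classical in
theorem theorem1p1 :
    ∃ (p : RamProg) (h : ℕ → ℕ → ℕ) (C : ℕ), Computable₂ h ∧
      ∀ (φ : ExSentence) (P : Type*) [PartialOrder P] (n : ℕ) (e : Fin n ≃ P),
        p.OutputsWithin (encodeInstance φ e) (if φ.Models P then 1 else 0)
          (h φ.size (posetWidth P) * (C * max n 1 ^ 2)) := by
  -- The constant `4` comes from `n + 1 ≤ 2 * max n 1`, squared.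
  refine ⟨modelCheck.compile 0 0, timeFactor, 4, computable_timeFactor, ?_⟩
  intro φ P _ n e
  have hlen := length_orderTable e
  have hq : φ.q ≤ φ.size := by unfold ExSentence.size; omega
  have hl : φ.body.encode.length ≤ φ.size := by
    have := φ.body.length_encode_le
    unfold ExSentence.size; omega
  obtain ⟨h1, h2⟩ := modelCheck_spec φ.body (n := n) (w := posetWidth P) (s := φ.size)
    (PState.start (encodeInstance φ e)) (tab := posetTable e) rfl rfl rfl
    (fun a ha => by
      simp only [PState.start]
      rw [List.getD_eq_default]
      simp [encodeInstance, hlen]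
      omega)
    (fun a ha b hb => by
      have h3 := mul_add_lt_mul ha hb
      have h4 : 3 + a * n + b = (a * n + b) + 1 + 1 + 1 := by omega
      simp only [PState.start, encodeInstance, h4, List.getD_cons_succ]
      rw [List.getD_append _ _ _ _ (by omega), List.getD_eq_getElem?_getD,
        getElem?_orderTable e ha hb]
      rfl)
    (fun i hi => by
      have h4 : 3 + n * n + i = (n * n + i) + 1 + 1 + 1 := by omega
      simp only [PState.start, encodeInstance, h4, List.getD_cons_succ]
      rw [List.getD_append_right _ _ _ _ (by omega), hlen, Nat.add_sub_cancel_left,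
        List.getD_eq_getElem _ _ hi])
    (isOrderTable_posetTable e) (widthLE_posetTable e) hq hl
  have hn : (n + 1) ^ 2 ≤ 4 * max n 1 ^ 2 := by
    have : n + 1 ≤ 2 * max n 1 := by omega
    calc (n + 1) ^ 2 ≤ (2 * max n 1) ^ 2 := Nat.pow_le_pow_left this 2
      _ = 4 * max n 1 ^ 2 := by ring
  have hr : (modelCheck.run (PState.start (encodeInstance φ e))).var .res =
      if φ.Models P then 1 else 0 :=
    Eq.trans h1 (if_congr (φ.models_iff e).symm rfl rfl)
  exact PStmt.outputsWithin modelCheck _ hr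
    (h2.trans (Nat.mul_le_mul_left (timeFactor φ.size (posetWidth P)) hn))
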